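/- **Setting.** A *right toroid* is $T(\mathbf r)=\prod_{k\in I}S^1(r_k)=\prod_{k\in I}\mathbb R/2\pi r_k\mathbb Z$, where $I=\{1,\dots,n\}$ with $1\le n<\infty$ or $I=\mathbb Z_{>0}$ ($n=\infty$), and $r_1\ge r_2\ge\cdots>0$ with $\|\mathbf r\|^2=\sum_k r_k^2<\infty$. It carries the product topology and normalised Haar measure. Let $\varpi:\mathbb R^I\to T(\mathbf r)$ be the canonical surjection. A *diagonal* is a translate $\mathbf t+\varpi(\mathbb R\mathbf r)$ of the main diagonal circle (of length $2\pi\|\mathbf r\|$). Put $L_k=2\pi r_k^2/\|\mathbf r\|$, which is $2\pi r_k^2$ when $\|\mathbf r\|=1$. An *allowable map* $\iota:T(\mathbf r)\hookrightarrow T(\mathbf r')$ is the inclusion of a sub-product: it is given by an injection $\iota:I\to I'$ with $r'_{\iota(j)}=r_j$, sends the $j$-th coordinate to the $\iota(j)$-th, and puts the remaining coordinates equal to the identity. A *convex lift* of $\mathfrak p_j\subseteq T(\mathbf r)$ is a compact convex $A_j\subset\mathbb R^I$ (product topology) with $\varpi(A_j)=\mathfrak p_j$, with $\varpi$ injective on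 the interior $\mathring A_j$, and such that every diagonal meets $\varpi(\mathring A_j)$ either not at all or in an open arc of length $L_j$. A *Pythagorean partition* of $T(\mathbf r)$ is a family $(\mathfrak p_j)_{j\in I}$ of subsets such that: the union of the $\mathfrak p_j$ is $T(\mathbf r)$ (for $n=\infty$: is dense in $T(\mathbf r)$); their interiors are pairwise disjoint; each $\mathfrak p_j$ is the closure of its interior; each $\mathfrak p_j$ has a convex lift; and almost every diagonal meets $\mathfrak p_j$ in a closed arc of length $L_j$. Right toroids with allowable maps form a category $\mathfrak T$. Let $\mathfrak{PT}$ be the category of right toroids with a Pythagorean partition, whose morphisms $(T(\mathbf r),\mathfrak P)\to(T(\mathbf r'),\mathfrak P')$ are the allowable maps $\iota$ with $\iota^{-1}(\mathfrak p'_{\iota(j)})=\mathfrak p_j$ for every $j\in I$ and such that for every $k\in I'$ the set $\iota^{-1}(\mathfrak p'_k)$ lies in some $\mathfrak p_j$. A *manifest functor* is a functor $\mathsf P:\mathfrak T\to\mathfrak{PT}$ whose composite with the forgetful functor $\mathfrak{PT}\to\mathfrak T$ is the identity. **Theorem 3.1.** With $\mathbf f_j=2\pi r_j\mathbf e_j$,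 $\mathbf s=\sum_j\mathbf f_j$ and $\mathbf g_j=\frac{r_j^2}{\|\mathbf r\|^2}\mathbf s-\mathbf f_j$, let $\mathbf A_k$ be the parallelotope $$\mathbf A_k=\Big\{\sum_{j\ne k}c_j\mathbf g_j+c_k\tfrac{r_k^2}{\|\mathbf r\|^2}\mathbf s\;:\;0\le c_j\le 1\text{ for all }j\in I\Big\}$$ generated by the $\mathbf g_j$ $(j\neq k)$ and $\frac{r_k^2}{\|\mathbf r\|^2}\mathbf s$, and let $\mathfrak p_k=\varpi(\mathbf A_k)$. 1. For every right toroid $T(\mathbf r)$, $(\mathfrak p_k)_{k\in I}$ is a Pythagorean partition (with $\bigcup_k\mathfrak p_k=T(\mathbf r)$ when $n<\infty$), $\mathbf A_k$ is a convex lift of $\mathfrak p_k$, and every diagonal $\mathbf t+\varpi(\mathbb R\mathbf r)$ with $\mathbf t=\varpi(\mathbf x)$, $x_j/r_j\not\equiv x_k/r_k \pmod{2\pi}$ for all $j\ne k$, meets $\mathfrak p_k$ in a closed arc of length $L_k$. 2. There is exactly one manifest functor $\mathsf P:\mathfrak T\to\mathfrak{PT}$, and it assigns to $T(\mathbf r)$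 the partition $(\mathfrak p_k)_{k\in I}$. -/

import Mathlib

open CategoryTheory MeasureTheory Set

noncomputable section

/-- The data of a right toroid: a dimension `n ∈ {1, 2, …} ∪ {∞}` and radii `r₁ ≥ r₂ ≥ ⋯ > 0`,
square summable when `n = ∞` (for finite `n` summability is automatic). -/
structure RightToroid where
  dim : ℕ∞
  dim_pos : 0 < dim
  r : {k : ℕ // (k : ℕ∞) < dim} → ℝ
  r_pos : ∀ k, 0 < r k
  r_anti : Antitone r
  r_summable : Summable fun k => r k ^ 2

namespace RightToroid

/-- The index set `I`: an initial segment of `ℕ` with `dim` elements (indices start at `0`). -/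
abbrev Idx (T : RightToroid) : Type := {k : ℕ // (k : ℕ∞) < T.dim}

/-- The underlying compact group of `∏ₖ S¹(rₖ)`: the point `(ζₖ)` is recorded by its phases
`ζₖ = exp (i θₖ)`, `θₖ ∈ ℝ / 2πℤ`. The radii enter through the covering `proj`. -/
abbrev Torus (T : RightToroid) : Type := T.Idx → AddCircle (2 * Real.pi)

/-- The canonical surjection `ϖ : ℝⁿ → T(r) = ∏ₖ ℝ / 2π rₖ ℤ`: the `k`-th coordinate is arc length
on the circle of radius `rₖ`, so it is divided by `rₖ` to give the phase. -/
def proj (T : RightToroid) (x : T.Idx → ℝ) : T.Torus :=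
  fun k => ((x k / T.r k : ℝ) : AddCircle (2 * Real.pi))

/-- `∑ₖ rₖ²`. -/
def normSq (T : RightToroid) : ℝ := ∑' k, T.r k ^ 2

/-- The Euclidean norm of the vector of radii. -/
def norm (T : RightToroid) : ℝ := Real.sqrt T.normSq

/-- The unit-speed parametrisation `ℓ ↦ t + ϖ (ℓ r / ‖r‖)` of the diagonal through `t`. -/
def diag (T : RightToroid) (t : T.Torus) (l : ℝ) : T.Torus :=
  t + T.proj (fun k => l / T.norm * T.r k)

/-- The diagonal through `t`, that is, the translate by `t` of the main diagonal circle. Its length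
is `2π ‖r‖`. -/
def diagonal (T : RightToroid) (t : T.Torus) : Set T.Torus := range (T.diag t)

/-- The length `2π rₖ² / ‖r‖` prescribed for the arcs of the `k`-th piece, that is, the fraction
`rₖ² / ‖r‖²` of a diagonal. It equals `2π rₖ²` when `∑ rₖ² = 1`. -/
def arcLength (T : RightToroid) (k : T.Idx) : ℝ := 2 * Real.pi * T.r k ^ 2 / T.norm

/-- The normalised Haar measure of the torus. -/
def haar (T : RightToroid) : Measure T.Torus :=
  haveI : Fact (0 < 2 * Real.pi) := ⟨Real.two_pi_pos⟩
  Measure.infinitePi fun _ => AddCircle.haarAddCircle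

/-- `A` is a compact convex lift of the set `p` by `ϖ`, injective on its interior, such that a
diagonal which meets the open part `ϖ (int A)` of `p` meets it in an open arc of length `L`. -/
structure IsConvexLift (T : RightToroid) (p : Set T.Torus) (L : ℝ) (A : Set (T.Idx → ℝ)) :
    Prop where
  isCompact : IsCompact A
  convex : Convex ℝ A
  image_eq : T.proj '' A = p
  injOn : InjOn T.proj (interior A)
  diagonal : ∀ t, T.diagonal t ∩ T.proj '' interior A = ∅ ∨
    ∃ a : ℝ, T.diagonal t ∩ T.proj '' interior A = T.diag t '' Ioo a (a + L)

/-- Pythagorean partitions `{pⱼ}` of a right toroid. For finite `n` the union of the (closed) pieces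
is closed, and `cover` says that the pieces cover the toroid. -/
structure IsPythagorean (T : RightToroid) (p : T.Idx → Set T.Torus) : Prop where
  cover : closure (⋃ j, p j) = univ
  disjoint : Pairwise fun i j => Disjoint (interior (p i)) (interior (p j))
  regular : ∀ j, p j = closure (interior (p j))
  convex : ∀ j, ∃ A, T.IsConvexLift (p j) (T.arcLength j) A
  diagonal : ∀ j, ∀ᵐ t ∂T.haar, ∃ a : ℝ,
    T.diagonal t ∩ p j = T.diag t '' Icc a (a + T.arcLength j)

/-- `s = (2π rₖ)ₖ = ∑ₖ fₖ`. -/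
def s (T : RightToroid) : T.Idx → ℝ := fun k => 2 * Real.pi * T.r k

/-- `fⱼ = 2π rⱼ eⱼ`. -/
def f (T : RightToroid) (j : T.Idx) : T.Idx → ℝ := Pi.single j (2 * Real.pi * T.r j)

/-- `gⱼ = (rⱼ² / ‖r‖²) s - fⱼ`. -/
def g (T : RightToroid) (j : T.Idx) : T.Idx → ℝ := (T.r j ^ 2 / T.normSq) • T.s - T.f j

/-- The edges at the vertex `0` of the parallelotope `Aₖ`: the `gⱼ` with `j ≠ k`, and
`(rₖ² / ‖r‖²) s`. -/
def edge (T : RightToroid) (k j : T.Idx) : T.Idx → ℝ :=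
  if j = k then (T.r k ^ 2 / T.normSq) • T.s else T.g j

/-- The parallelotope `Aₖ = {∑ⱼ cⱼ uⱼ : 0 ≤ cⱼ ≤ 1}` with edges `uⱼ = edge k j`. -/
def parallelotope (T : RightToroid) (k : T.Idx) : Set (T.Idx → ℝ) :=
  {x | ∃ c : T.Idx → ℝ, (∀ j, c j ∈ Icc (0 : ℝ) 1) ∧ HasSum (fun j => c j • T.edge k j) x}

/-- `pₖ = ϖ (Aₖ)`. -/
def piece (T : RightToroid) (k : T.Idx) : Set T.Torus := T.proj '' T.parallelotope k

/-- An allowable map `T(r) → T(r')`, the inclusion of a sub-product: it is given by an injective map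
of the indices which preserves the radii. -/
@[ext]
structure Hom (T T' : RightToroid) where
  idx : T.Idx ↪ T'.Idx
  r_idx : ∀ j, T'.r (idx j) = T.r j

/-- The map of toroids: `ζ'ₖ = ζⱼ` if `k` is the image of `j`, and `ζ'ₖ = 1` (phase `0`) if `k` is not
in the image. -/
def Hom.incl {T T' : RightToroid} (φ : T.Hom T') (t : T.Torus) : T'.Torus :=
  Function.extend φ.idx t 0

instance : Category RightToroid where
  Hom := Hom
  id T := ⟨Function.Embedding.refl _, fun _ => rfl⟩
  comp φ ψ := ⟨φ.idx.trans ψ.idx, fun j => (ψ.r_idx _).trans (φ.r_idx j)⟩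

/-- Compatibility of partitions `p` of `T` and `q` of `T'` with the inclusion `T ↪ T'`: the piece
of `T'` labelled by a circle of `T` restricts to the piece of `T` with the same label, and the
restriction of every piece of `T'` lies in some piece of `T`. -/
structure Hom.Preserves {T T' : RightToroid} (φ : T.Hom T') (p : T.Idx → Set T.Torus)
    (q : T'.Idx → Set T'.Torus) : Prop where
  preimage_eq : ∀ j, φ.incl ⁻¹' q (φ.idx j) = p j
  subordinate : ∀ k, ∃ j, φ.incl ⁻¹' q k ⊆ p j

theorem Hom.incl_id (T : RightToroid) (t : T.Torus) : Hom.incl (𝟙 T) t = t := by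
  funext k
  exact (Function.Embedding.refl T.Idx).injective.extend_apply t 0 k

theorem Hom.incl_comp {T T' T'' : RightToroid} (φ : T ⟶ T') (ψ : T' ⟶ T'') (t : T.Torus) :
    Hom.incl (φ ≫ ψ) t = Hom.incl ψ (Hom.incl φ t) := by
  funext k
  change Function.extend (fun j => ψ.idx (φ.idx j)) t 0 k =
    Function.extend ψ.idx (Function.extend φ.idx t 0) 0 k
  by_cases hk : ∃ k', ψ.idx k' = k
  · obtain ⟨k', rfl⟩ := hk
    rw [ψ.idx.injective.extend_apply]
    by_cases hj : ∃ j, φ.idx j = k'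
    · obtain ⟨j, rfl⟩ := hj
      rw [φ.idx.injective.extend_apply]
      exact (ψ.idx.injective.comp φ.idx.injective).extend_apply t 0 j
    · rw [Function.extend_apply' _ _ _ hj, Function.extend_apply']
      · rfl
      · rintro ⟨j, h⟩
        exact hj ⟨j, ψ.idx.injective h⟩
  · rw [Function.extend_apply' _ _ _ hk, Function.extend_apply']
    rintro ⟨j, h⟩
    exact hk ⟨_, h⟩

theorem Hom.preserves_id (T : RightToroid) (p : T.Idx → Set T.Torus) :
    Hom.Preserves (𝟙 T) p p := by
  have h : Hom.incl (𝟙 T) = id := funext (Hom.incl_id T)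
  refine ⟨fun j => ?_, fun k => ⟨k, ?_⟩⟩
  · rw [h]; rfl
  · rw [h]; exact subset_rfl

theorem Hom.preserves_comp {T T' T'' : RightToroid} {φ : T ⟶ T'} {ψ : T' ⟶ T''}
    {p : T.Idx → Set T.Torus} {q : T'.Idx → Set T'.Torus} {u : T''.Idx → Set T''.Torus}
    (hφ : Hom.Preserves φ p q) (hψ : Hom.Preserves ψ q u) : Hom.Preserves (φ ≫ ψ) p u := by
  have h : Hom.incl (φ ≫ ψ) = Hom.incl ψ ∘ Hom.incl φ := funext (Hom.incl_comp φ ψ)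
  refine ⟨fun j => ?_, fun k => ?_⟩
  · rw [h, preimage_comp, ← hφ.preimage_eq j, ← hψ.preimage_eq (φ.idx j)]
    rfl
  · obtain ⟨k', hk'⟩ := hψ.subordinate k
    obtain ⟨j, hj⟩ := hφ.subordinate k'
    refine ⟨j, ?_⟩
    rw [h, preimage_comp]
    exact (preimage_mono hk').trans hj

end RightToroid

/-- A right toroid with a Pythagorean partition. -/
structure PartitionedToroid where
  toroid : RightToroid
  part : toroid.Idx → Set toroid.Torus
  isPythagorean : toroid.IsPythagorean part

namespace PartitionedToroid

/-- Morphisms of partitioned right toroids: the allowable maps which preserve the partitions. -/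
@[ext]
structure Hom (X Y : PartitionedToroid) where
  hom : X.toroid ⟶ Y.toroid
  preserves : RightToroid.Hom.Preserves hom X.part Y.part

instance : Category PartitionedToroid where
  Hom := Hom
  id X := ⟨𝟙 X.toroid, RightToroid.Hom.preserves_id _ _⟩
  comp φ ψ := ⟨φ.hom ≫ ψ.hom, RightToroid.Hom.preserves_comp φ.preserves ψ.preserves⟩

/-- The functor which forgets the partition. -/
def forget : PartitionedToroid ⥤ RightToroid where
  obj X := X.toroid
  map φ := φ.hom

end PartitionedToroid

/-- A manifest functor from right toroids to partitioned right toroids: a functor which adds a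
partition to each toroid and keeps the allowable maps. -/
def IsManifest (P : RightToroid ⥤ PartitionedToroid) : Prop :=
  P ⋙ PartitionedToroid.forget = 𝟭 RightToroid

end

open Filter Topology

noncomputable section

/-! Divide the k-th coordinate by 2πr_k. The period lattice becomes ℤ^I, the diagonal direction
(1,1,…), and with ω_k = r_k², Ω = ∑ω, h(y) = ∑ω_i y_i, the parallelotope A_k becomes `diagBox ω k`:
0 ≤ y_k − y_i ≤ 1 and 0 ≤ h(y) ≤ ω_k. Along a diagonal the differences y_k − y_i are constant and h
grows with slope Ω, while the lift of a generic diagonal with all y_k − y_i in (0,1) is unique up to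
constant shifts. So the piece cuts out the fraction w = ω_k/Ω of it.

Existence. On a generic diagonal the arcs of two pieces share at most end points, whence the
interiors are disjoint. Finite products are covered by an extremal choice of lift
(`iUnion_image_diagBox`), infinite ones up to closure because finitely supported points are dense.
The partition restricts to sub-products because on the box of k a coordinate i ≠ k lies strictly
between −1 and 1, so it vanishes when it is integral (`extend_mem_image_diagBox_iff`).

Uniqueness, finite case. Induct on the number of circles: compatibility fixes the pieces on every
coordinate subtorus. The subtorus without the circle k is covered by the other pieces, so the
interior of a lift of piece k avoids y_k ∈ ℤ, and the lift can be moved into 0 ≤ y_k ≤ 1. `IsTile`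
records what is then known: chords of length w, packing, the strip, the sections by the hyperplanes
y_i = 0. It suffices to put the tile inside a lattice translate of the model
(`IsTile.exists_sub_mem_diagBox`), since two regular partitions, one refining the other, agree.

For at least three circles the sections show that the tile has exactly one lattice point with y_k =
0, say 0, and contains the germs there of the model cone's sections. The bottom edges of the model
consist, near 0, of lower ends of full chords; as no chord is longer than w, this forces 0 ≤ h ≤ ω_k
on the tile. A tile point with y_l > y_k would make a point of the wall y_k = y_l the end of a chord
leaving this slab. Reflecting at e_k/2 gives the remaining inequalities y_k − y_l ≤ 1. Two circles
need a planar argument.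

Uniqueness, infinite case. Truncating an interior point of a piece to many coordinates stays in the
piece and lands in a finite sub-product, so the closed pieces are determined. -/

/-- The model parallelotope with distinguished index `k` for the weights `ω`, in coordinates in which
the period lattice is `ℤ^ι` and the diagonal direction is `(1, 1, …)`. -/
def diagBox {ι : Type*} (ω : ι → ℝ) (k : ι) : Set (ι → ℝ) :=
  {y | (∀ i, y k - y i ∈ Icc (0 : ℝ) 1) ∧ ∑' i, ω i * y i ∈ Icc 0 (ω k)}

/-- The properties of a convex lift of the piece with index `k` from which it is identified with a
translate of `diagBox ω k`. -/
structure IsTile {ι : Type*} [Fintype ι] (ω : ι → ℝ) (k : ι) (A : Set (ι → ℝ)) : Prop where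
  pos : ∀ i, 0 < ω i
  isCompact : IsCompact A
  convex : Convex ℝ A
  nonempty : (interior A).Nonempty
  chord : ∀ y ∈ A, ∃ τ ∈ Icc 0 (ω k / ∑ i, ω i),
    (fun i => y i - τ) ∈ A ∧ (fun i => y i - τ + ω k / ∑ i, ω i) ∈ A
  chord_le : ∀ (y : ι → ℝ) (τ : ℝ), y ∈ A → (fun i => y i + τ) ∈ A → τ ≤ ω k / ∑ i, ω i
  packing : ∀ (y : ι → ℝ) (τ : ℝ) (z : ι → ℤ), y ∈ interior A →
    (fun i => y i + τ + z i) ∈ interior A → ∃ m : ℤ, ∀ i, z i = m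
  strip : ∀ y ∈ A, y k ∈ Icc (0 : ℝ) 1
  slice : ∀ i, i ≠ k → ∀ y : ι → ℝ, y i = 0 →
    ((∃ z : ι → ℤ, (fun j => y j + z j) ∈ A) ↔
      ∃ z : ι → ℤ, z i = 0 ∧ (∀ l, l ≠ i → (y k + z k) - (y l + z l) ∈ Icc (0 : ℝ) 1) ∧
        ∑ j, ω j * (y j + z j) ∈ Icc 0 (ω k))

/-- The smallness condition under which points of a coordinate hyperplane are only affected by the
vertices `0` and `e k` of the model parallelotopes. -/
def IsSmall {ι : Type*} [Fintype ι] (ω : ι → ℝ) (y : ι → ℝ) : Prop :=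
  (∀ i, |y i| < 1 / 4) ∧ ∀ l, |∑ j, ω j * y j| < ω l

/-! ### Tiles: behaviour near lattice points, chords, symmetries -/

section
variable {ι : Type*} [Fintype ι] {ω : ι → ℝ} {k : ι} {A : Set (ι → ℝ)}

theorem isOpen_setOf_isSmall (ω : ι → ℝ) : IsOpen {y : ι → ℝ | IsSmall ω y} := by
  have : {y : ι → ℝ | IsSmall ω y} =
      (⋂ i, {y | |y i| < 1 / 4}) ∩ ⋂ l, {y | |∑ j, ω j * y j| < ω l} := by
    ext y; simp [IsSmall]
  rw [this]
  refine (isOpen_iInter_of_finite fun i => ?_).inter (isOpen_iInter_of_finite fun l => ?_)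
  · exact isOpen_lt (by fun_prop) continuous_const
  · exact isOpen_lt (by fun_prop) continuous_const

theorem isSmall_zero (hω : ∀ i, 0 < ω i) : IsSmall ω (0 : ι → ℝ) :=
  ⟨by simp, by simpa using hω⟩

theorem eventually_isSmall_smul (hω : ∀ i, 0 < ω i) (y : ι → ℝ) :
    ∀ᶠ s in 𝓝[>] (0 : ℝ), IsSmall ω (s • y) := by
  have h : Tendsto (fun s : ℝ => s • y) (𝓝[>] 0) (𝓝 0) := by
    have : Tendsto (fun s : ℝ => s • y) (𝓝 0) (𝓝 ((0 : ℝ) • y)) := by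
      exact Continuous.tendsto (by fun_prop) 0
    rw [zero_smul] at this
    exact this.mono_left nhdsWithin_le_nhds
  exact h.eventually ((isOpen_setOf_isSmall ω).mem_nhds (isSmall_zero hω))

namespace IsTile

theorem sum_pos (h : IsTile ω k A) : 0 < ∑ i, ω i :=
  Finset.sum_pos (fun i _ => h.pos i) ⟨k, Finset.mem_univ k⟩

theorem ratio_pos (h : IsTile ω k A) : 0 < ω k / ∑ i, ω i := div_pos (h.pos k) h.sum_pos

theorem ratio_lt_one (h : IsTile ω k A) {i : ι} (hi : i ≠ k) : ω k / ∑ i, ω i < 1 := by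
  classical
  rw [div_lt_one h.sum_pos]
  exact Finset.single_lt_sum hi (Finset.mem_univ _) (Finset.mem_univ _) (h.pos i)
    fun j _ _ => (h.pos j).le

theorem subset_closure (h : IsTile ω k A) : A ⊆ closure (interior A) := by
  rw [h.convex.closure_interior_eq_closure_of_nonempty_interior h.nonempty]
  exact _root_.subset_closure

/-- A point of a coordinate hyperplane near `0` which is covered by the lattice translates of the
tile lies in the cone of the model at the vertex `0` or in the opposite cone. -/
theorem cone_of_isSmall (h : IsTile ω k A) {i : ι} (hi : i ≠ k) {y : ι → ℝ} (hy : y i = 0)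
    (hs : IsSmall ω y) (hA : ∃ z : ι → ℤ, (fun j => y j + z j) ∈ A) :
    ((∀ l, l ≠ i → 0 ≤ y k - y l) ∧ 0 ≤ ∑ j, ω j * y j) ∨
      ((∀ l, l ≠ i → y k - y l ≤ 0) ∧ ∑ j, ω j * y j ≤ 0) := by
  classical
  -- Smallness leaves N_k − N_l ∈ {0, 1} for l ≠ i and bounds h(N) on both sides. With N_i = 0 only
  -- N = 0 and N = e_k survive; these are the opposite vertices of the model.
  obtain ⟨N, hN, hc, hh⟩ := (h.slice i hi y hy).1 hA
  have hsum : ∑ j, ω j * (y j + N j) = ∑ j, ω j * y j + ∑ j, ω j * (N j : ℝ) := by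
    rw [← Finset.sum_add_distrib]; exact Finset.sum_congr rfl fun j _ => by ring
  rw [hsum] at hh
  have hNl : ∀ l, l ≠ i → N k - 1 ≤ N l ∧ N l ≤ N k := by
    intro l hl
    have h1 := hc l hl
    have h2 := abs_lt.1 (hs.1 k)
    have h3 := abs_lt.1 (hs.1 l)
    have h4 : ((N k - N l : ℤ) : ℝ) < ((2 : ℤ) : ℝ) := by push_cast; linarith [h1.2]
    have h5 : ((-1 : ℤ) : ℝ) < ((N k - N l : ℤ) : ℝ) := by push_cast; linarith [h1.1]
    have h4 := Int.cast_lt.1 h4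
    have h5 := Int.cast_lt.1 h5
    omega
  rcases le_or_gt (N k) 0 with hk | hk
  · have hneg : ∀ j, N j ≤ 0 := by
      intro j
      by_cases hj : j = i
      · rw [hj, hN]
      · exact (hNl j hj).2.trans hk
    have hzero : ∀ j, N j = 0 := by
      intro j
      have h1 : ∑ l, ω l * (N l : ℝ) ≤ ω j * N j := by
        have := Finset.single_le_sum (f := fun l => -(ω l * (N l : ℝ))) (s := Finset.univ)
          (fun l _ => by
            have : (N l : ℝ) ≤ 0 := by exact_mod_cast hneg l
            nlinarith [h.pos l]) (Finset.mem_univ j)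
        simp only [Finset.sum_neg_distrib] at this
        linarith
      have h2 := abs_lt.1 (hs.2 j)
      have h3 : ω j * (-1 : ℝ) < ω j * N j := by linarith [hh.1]
      have h4 : ((-1 : ℤ) : ℝ) < (N j : ℝ) := by
        push_cast; exact lt_of_mul_lt_mul_left h3 (h.pos j).le
      have := Int.cast_lt.1 h4
      have := hneg j
      omega
    left
    refine ⟨fun l hl => ?_, ?_⟩
    · have := (hc l hl).1
      simpa [hzero] using this
    · have := hh.1
      simpa [hzero] using this
  · have hnn : ∀ j, 0 ≤ N j := by
      intro j
      by_cases hj : j = i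
      · rw [hj, hN]
      · have := (hNl j hj).1
        omega
    have hnn' : ∀ j, 0 ≤ ω j * (N j : ℝ) := fun j =>
      mul_nonneg (h.pos j).le (by exact_mod_cast hnn j)
    have hk1 : N k = 1 := by
      have h1 := Finset.single_le_sum (f := fun l => ω l * (N l : ℝ)) (s := Finset.univ)
        (fun l _ => hnn' l) (Finset.mem_univ k)
      have h2 := abs_lt.1 (hs.2 k)
      have h3 : ω k * (N k : ℝ) < ω k * 2 := by linarith [hh.2]
      have h4 : ((N k : ℤ) : ℝ) < ((2 : ℤ) : ℝ) := by
        push_cast; exact lt_of_mul_lt_mul_left h3 (h.pos k).le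
      have := Int.cast_lt.1 h4
      omega
    have hl0 : ∀ l, l ≠ k → N l = 0 := by
      intro l hl
      have h1 := Finset.add_le_sum (f := fun l => ω l * (N l : ℝ)) (s := Finset.univ)
        (fun l _ => hnn' l) (Finset.mem_univ k) (Finset.mem_univ l) hl.symm
      have h2 := abs_lt.1 (hs.2 l)
      rw [hk1] at h1
      push_cast at h1
      have h3 : ω l * (N l : ℝ) < ω l * 1 := by linarith [hh.2]
      have h4 : ((N l : ℤ) : ℝ) < ((1 : ℤ) : ℝ) := by
        push_cast; exact lt_of_mul_lt_mul_left h3 (h.pos l).le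
      have := Int.cast_lt.1 h4
      have := hnn l
      omega
    right
    refine ⟨fun l hl => ?_, ?_⟩
    · by_cases hlk : l = k
      · simp [hlk]
      · have := (hc l hl).2
        rw [hk1, hl0 l hlk] at this
        push_cast at this
        linarith
    · have h1 : ∑ j, ω j * (N j : ℝ) = ω k := by
        rw [Finset.sum_eq_single k]
        · simp [hk1]
        · intro l _ hl; simp [hl0 l hl]
        · simp
      linarith [hh.2]

/-- Small points of the cone at `0` in a coordinate hyperplane are covered. -/
theorem exists_mem_of_cone (h : IsTile ω k A) {i : ι} (hi : i ≠ k) {y : ι → ℝ} (hy : y i = 0)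
    (hs : IsSmall ω y) (hc : ∀ l, l ≠ i → 0 ≤ y k - y l) (hh : 0 ≤ ∑ j, ω j * y j) :
    ∃ z : ι → ℤ, (fun j => y j + z j) ∈ A := by
  refine (h.slice i hi y hy).2 ⟨0, rfl, fun l hl => ⟨by simpa using hc l hl, ?_⟩, ?_, ?_⟩
  · have h1 := abs_lt.1 (hs.1 k)
    have h2 := abs_lt.1 (hs.1 l)
    simp; linarith
  · simpa using hh
  · simpa using (abs_lt.1 (hs.2 k)).2.le

/-- Small points of the opposite cone in a coordinate hyperplane are covered. -/
theorem exists_mem_of_neg_cone (h : IsTile ω k A) {i : ι} (hi : i ≠ k) {y : ι → ℝ} (hy : y i = 0)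
    (hs : IsSmall ω y) (hc : ∀ l, l ≠ i → y k - y l ≤ 0) (hh : ∑ j, ω j * y j ≤ 0) :
    ∃ z : ι → ℤ, (fun j => y j + z j) ∈ A := by
  classical
  -- Adding e_k turns the opposite cone at 0 into the cone of the model at its vertex e_k.
  refine (h.slice i hi y hy).2 ⟨Pi.single k 1, by simp [hi], fun l hl => ?_, ?_⟩
  · by_cases hlk : l = k
    · simp [hlk]
    · have h1 := abs_lt.1 (hs.1 k)
      have h2 := abs_lt.1 (hs.1 l)
      have h3 := hc l hl
      simp only [Pi.single_eq_same, Pi.single_eq_of_ne hlk, mem_Icc]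
      push_cast
      constructor <;> linarith
  · have : ∑ j, ω j * (y j + ((Pi.single k 1 : ι → ℤ) j : ℝ)) = ∑ j, ω j * y j + ω k := by
      simp only [mul_add, Finset.sum_add_distrib]
      congr 1
      rw [Finset.sum_eq_single k]
      · simp
      · intro l _ hl; simp [hl]
      · simp
    rw [this]
    have := abs_lt.1 (hs.2 k)
    constructor <;> linarith

/-- The packing property, for a point of the closed tile. -/
theorem packing_mem (h : IsTile ω k A) {y : ι → ℝ} {τ : ℝ} {z : ι → ℤ} (hy : y ∈ interior A)
    (hz : (fun i => y i + τ + z i) ∈ A) : ∃ m : ℤ, ∀ i, z i = m := by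
  -- Approximate the point of the closed tile by interior points; the same small displacement keeps
  -- `y` in the interior.
  have hopen : IsOpen ((fun v : ι → ℝ => (fun i => v i - τ - z i : ι → ℝ)) ⁻¹' interior A) :=
    isOpen_interior.preimage (by fun_prop)
  obtain ⟨v, hv, hvA⟩ := mem_closure_iff.1 (h.subset_closure hz) _ hopen (by
    simp only [mem_preimage]
    convert hy using 1
    funext i; ring)
  refine h.packing _ τ z hv ?_
  convert hvA using 1
  funext i; ring

/-- A boundary point of a tile on a diagonal line through the interior is an end of a chord. -/
theorem endpoint (h : IsTile ω k A) {p : ι → ℝ} {σ : ℝ} (hp : p ∈ A) (hp' : p ∉ interior A)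
    (hσ : (fun i => p i + σ) ∈ interior A) :
    (fun i => p i + ω k / ∑ i, ω i) ∈ A ∨ (fun i => p i - ω k / ∑ i, ω i) ∈ A := by
  -- Were `p` strictly inside its chord, it would lie strictly between the interior point `p + σ`
  -- and the chord end on the other side, hence be interior.
  obtain ⟨τ, ⟨h0, h1⟩, ha, hb⟩ := h.chord p hp
  rcases h0.eq_or_lt with rfl | h0
  · left; simpa using hb
  rcases h1.eq_or_lt with rfl | h1
  · right; simpa using ha
  exfalso
  apply hp'
  set w := ω k / ∑ i, ω i
  rcases lt_trichotomy σ 0 with hs | hs | hs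
  · refine h.convex.openSegment_interior_self_subset_interior hσ hb
      ⟨(w - τ) / (w - τ - σ), -σ / (w - τ - σ), ?_, ?_, ?_, ?_⟩
    · apply div_pos <;> linarith
    · apply div_pos <;> linarith
    · rw [← add_div, div_eq_one_iff_eq (by linarith)]; ring
    · funext i
      have : w - τ - σ ≠ 0 := by linarith
      simp only [Pi.add_apply, Pi.smul_apply, smul_eq_mul]
      field_simp
      ring
  · rw [hs] at hσ; simpa using hσ
  · refine h.convex.openSegment_interior_self_subset_interior hσ ha
      ⟨τ / (σ + τ), σ / (σ + τ), ?_, ?_, ?_, ?_⟩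
    · apply div_pos <;> linarith
    · apply div_pos <;> linarith
    · rw [← add_div, div_eq_one_iff_eq (by linarith)]; ring
    · funext i
      have : σ + τ ≠ 0 := by linarith
      simp only [Pi.add_apply, Pi.smul_apply, smul_eq_mul]
      field_simp
      ring

/-- Translation of a tile by a lattice vector. -/
theorem translate (h : IsTile ω k A) (z : ι → ℤ) (hz : z k = 0) :
    IsTile ω k ((fun y : ι → ℝ => (fun i => y i + z i : ι → ℝ)) ⁻¹' A) := by
  let e : (ι → ℝ) ≃ₜ (ι → ℝ) := Homeomorph.addRight (fun i => (z i : ℝ))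
  have he : ∀ y i, e y i = y i + z i := fun _ _ => rfl
  have hint : interior (e ⁻¹' A) = e ⁻¹' interior A := (e.preimage_interior A).symm
  change IsTile ω k (e ⁻¹' A)
  refine ⟨h.pos, e.isCompact_preimage.2 h.isCompact, ?_, ?_, ?_, ?_, ?_, ?_, ?_⟩
  · exact h.convex.translate_preimage_left _
  · rw [hint]; exact h.nonempty.preimage e.surjective
  · intro y hy
    obtain ⟨τ, hτ, ha, hb⟩ := h.chord _ hy
    refine ⟨τ, hτ, ?_, ?_⟩
    · change (fun i => _) ∈ A
      convert ha using 1; funext i; simp [e]; ring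
    · change (fun i => _) ∈ A
      convert hb using 1; funext i; simp [e]; ring
  · intro y τ hy hy'
    refine h.chord_le _ τ hy ?_
    change (fun i => _) ∈ A at hy'
    convert hy' using 1; funext i; simp [e]; ring
  · intro y τ z' hy hy'
    rw [hint] at hy hy'
    refine h.packing _ τ z' hy ?_
    change (fun i => _) ∈ interior A at hy'
    convert hy' using 1; funext i; simp [e]; ring
  · intro y hy
    have := h.strip _ hy
    simpa [e, hz] using this
  · intro i hi y hy
    rw [← h.slice i hi y hy]
    constructor
    · rintro ⟨z', hz'⟩
      refine ⟨z' + z, ?_⟩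
      change (fun i => _) ∈ A at hz'
      convert hz' using 1; funext i; simp [e]; ring
    · rintro ⟨z', hz'⟩
      refine ⟨z' - z, ?_⟩
      change (fun i => _) ∈ A
      convert hz' using 1; funext i; rw [he]; simp; ring

/-- The reflection of a tile at the midpoint of the edge from `0` to `e k`. -/
theorem reflect [DecidableEq ι] (h : IsTile ω k A) :
    IsTile ω k ((fun y : ι → ℝ => (Pi.single k 1 : ι → ℝ) - y) ⁻¹' A) := by
  let e : (ι → ℝ) ≃ₜ (ι → ℝ) := Homeomorph.subLeft (Pi.single k 1 : ι → ℝ)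
  have hint : interior (e ⁻¹' A) = e ⁻¹' interior A := (e.preimage_interior A).symm
  change IsTile ω k (e ⁻¹' A)
  refine ⟨h.pos, e.isCompact_preimage.2 h.isCompact, ?_, ?_, ?_, ?_, ?_, ?_, ?_⟩
  · intro x hx y hy a b ha hb hab
    change _ - _ ∈ A
    have := h.convex hx hy ha hb hab
    convert this using 1
    funext i
    have hb' : b = 1 - a := by linarith
    simp [e, hb']
    ring
  · rw [hint]; exact h.nonempty.preimage e.surjective
  · intro y hy
    obtain ⟨τ, hτ, ha, hb⟩ := h.chord _ hy
    refine ⟨ω k / ∑ i, ω i - τ, ⟨by linarith [hτ.2], by linarith [hτ.1]⟩, ?_, ?_⟩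
    · change _ - _ ∈ A
      convert hb using 1; funext i; simp [e]; ring
    · change _ - _ ∈ A
      convert ha using 1; funext i; simp [e]; ring
  · intro y τ hy hy'
    refine h.chord_le _ τ hy' ?_
    change _ - _ ∈ A at hy
    convert hy using 1; funext i; simp [e]; ring
  · intro y τ z hy hy'
    rw [hint] at hy hy'
    refine h.packing _ τ z hy' ?_
    change _ - _ ∈ interior A at hy
    convert hy using 1; funext i; simp [e]; ring
  · intro y hy
    have := h.strip _ hy
    simp [e] at this
    exact ⟨by linarith [this.2], by linarith [this.1]⟩
  · intro i hi y hy
    have hs := h.slice i hi (-y) (by simp [hy])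
    have h1 : (∃ z : ι → ℤ, (fun j => y j + z j) ∈ e ⁻¹' A) ↔
        ∃ z : ι → ℤ, (fun j => (-y) j + z j) ∈ A := by
      constructor
      · rintro ⟨z, hz⟩
        refine ⟨Pi.single k 1 - z, ?_⟩
        change _ - _ ∈ A at hz
        convert hz using 1
        funext j
        by_cases hj : j = k
        · subst hj; simp; ring
        · simp [hj]; ring
      · rintro ⟨z, hz⟩
        refine ⟨Pi.single k 1 - z, ?_⟩
        change _ - _ ∈ A
        convert hz using 1
        funext j
        by_cases hj : j = k
        · subst hj; simp; ring
        · simp [hj]; ring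
    rw [h1, hs]
    have h2 : ∀ z : ι → ℤ, ∑ j, ω j * (y j + ((Pi.single k 1 - z : ι → ℤ) j : ℝ)) =
        ω k - ∑ j, ω j * (-y j + z j) := by
      intro z
      have : ω k = ∑ j, ω j * (((Pi.single k 1 : ι → ℤ) j : ℤ) : ℝ) := by
        rw [Finset.sum_eq_single k]
        · simp
        · intro l _ hl; simp [hl]
        · simp
      conv_rhs => rw [this]
      rw [← Finset.sum_sub_distrib]
      refine Finset.sum_congr rfl fun j _ => ?_
      simp only [Pi.sub_apply]
      push_cast
      ring
    have h3 : ∀ z : ι → ℤ, ∑ j, ω j * (-y j + ((Pi.single k 1 - z : ι → ℤ) j : ℝ)) =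
        ω k - ∑ j, ω j * (y j + z j) := by
      intro z
      have : ω k = ∑ j, ω j * (((Pi.single k 1 : ι → ℤ) j : ℤ) : ℝ) := by
        rw [Finset.sum_eq_single k]
        · simp
        · intro l _ hl; simp [hl]
        · simp
      conv_rhs => rw [this]
      rw [← Finset.sum_sub_distrib]
      refine Finset.sum_congr rfl fun j _ => ?_
      simp only [Pi.sub_apply]
      push_cast
      ring
    constructor
    · rintro ⟨z, hz, hc, hh⟩
      refine ⟨Pi.single k 1 - z, by simp [hz, hi], fun l hl => ?_, ?_⟩
      · by_cases hlk : l = k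
        · simp [hlk]
        · have := hc l hl
          simp [hlk] at this ⊢
          constructor <;> linarith [this.1, this.2]
      · rw [h2]
        simp only [Pi.neg_apply] at hh
        exact ⟨by linarith [hh.2], by linarith [hh.1]⟩
    · rintro ⟨z, hz, hc, hh⟩
      refine ⟨Pi.single k 1 - z, by simp [hz, hi], fun l hl => ?_, ?_⟩
      · by_cases hlk : l = k
        · simp [hlk]
        · have := hc l hl
          simp [hlk] at this ⊢
          constructor <;> linarith [this.1, this.2]
      · simp only [Pi.neg_apply]
        rw [h3]
        exact ⟨by linarith [hh.2], by linarith [hh.1]⟩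

end IsTile
end
-- The lattice point of a tile in the face y_k = 0
section
variable {ι : Type*} [Fintype ι] {ω : ι → ℝ} {k : ι} {A : Set (ι → ℝ)}

namespace IsTile

theorem finite_lattice (h : IsTile ω k A) {B : Set (ι → ℝ)} (hB : Bornology.IsBounded B) :
    {z : ι → ℤ | ∃ y ∈ B, (fun j => y j + z j) ∈ A}.Finite := by
  obtain ⟨R, hR⟩ := (isBounded_iff_forall_norm_le).1 h.isCompact.isBounded
  obtain ⟨R', hR'⟩ := (isBounded_iff_forall_norm_le).1 hB
  refine (Set.Finite.pi' (t := fun _ : ι => Icc (⌊-(R + R')⌋) ⌈R + R'⌉)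
    fun _ => Set.finite_Icc _ _).subset ?_
  rintro z ⟨y, hy, hz⟩ j
  have h1 := abs_le.1 ((norm_le_pi_norm _ j).trans (hR _ hz))
  have h2 := abs_le.1 ((norm_le_pi_norm _ j).trans (hR' _ hy))
  constructor
  · exact Int.floor_le_iff.2 (by linarith) 
  · exact Int.le_ceil_iff.2 (by linarith)

/-- Along a ray of the cone of the model at `0` in a coordinate hyperplane there is a fixed
translate of the tile which contains points arbitrarily close to `0`. -/
theorem exists_lattice_mem (h : IsTile ω k A) {i : ι} (hi : i ≠ k) {y : ι → ℝ} (hy : y i = 0)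
    (hc : ∀ l, l ≠ i → 0 ≤ y k - y l) (hh : 0 ≤ ∑ j, ω j * y j) (hk : 0 < y k) :
    ∃ z : ι → ℤ, z k = 0 ∧ (fun j => (z j : ℝ)) ∈ A ∧
      ∃ᶠ s in 𝓝[>] (0 : ℝ), (fun j => s * y j + z j) ∈ A := by
  have hev : ∀ᶠ s in 𝓝[>] (0 : ℝ), ∃ z : ι → ℤ, (fun j => s * y j + z j) ∈ A := by
    filter_upwards [eventually_isSmall_smul h.pos y, self_mem_nhdsWithin] with s hs hs0
    have hs0 : 0 < s := hs0
    refine h.exists_mem_of_cone (y := s • y) hi (by simp [hy]) hs (fun l hl => ?_) ?_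
    · have := mul_nonneg hs0.le (hc l hl)
      simp only [Pi.smul_apply, smul_eq_mul]; linarith
    · have := mul_nonneg hs0.le hh
      rw [Finset.mul_sum] at this
      refine this.trans_eq ?_
      refine Finset.sum_congr rfl fun j _ => ?_
      simp only [Pi.smul_apply, smul_eq_mul]; ring
  have hlt : ∀ᶠ s in 𝓝[>] (0 : ℝ), s < min 1 (1 / y k) :=
    nhdsWithin_le_nhds (Iio_mem_nhds (by positivity))
  have hbdd : Bornology.IsBounded ((fun s : ℝ => s • y) '' Icc 0 1) :=
    (isCompact_Icc.image (by fun_prop)).isBounded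
  have hfin := h.finite_lattice hbdd
  -- Pigeonhole: only finitely many translates reach the bounded segment, so one of them is used
  -- arbitrarily close to 0.
  have hfr : ∃ z : ι → ℤ, ∃ᶠ s in 𝓝[>] (0 : ℝ), (fun j => s * y j + z j) ∈ A ∧
      s < min 1 (1 / y k) ∧ 0 < s := by
    by_contra hcon
    simp only [not_exists, not_frequently] at hcon
    have h2 := (Filter.eventually_all_finite hfin).2 fun z _ => hcon z
    obtain ⟨s, ⟨⟨z, hz⟩, h2⟩, h3, h4⟩ := ((hev.and h2).and (hlt.and self_mem_nhdsWithin)).exists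
    exact h2 z ⟨s • y, ⟨s, ⟨le_of_lt h4, (h3.trans_le (min_le_left _ _)).le⟩, rfl⟩, hz⟩
      ⟨hz, h3, h4⟩
  obtain ⟨z, hz⟩ := hfr
  refine ⟨z, ?_, ?_, hz.mono fun s hs => hs.1⟩
  · obtain ⟨s, h1, h2, h3⟩ := hz.exists
    have h4 := h.strip _ h1
    -- As 0 < s y_k < 1, the strip leaves only the integer 0 for `z k`.
    have h5 : s * y k < 1 := by
      have := h2.trans_le (min_le_right _ _)
      rwa [lt_div_iff₀ hk] at this
    have h6 : 0 < s * y k := by positivity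
    have h7 : ((z k : ℤ) : ℝ) < ((1 : ℤ) : ℝ) := by push_cast; linarith [h4.2]
    have h8 : ((-1 : ℤ) : ℝ) < ((z k : ℤ) : ℝ) := by push_cast; linarith [h4.1]
    have h7 := Int.cast_lt.1 h7
    have h8 := Int.cast_lt.1 h8
    omega
  · have ht : Tendsto (fun s : ℝ => (fun j => s * y j + z j : ι → ℝ)) (𝓝[>] 0)
        (𝓝 (fun j => (z j : ℝ))) := by
      have : Tendsto (fun s : ℝ => (fun j => s * y j + z j : ι → ℝ)) (𝓝 0)
        (𝓝 (fun j => 0 * y j + (z j : ℝ))) := Continuous.tendsto (by fun_prop) 0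
      simp only [zero_mul, zero_add] at this
      exact this.mono_left nhdsWithin_le_nhds
    exact h.isCompact.isClosed.mem_of_frequently_of_tendsto (hz.mono fun s hs => hs.1) ht

theorem smul_mem (h : IsTile ω k A) (h0 : (0 : ι → ℝ) ∈ A) {y : ι → ℝ} (hy : y ∈ A) {s : ℝ}
    (hs0 : 0 ≤ s) (hs1 : s ≤ 1) : s • y ∈ A := by
  have := h.convex h0 hy (sub_nonneg.2 hs1) hs0 (by ring)
  simpa using this

/-- If `0` belongs to the tile, the section of the tile by a coordinate hyperplane lies in the cone
of the model at `0`. -/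
theorem cone_of_mem (h : IsTile ω k A) (h0 : (0 : ι → ℝ) ∈ A) {i : ι} (hi : i ≠ k) {y : ι → ℝ}
    (hy : y i = 0) (hA : y ∈ A) : (∀ l, l ≠ i → 0 ≤ y k - y l) ∧ 0 ≤ ∑ j, ω j * y j := by
  have hlt : ∀ᶠ s in 𝓝[>] (0 : ℝ), s < 1 := nhdsWithin_le_nhds (Iio_mem_nhds one_pos)
  obtain ⟨s, ⟨hs, hs1⟩, hs0⟩ :=
    (((eventually_isSmall_smul h.pos y).and hlt).and self_mem_nhdsWithin).exists
  have hs0 : 0 < s := hs0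
  have hsA := h.smul_mem h0 hA hs0.le hs1.le
  have hsum : ∑ j, ω j * (s • y) j = s * ∑ j, ω j * y j := by
    rw [Finset.mul_sum]
    refine Finset.sum_congr rfl fun j _ => ?_
    simp only [Pi.smul_apply, smul_eq_mul]; ring
  rcases h.cone_of_isSmall hi (y := s • y) (by simp [hy]) hs ⟨0, by simpa [Pi.smul_def] using hsA⟩ with
    ⟨h1, h2⟩ | ⟨h1, h2⟩
  · rw [hsum] at h2
    refine ⟨fun l hl => ?_, nonneg_of_mul_nonneg_right h2 hs0⟩
    have := h1 l hl
    simp only [Pi.smul_apply, smul_eq_mul, ← mul_sub] at this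
    exact nonneg_of_mul_nonneg_right this hs0
  · rw [hsum] at h2
    -- In the opposite cone all y_l ≥ y_k ≥ 0 by the strip, while h(y) ≤ 0. So y = 0.
    have hyk := (h.strip _ hA).1
    have hyl : ∀ l, 0 ≤ y l := by
      intro l
      by_cases hl : l = i
      · rw [hl, hy]
      · have := h1 l hl
        simp only [Pi.smul_apply, smul_eq_mul, ← mul_sub] at this
        have := nonpos_of_mul_nonpos_right this hs0
        linarith
    have hn : ∀ j ∈ Finset.univ, 0 ≤ ω j * y j := fun j _ => mul_nonneg (h.pos j).le (hyl j)
    have hsum0 : ∑ j, ω j * y j = 0 :=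
      le_antisymm (nonpos_of_mul_nonpos_right h2 hs0) (Finset.sum_nonneg hn)
    have hy0 : ∀ l, y l = 0 := fun l => by
      have := (Finset.sum_eq_zero_iff_of_nonneg hn).1 hsum0 l (Finset.mem_univ l)
      exact (mul_eq_zero.1 this).resolve_left (h.pos l).ne'
    exact ⟨fun l _ => by simp [hy0], hsum0.ge⟩

/-- A tile does not contain both `0` and a lattice point `e` with `e k = 0` and positive other
coordinates. -/
theorem false_of_pos_lattice (h : IsTile ω k A) (hι : ∃ i, i ≠ k) (h0 : (0 : ι → ℝ) ∈ A)
    {e : ι → ℝ} (he : e ∈ A) (hek : e k = 0) (hpos : ∀ l, l ≠ k → 0 < e l) : False := by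
  classical
  -- Let e_i be maximal and let `q` project along the diagonal onto y_i = 0. Interior points y near
  -- a small multiple of e project into the opposite cone, so a lattice translate of q(y) is in the
  -- tile. By packing the translation is by a constant m, and the strip gives m ≥ 1. The chord from
  -- y to q(y) + m then has length m − y_i > w.
  obtain ⟨i, -, hi⟩ := Finset.exists_max_image Finset.univ e ⟨k, Finset.mem_univ k⟩
  have hik : i ≠ k := by
    rintro rfl
    obtain ⟨j, hj⟩ := hι
    have := hi j (Finset.mem_univ j)
    linarith [hpos j hj]
  have hei := hpos i hik
  have hw := h.ratio_lt_one hik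
  set w := ω k / ∑ i, ω i with hwdef
  have hΩ := h.sum_pos
  set q : (ι → ℝ) → ι → ℝ := fun y j => y j - y i with hq
  have hqc : Continuous q := by fun_prop
  have hneg : ∑ j, ω j * (e j - e i) < 0 := by
    refine Finset.sum_neg' (fun j _ => ?_) ⟨k, Finset.mem_univ k, ?_⟩
    · exact mul_nonpos_of_nonneg_of_nonpos (h.pos j).le (by linarith [hi j (Finset.mem_univ j)])
    · rw [hek]; nlinarith [h.pos k]
  let O : Set (ι → ℝ) := (⋂ l, {y | l ≠ k → y k - y l < 0}) ∩ {y | ∑ j, ω j * q y j < 0} ∩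
    q ⁻¹' {y | IsSmall ω y} ∩ {y | y i < 1 - w}
  have hO : IsOpen O := by
    refine (((isOpen_iInter_of_finite fun l => ?_).inter ?_).inter
      ((isOpen_setOf_isSmall ω).preimage hqc)).inter ?_
    · by_cases hl : l = k
      · simp [hl]
      · simp only [hl, ne_eq, not_false_eq_true, forall_true_left]
        exact isOpen_lt (by fun_prop) continuous_const
    · exact isOpen_lt (by fun_prop) continuous_const
    · exact isOpen_lt (by fun_prop) continuous_const
  have hlt : ∀ b : ℝ, 0 < b → ∀ᶠ s in 𝓝[>] (0 : ℝ), s < b := fun b hb =>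
    nhdsWithin_le_nhds (Iio_mem_nhds hb)
  obtain ⟨s, ⟨hs1, hsw, hs1'⟩, hs0⟩ := (((eventually_isSmall_smul h.pos (q e)).and
    ((hlt ((1 - w) / e i) (div_pos (by linarith) hei)).and (hlt 1 one_pos))).and
      self_mem_nhdsWithin).exists
  have hs0 : 0 < s := hs0
  have hse : s • e ∈ A := h.smul_mem h0 he hs0.le hs1'.le
  have hseO : s • e ∈ O := by
    refine ⟨⟨⟨?_, ?_⟩, ?_⟩, ?_⟩
    · refine mem_iInter.2 fun l hl => ?_
      have := mul_pos hs0 (hpos l hl)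
      simp [hek, this]
    · have : ∑ j, ω j * q (s • e) j = s * ∑ j, ω j * (e j - e i) := by
        rw [Finset.mul_sum]
        refine Finset.sum_congr rfl fun j _ => ?_
        simp only [hq, Pi.smul_apply, smul_eq_mul]; ring
      change ∑ j, ω j * q (s • e) j < 0
      rw [this]
      exact mul_neg_of_pos_of_neg hs0 hneg
    · have : q (s • e) = s • q e := by
        funext j; simp only [hq, Pi.smul_apply, smul_eq_mul]; ring
      change IsSmall ω (q (s • e))
      rw [this]; exact hs1
    · change s * e i < 1 - w
      rwa [lt_div_iff₀ hei] at hsw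
  obtain ⟨y, hyO, hyA⟩ := mem_closure_iff.1 (h.subset_closure hse) O hO hseO
  obtain ⟨⟨⟨hy1, hy2⟩, hy3⟩, hy4⟩ := hyO
  have hy1 : ∀ l, l ≠ k → y k - y l < 0 := fun l hl => mem_iInter.1 hy1 l hl
  obtain ⟨z, hz⟩ := h.exists_mem_of_neg_cone hik (y := q y) (by simp [hq]) hy3
    (fun l _ => by
      by_cases hlk : l = k
      · simp [hlk]
      · have := hy1 l hlk
        simp only [hq]; linarith)
    (le_of_lt hy2)
  obtain ⟨m, hm⟩ := h.packing_mem (y := y) (τ := -y i) (z := z) hyA (by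
    convert hz using 1; funext j; simp only [hq]; ring)
  have hstrip := (h.strip _ hz).1
  have hm1 : 0 < m := by
    have h1 := hy1 i hik
    simp only [hq, hm] at hstrip
    have : (0 : ℝ) < m := by linarith
    exact_mod_cast this
  have hle := h.chord_le y (m - y i) (interior_subset hyA) (by
    convert hz using 1; funext j; simp only [hq, hm]; ring)
  have : (1 : ℝ) ≤ m := by exact_mod_cast hm1
  have hy4 : y i < 1 - w := hy4
  linarith

/-- The lattice point of a tile in the face `y k = 0` is unique. -/
theorem lattice_unique (h : IsTile ω k A) (hι : 3 ≤ Fintype.card ι) {z z' : ι → ℤ}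
    (hz : z k = 0) (hz' : z' k = 0) (hA : (fun j => (z j : ℝ)) ∈ A)
    (hA' : (fun j => (z' j : ℝ)) ∈ A) : z = z' := by
  classical
  -- If z'_i ≤ z_i, the segment from z' to z + w(1,…,1) contains a point with i-th coordinate z_i.
  -- The cone condition there, relative to z, reads z'_l ≤ z_l for all l.
  have key : ∀ z z' : ι → ℤ, z k = 0 → z' k = 0 → (fun j => (z j : ℝ)) ∈ A →
      (fun j => (z' j : ℝ)) ∈ A → ∀ i, i ≠ k → z' i ≤ z i → ∀ l, l ≠ k → z' l ≤ z l := by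
    intro z z' hz hz' hA hA' i hi hle
    have h2 := h.translate z hz
    set B := (fun y : ι → ℝ => (fun i => y i + z i : ι → ℝ)) ⁻¹' A with hB
    have h0 : (0 : ι → ℝ) ∈ B := by
      change (fun i => (0 : ι → ℝ) i + (z i : ℝ)) ∈ A
      simpa using hA
    set d : ι → ℝ := fun j => (z' j : ℝ) - z j with hd
    have hdB : d ∈ B := by
      change (fun i => d i + (z i : ℝ)) ∈ A
      simpa [hd] using hA'
    have hdk : d k = 0 := by simp [hd, hz, hz']
    have hdi : d i ≤ 0 := by
      have : (z' i : ℝ) ≤ z i := by exact_mod_cast hle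
      simp only [hd]; linarith
    set w := ω k / ∑ i, ω i with hw
    have hw0 : 0 < w := h.ratio_pos
    have hwB : (fun _ => w : ι → ℝ) ∈ B := by
      obtain ⟨τ, hτ, ha, hb⟩ := h2.chord _ h0
      have h3 := (h2.strip _ ha).1
      have h4 : τ = 0 := by simp at h3; linarith [hτ.1]
      simpa [h4] using hb
    have hd1 : 0 < 1 - d i / w := by
      have : d i / w ≤ 0 := div_nonpos_of_nonpos_of_nonneg hdi hw0.le
      linarith
    -- The weights are chosen so that the i-th coordinate of the combination vanishes.
    have hp := h2.convex hdB hwB (a := 1 / (1 - d i / w)) (b := (-d i / w) / (1 - d i / w))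
      (by positivity) (div_nonneg (div_nonneg (by linarith) hw0.le) hd1.le)
      (by rw [← add_div, div_eq_one_iff_eq hd1.ne']; ring)
    have hpe : ∀ j, (((1 / (1 - d i / w)) • d + ((-d i / w) / (1 - d i / w)) •
        (fun _ => w : ι → ℝ) : ι → ℝ)) j = (d j - d i) / (1 - d i / w) := by
      intro j
      simp only [Pi.add_apply, Pi.smul_apply, smul_eq_mul]
      have : 1 - d i / w ≠ 0 := hd1.ne'
      field_simp
      ring
    have hc := (h2.cone_of_mem h0 hi (by rw [hpe]; simp) hp).1
    intro l hl
    by_cases hli : l = i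
    · rw [hli]; exact hle
    have h3 := hc l hli
    rw [hpe, hpe, hdk, ← sub_div] at h3
    have h4 : 0 ≤ 0 - d i - (d l - d i) := by
      by_contra hcon
      exact absurd h3 (not_le.2 (div_neg_of_neg_of_pos (not_le.1 hcon) hd1))
    have h5 : (z' l : ℝ) ≤ z l := by simp only [hd] at h4; linarith
    exact_mod_cast h5
  have hex : ∃ i, i ≠ k := by
    have : Nontrivial ι := Fintype.one_lt_card_iff_nontrivial.1 (by omega)
    exact exists_ne k
  -- Equality at one index would, by `key`, give the reverse inequality everywhere. So comparable
  -- distinct points differ strictly off k, which `false_of_pos_lattice` excludes.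
  have strict : ∀ z z' : ι → ℤ, z k = 0 → z' k = 0 → (fun j => (z j : ℝ)) ∈ A →
      (fun j => (z' j : ℝ)) ∈ A → z ≠ z' → (∀ l, l ≠ k → z l ≤ z' l) → False := by
    intro z z' hz hz' hA hA' hne hle
    have h2 := h.translate z hz
    have h0 : (0 : ι → ℝ) ∈ (fun y : ι → ℝ => (fun i => y i + z i : ι → ℝ)) ⁻¹' A := by
      change (fun i => (0 : ι → ℝ) i + (z i : ℝ)) ∈ A
      simpa using hA
    refine h2.false_of_pos_lattice hex h0 (e := fun j => (z' j : ℝ) - z j) ?_ (by simp [hz, hz']) ?_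
    · change (fun i => ((z' i : ℝ) - z i) + (z i : ℝ)) ∈ A
      simpa using hA'
    · intro l hl
      have hlt : z l < z' l := by
        refine lt_of_le_of_ne (hle l hl) fun heq => hne ?_
        have hge := key z z' hz hz' hA hA' l hl heq.ge
        funext j
        by_cases hj : j = k
        · rw [hj, hz, hz']
        · exact le_antisymm (hle j hj) (hge j hj)
      have : (z l : ℝ) < z' l := by exact_mod_cast hlt
      linarith
  by_contra hne
  obtain ⟨i, hi⟩ := hex
  rcases le_total (z i) (z' i) with hle | hle
  · exact strict z z' hz hz' hA hA' hne (key z' z hz' hz hA' hA i hi hle)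
  · exact strict z' z hz' hz hA' hA (Ne.symm hne) (key z z' hz hz' hA hA' i hi hle)

end IsTile
end
-- Tiles on at least three circles: the slab and the cone
section
variable {ι : Type*} [Fintype ι] {ω : ι → ℝ} {k : ι} {A : Set (ι → ℝ)}

theorem eventually_lt_right {b : ℝ} (hb : 0 < b) : ∀ᶠ s in 𝓝[>] (0 : ℝ), s < b :=
  nhdsWithin_le_nhds (Iio_mem_nhds hb)

theorem eventually_lt_of_continuous {f g : ℝ → ℝ} (hf : Continuous f) (hg : Continuous g)
    (h : f 0 < g 0) : ∀ᶠ s in 𝓝[>] (0 : ℝ), f s < g s :=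
  nhdsWithin_le_nhds ((isOpen_lt hf hg).mem_nhds h)

/-- The missing weight 1 − ∑ t_i is given to the point 0. -/
theorem _root_.Convex.sum_smul_mem_of_zero_mem {E : Type*} [AddCommGroup E] [Module ℝ E]
    {B : Set E} (hB : Convex ℝ B) (h0 : (0 : E) ∈ B) {t : ι → ℝ} {v : ι → E} (ht : ∀ i, 0 ≤ t i)
    (ht1 : ∑ i, t i ≤ 1) (hv : ∀ i, v i ∈ B) : ∑ i, t i • v i ∈ B := by
  have := hB.sum_mem (t := (Finset.univ : Finset (Option ι)))
    (w := fun o => o.elim (1 - ∑ i, t i) t) (z := fun o => o.elim 0 v)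
    (by rintro (_ | i) -
        · simpa using ht1
        · exact ht i)
    (by simp [Fintype.sum_option])
    (by rintro (_ | i) -
        · exact h0
        · exact hv i)
  simpa [Fintype.sum_option] using this

namespace IsTile

/-- Rays of the cone of the model at `0` in a coordinate hyperplane start inside the tile. -/
theorem eventually_smul_mem (h : IsTile ω k A) (hι : 3 ≤ Fintype.card ι) (h0 : (0 : ι → ℝ) ∈ A)
    {i : ι} (hi : i ≠ k) {y : ι → ℝ} (hy : y i = 0) (hc : ∀ l, l ≠ i → 0 ≤ y k - y l)
    (hh : 0 ≤ ∑ j, ω j * y j) (hk : 0 < y k) : ∀ᶠ s in 𝓝[>] (0 : ℝ), s • y ∈ A := by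
  obtain ⟨z, hzk, hzA, hfr⟩ := h.exists_lattice_mem hi hy hc hh hk
  -- Uniqueness of the lattice point identifies the translate met by the ray with the tile itself.
  have hz0 : z = 0 := h.lattice_unique hι hzk rfl hzA (by simpa [Pi.zero_def] using h0)
  subst hz0
  obtain ⟨s₀, hs₀, hpos⟩ := (hfr.and_eventually self_mem_nhdsWithin).exists
  have hpos : 0 < s₀ := hpos
  have hs₀ : s₀ • y ∈ A := by simpa [Pi.smul_def] using hs₀
  filter_upwards [eventually_lt_right hpos, self_mem_nhdsWithin] with s hs hs'
  have hs' : 0 < s := hs'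
  have := h.smul_mem h0 hs₀ (s := s / s₀) (by positivity) ((div_le_one hpos).2 hs.le)
  rwa [smul_smul, div_mul_cancel₀ _ hpos.ne'] at this

/-- The strip prevents the chord through 0 from continuing below 0, so it starts there. -/
theorem const_mem (h : IsTile ω k A) (h0 : (0 : ι → ℝ) ∈ A) :
    (fun _ => ω k / ∑ i, ω i : ι → ℝ) ∈ A := by
  obtain ⟨τ, hτ, ha, hb⟩ := h.chord _ h0
  have h3 := (h.strip _ ha).1
  have h4 : τ = 0 := by simp at h3; linarith [hτ.1]
  simpa [h4] using hb

/-- The diagonal lines near `0` in the positive orthant directions meet the interior. -/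
theorem exists_add_mem_interior [DecidableEq ι] (h : IsTile ω k A) (hι : 3 ≤ Fintype.card ι)
    (h0 : (0 : ι → ℝ) ∈ A) :
    ∃ ρ > 0, ∀ y : ι → ℝ, (∀ i, i ≠ k → 0 < y k - y i) → ∑ i, (y k - y i) < ρ →
      ∃ σ : ℝ, (fun i => y i + σ) ∈ interior A := by
  have hev : ∀ᶠ s in 𝓝[>] (0 : ℝ), ∀ i, i ≠ k → s • (1 - Pi.single i 1 : ι → ℝ) ∈ A := by
    refine Filter.eventually_all.2 fun i => ?_
    by_cases hi : i = k
    · simp [hi]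
    · simp only [hi, ne_eq, not_false_eq_true, forall_true_left]
      refine h.eventually_smul_mem hι h0 hi (by simp) (fun l hl => ?_) ?_ ?_
      · simp [Ne.symm hi, hl]
      · refine Finset.sum_nonneg fun j _ => mul_nonneg (h.pos j).le ?_
        by_cases hj : j = i
        · simp [hj]
        · simp [hj]
      · simp [Ne.symm hi]
  obtain ⟨s, hs, hs0⟩ := (hev.and self_mem_nhdsWithin).exists
  have hs0 : 0 < s := hs0
  set w := ω k / ∑ i, ω i with hw
  have hw0 : 0 < w := h.ratio_pos
  -- With C = ∑ (y_k − y_i) one has y = ∑_{i≠k} (y_k − y_i)(1 − e_i) + (y_k − C)(1,…,1). Hence `G`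
  -- is the open simplex with vertices 0, w(1,…,1) and s(1 − e_i), all of them in the tile.
  let G : Set (ι → ℝ) := (⋂ i, {y | i ≠ k → 0 < y k - y i}) ∩ {y | ∑ i, (y k - y i) < y k} ∩
    {y | (y k - ∑ i, (y k - y i)) / w + (∑ i, (y k - y i)) / s < 1}
  have hG : IsOpen G := by
    refine ((isOpen_iInter_of_finite fun i => ?_).inter ?_).inter ?_
    · by_cases hi : i = k
      · simp [hi]
      · simp only [hi, ne_eq, not_false_eq_true, forall_true_left]
        exact isOpen_lt continuous_const (by fun_prop)
    · exact isOpen_lt (by fun_prop) (by fun_prop)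
    · exact isOpen_lt (by fun_prop) continuous_const
  have hGA : G ⊆ A := by
    rintro y ⟨⟨hy1, hy2⟩, hy3⟩
    have hy1 : ∀ i, i ≠ k → 0 < y k - y i := fun i hi => mem_iInter.1 hy1 i hi
    have hy2 : ∑ i, (y k - y i) < y k := hy2
    have hy3 : (y k - ∑ i, (y k - y i)) / w + (∑ i, (y k - y i)) / s < 1 := hy3
    set C := ∑ i, (y k - y i) with hC
    have hsplit : ∀ f : ι → ℝ, ∑ i, f i = f k + ∑ i ∈ Finset.univ.erase k, f i := fun f =>
      (Finset.add_sum_erase _ f (Finset.mem_univ k)).symm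
    have hC' : C = ∑ i ∈ Finset.univ.erase k, (y k - y i) := by
      rw [hC, hsplit]; simp
    have hmem := h.convex.sum_smul_mem_of_zero_mem h0
      (t := fun i => if i = k then (y k - C) / w else (y k - y i) / s)
      (v := fun i => if i = k then (fun _ => w : ι → ℝ) else s • (1 - Pi.single i 1 : ι → ℝ))
      (fun i => by
        by_cases hi : i = k
        · simp only [hi, if_true]; exact div_nonneg (by linarith) hw0.le
        · simp only [hi, if_false]; exact div_nonneg (hy1 i hi).le hs0.le)
      (by
        rw [hsplit]
        simp only [if_true]
        rw [Finset.sum_congr rfl (g := fun i => (y k - y i) / s)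
          (fun i hi => by simp [Finset.ne_of_mem_erase hi]), ← Finset.sum_div, ← hC']
        exact hy3.le)
      (fun i => by
        by_cases hi : i = k
        · simp only [hi, if_true]; exact h.const_mem h0
        · simp only [hi, if_false]; exact hs i hi)
    convert hmem using 1
    funext j
    rw [Finset.sum_apply, hsplit]
    rw [Finset.sum_congr rfl (g := fun i => (y k - y i) - (if i = j then (y k - y i) else 0))
      (fun i hi => by
        have hik := Finset.ne_of_mem_erase hi
        by_cases hij : i = j
        · subst hij; simp [hik]
        · simp [hik, hij, Ne.symm hij, hs0.ne'])]
    rw [Finset.sum_sub_distrib, ← hC', Finset.sum_ite_eq']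
    simp only [if_true, Pi.smul_apply, smul_eq_mul]
    rw [div_mul_cancel₀ _ hw0.ne']
    by_cases hj : j = k
    · simp [hj]
    · simp [hj]
  -- The shift σ makes the coefficient of (1,…,1) equal to w/2, which uses half of the admissible
  -- weight; C < s/2 keeps the rest below the other half.
  refine ⟨s / 2, by positivity, fun y hy hC => ⟨∑ i, (y k - y i) + w / 2 - y k, ?_⟩⟩
  refine interior_maximal hGA hG ⟨⟨?_, ?_⟩, ?_⟩
  · refine mem_iInter.2 fun i hi => ?_
    have := hy i hi
    linarith
  · change ∑ i, (y k + _ - (y i + _)) < y k + _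
    simp only [add_sub_add_right_eq_sub]
    linarith
  · change (y k + _ - ∑ i, (y k + _ - (y i + _))) / w + (∑ i, (y k + _ - (y i + _))) / s < 1
    simp only [add_sub_add_right_eq_sub]
    have h1 : (∑ i, (y k - y i)) / s < 1 / 2 := by
      rw [div_lt_iff₀ hs0]; linarith
    have h2 : (y k + (∑ i, (y k - y i) + w / 2 - y k) - ∑ i, (y k - y i)) / w = 1 / 2 := by
      field_simp; ring
    rw [h2]; linarith

/-- Points of the bottom edges of the model near `0` are the lower ends of chords of the tile. -/
theorem eventually_edge_mem [DecidableEq ι] (h : IsTile ω k A) (hι : 3 ≤ Fintype.card ι)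
    (h0 : (0 : ι → ℝ) ∈ A) (l : ι) :
    ∀ᶠ s in 𝓝[>] (0 : ℝ), s • (ω l • Pi.single k 1 - ω k • Pi.single l 1 : ι → ℝ) ∈ A ∧
      (fun j => (s • (ω l • Pi.single k 1 - ω k • Pi.single l 1 : ι → ℝ)) j + ω k / ∑ i, ω i)
        ∈ A := by
  by_cases hl : l = k
  · subst hl
    refine Filter.Eventually.of_forall fun s => ?_
    simpa using ⟨h0, h.const_mem h0⟩
  set γ : ι → ℝ := ω l • Pi.single k 1 - ω k • Pi.single l 1 with hγ
  have hγk : γ k = ω l := by simp [hγ, Ne.symm hl]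
  have hγl : γ l = -ω k := by simp [hγ, hl]
  have hγj : ∀ j, j ≠ k → j ≠ l → γ j = 0 := fun j h1 h2 => by simp [hγ, h1, h2]
  have hγh : ∑ j, ω j * γ j = 0 := by
    simp only [hγ, Pi.sub_apply, Pi.smul_apply, smul_eq_mul, mul_sub, Finset.sum_sub_distrib,
      Pi.single_apply, mul_ite, mul_one, mul_zero, Finset.sum_ite_eq', Finset.mem_univ, if_true]
    ring
  -- This is where a third circle is needed: γ must lie in a hyperplane y_i = 0 with i ≠ k, l.
  obtain ⟨i, hi⟩ : ∃ i, i ∉ ({k, l} : Finset ι) := by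
    by_contra hcon
    push Not at hcon
    have : Fintype.card ι ≤ 2 := by
      rw [← Finset.card_univ, ← Finset.eq_univ_iff_forall.2 hcon]
      exact Finset.card_le_two
    omega
  simp only [Finset.mem_insert, Finset.mem_singleton, not_or] at hi
  obtain ⟨hik, hil⟩ := hi
  obtain ⟨ρ, hρ, hint⟩ := h.exists_add_mem_interior hι h0
  have hγc : ∀ j, j ≠ k → 0 < γ k - γ j := by
    intro j hj
    by_cases hjl : j = l
    · rw [hjl, hγk, hγl]; linarith [h.pos l, h.pos k]
    · rw [hγk, hγj j hj hjl]; linarith [h.pos l]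
  have hmem := h.eventually_smul_mem hι h0 hik (y := γ) (hγj i hik hil)
    (fun j _ => by
      by_cases hj : j = k
      · simp [hj]
      · exact (hγc j hj).le) hγh.ge (by rw [hγk]; exact h.pos l)
  have hw0 := h.ratio_pos
  set w := ω k / ∑ i, ω i with hw
  filter_upwards [hmem, eventually_isSmall_smul h.pos γ, self_mem_nhdsWithin,
    eventually_lt_of_continuous (f := fun s => s * ∑ j, (γ k - γ j)) (g := fun _ => ρ)
      (by fun_prop) (by fun_prop) (by simpa using hρ),
    eventually_lt_of_continuous (f := fun s => s * ω l) (g := fun _ => w)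
      (by fun_prop) (by fun_prop) (by simpa using hw0)] with s hsA hsmall hs0 hsρ hsw
  have hs0 : 0 < s := hs0
  refine ⟨hsA, ?_⟩
  obtain ⟨σ, hσ⟩ := hint (s • γ)
    (fun j hj => by
      have := mul_pos hs0 (hγc j hj)
      simp only [Pi.smul_apply, smul_eq_mul]; linarith)
    (by
      simp only [Pi.smul_apply, smul_eq_mul, ← mul_sub]
      rw [← Finset.mul_sum]; exact hsρ)
  -- Otherwise lowering the k-th coordinate slightly gives tile points with h < 0 and y_k > y_l,
  -- which are in neither cone.
  have hnot : s • γ ∉ interior A := by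
    intro hcon
    have hopen : IsOpen (interior A ∩ {y | IsSmall ω y} ∩ {y : ι → ℝ | 0 < y k - y l}) :=
      (isOpen_interior.inter (isOpen_setOf_isSmall ω)).inter
        (isOpen_lt continuous_const (by fun_prop))
    have hin : s • γ ∈ interior A ∩ {y | IsSmall ω y} ∩ {y : ι → ℝ | 0 < y k - y l} := by
      refine ⟨⟨hcon, hsmall⟩, ?_⟩
      have := mul_pos hs0 (hγc l hl)
      change 0 < s * γ k - s * γ l
      linarith
    have ht : Tendsto (fun ε : ℝ => (s • γ - ε • Pi.single k 1 : ι → ℝ)) (𝓝 0) (𝓝 (s • γ)) := by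
      have : Tendsto (fun ε : ℝ => (s • γ - ε • Pi.single k 1 : ι → ℝ)) (𝓝 0)
        (𝓝 (s • γ - (0 : ℝ) • Pi.single k 1)) := Continuous.tendsto (by fun_prop) 0
      simpa using this
    obtain ⟨ε, ⟨⟨hε1, hε2⟩, hε3⟩, hε0⟩ := (((ht.mono_left nhdsWithin_le_nhds).eventually
      (hopen.mem_nhds hin)).and (self_mem_nhdsWithin (s := Ioi (0 : ℝ)))).exists
    have hε0 : 0 < ε := hε0
    have hsum : ∑ j, ω j * (s • γ - ε • Pi.single k 1 : ι → ℝ) j = -ε * ω k := by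
      have : ∑ j, ω j * (s • γ - ε • Pi.single k 1 : ι → ℝ) j =
          s * (∑ j, ω j * γ j) - ε * ∑ j, ω j * (Pi.single k 1 : ι → ℝ) j := by
        rw [Finset.mul_sum, Finset.mul_sum, ← Finset.sum_sub_distrib]
        refine Finset.sum_congr rfl fun j _ => ?_
        simp only [Pi.sub_apply, Pi.smul_apply, smul_eq_mul]; ring
      rw [this, hγh]
      simp [Pi.single_apply]
    rcases h.cone_of_isSmall hik (by simp [hγj i hik hil, hik]) hε2
      ⟨0, by
        have hεA := interior_subset hε1
        convert hεA using 1
        funext j; simp⟩ with ⟨-, h2⟩ | ⟨h1, -⟩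
    · rw [hsum] at h2
      nlinarith [h.pos k]
    · have := h1 l (Ne.symm hil)
      have hε3 : 0 < (s • γ - ε • Pi.single k 1 : ι → ℝ) k - (s • γ - ε • Pi.single k 1 : ι → ℝ) l :=
        hε3
      linarith
  rcases h.endpoint hsA hnot hσ with h1 | h1
  · exact h1
  -- The downward chord would leave the strip, because s ω_l < w.
  · have := (h.strip _ h1).1
    simp only [Pi.smul_apply, smul_eq_mul, hγk] at this
    linarith

/-- A tile with lattice point `0` lies in the same slab as the model. -/
theorem sum_mem_Icc (h : IsTile ω k A) (hι : 3 ≤ Fintype.card ι) (h0 : (0 : ι → ℝ) ∈ A)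
    {y : ι → ℝ} (hy : y ∈ A) : ∑ j, ω j * y j ∈ Icc 0 (ω k) := by
  classical
  obtain ⟨s, hs, hs0⟩ := ((Filter.eventually_all.2 (h.eventually_edge_mem hι h0)).and
    self_mem_nhdsWithin).exists
  have hs0 : 0 < s := hs0
  set γ : ι → ι → ℝ := fun l => ω l • Pi.single k 1 - ω k • Pi.single l 1 with hγ
  have hγj : ∀ l j, γ l j = (if j = k then ω l else 0) - (if l = j then ω k else 0) := by
    intro l j
    simp [hγ, Pi.single_apply, eq_comm]
  have hw0 := h.ratio_pos
  have hΩ := h.sum_pos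
  set w := ω k / ∑ i, ω i with hw
  set Ω := ∑ i, ω i with hΩdef
  set η := ∑ j, ω j * y j with hη
  have hwΩ : w * Ω = ω k := div_mul_cancel₀ _ hΩ.ne'
  -- `B` is the convex set of lower ends of full chords; it contains 0 and all s γ_l, which span the
  -- hyperplane h = 0.
  let B : Set (ι → ℝ) := A ∩ (fun v : ι → ℝ => v + fun _ => w) ⁻¹' A
  have hB : Convex ℝ B := h.convex.inter (h.convex.translate_preimage_left _)
  have hB0 : (0 : ι → ℝ) ∈ B := ⟨h0, by simpa using h.const_mem h0⟩
  have hBγ : ∀ l, s • γ l ∈ B := fun l => ⟨(hs l).1, (hs l).2⟩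
  have hcard : (0 : ℝ) < Fintype.card ι := by
    have : 0 < Fintype.card ι := by omega
    exact_mod_cast this
  set ρ : ℝ := 1 / (2 * Fintype.card ι) with hρ
  have hρ0 : 0 < ρ := by positivity
  have hρ1 : ∑ _i : ι, ρ = 1 / 2 := by
    simp only [Finset.sum_const, Finset.card_univ, nsmul_eq_mul, hρ]; field_simp
  set y' : ι → ℝ := fun j => y j - η / Ω with hy'
  have hy'0 : ∑ j, ω j * y' j = 0 := by
    simp only [hy', mul_sub, Finset.sum_sub_distrib, ← Finset.sum_mul]
    rw [← hη, ← hΩdef]; field_simp; ring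
  -- These are the coefficients of (1 + ε)z − εy' in the vectors s γ_l. Those of z all equal ρ, so
  -- for small ε they remain positive with sum below 1.
  let t : ℝ → ι → ℝ := fun ε l => (1 + ε) * ρ + ε * y' l / (ω k * s)
  obtain ⟨ε, ⟨hε1, hε2⟩, hε0⟩ := (((Filter.eventually_all.2 fun l =>
    eventually_lt_of_continuous (f := fun _ => 0) (g := fun ε => t ε l) (by fun_prop)
      (by fun_prop) (by simpa [t] using hρ0)).and
    (eventually_lt_of_continuous (f := fun ε => ∑ l, t ε l) (g := fun _ => 1) (by fun_prop)
      (by fun_prop) (by simp only [t, add_zero, one_mul, zero_mul, zero_div]; rw [hρ1]; norm_num))).and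
    self_mem_nhdsWithin).exists
  have hε0 : 0 < ε := hε0
  have hz := hB.sum_smul_mem_of_zero_mem hB0 (t := fun _ => ρ) (fun _ => hρ0.le)
    (by rw [hρ1]; norm_num) hBγ
  have hz' := hB.sum_smul_mem_of_zero_mem hB0 (t := t ε) (fun l => (hε1 l).le) hε2.le hBγ
  set z : ι → ℝ := ∑ l, ρ • (s • γ l) with hzdef
  have hγsum : ∀ (u : ι → ℝ) j, (∑ l, u l • (s • γ l)) j =
      (if j = k then s * ∑ l, u l * ω l else 0) - s * u j * ω k := by
    intro u j
    rw [Finset.sum_apply]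
    simp only [Pi.smul_apply, smul_eq_mul, hγj, mul_sub, Finset.sum_sub_distrib, mul_ite, mul_zero,
      Finset.sum_ite_eq', Finset.mem_univ, if_true]
    congr 1
    · split_ifs
      · rw [Finset.mul_sum]; exact Finset.sum_congr rfl fun l _ => by ring
      · simp
    · ring
  have hrel : ∀ j, (∑ l, t ε l • (s • γ l)) j = (1 + ε) * z j - ε * y' j := by
    intro j
    rw [hzdef, hγsum, hγsum (fun _ => ρ)]
    have hωk := (h.pos k).ne'
    have hsum : s * ∑ l, t ε l * ω l = (1 + ε) * (s * ∑ l, ρ * ω l) := by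
      have : ∑ l, t ε l * ω l = (1 + ε) * ∑ l, ρ * ω l + ε / (ω k * s) * ∑ l, ω l * y' l := by
        rw [Finset.mul_sum, Finset.mul_sum, ← Finset.sum_add_distrib]
        exact Finset.sum_congr rfl fun l _ => by simp only [t]; ring
      rw [this, hy'0]; ring
    rw [hsum]
    split_ifs
    · simp only [t]; field_simp; ring
    · simp only [t]; field_simp; ring
  have hcomb : ∀ v ∈ A, (fun j => (v j + ε * y j) / (1 + ε)) ∈ A := by
    intro v hv
    have := h.convex hv hy (a := 1 / (1 + ε)) (b := ε / (1 + ε)) (by positivity) (by positivity)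
      (by field_simp)
    convert this using 1
    funext j
    simp only [Pi.add_apply, Pi.smul_apply, smul_eq_mul]
    ring
  have h1ε : (1 + ε) ≠ 0 := by positivity
  have hz2 : (fun j => z j + w) ∈ A := hz.2
  have hz2' : (fun j => (∑ l, t ε l • (s • γ l)) j + w) ∈ A := hz'.2
  constructor
  -- Averaging (1 + ε)z − εy' with y gives z shifted along the diagonal by ε/(1 + ε) · η/Ω. Since z
  -- + w is in the tile as well, the bound on chord lengths forces η ≥ 0.
  · have h1 := hcomb _ hz'.1
    have h2 := h.chord_le _ (w - ε / (1 + ε) * (η / Ω)) h1 (by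
      convert hz2 using 1
      funext j
      rw [hrel]
      simp only [hy']
      field_simp; ring)
    have h3 : 0 ≤ ε / (1 + ε) * (η / Ω) := by linarith
    have h4 := nonneg_of_mul_nonneg_right h3 (by positivity)
    by_contra hcon
    exact absurd h4 (not_le.2 (div_neg_of_neg_of_pos (not_le.1 hcon) hΩ))
  -- The same with the upper ends of the chords gives η ≤ ω_k.
  · have h1 := hcomb _ hz2'
    have h2 := h.chord_le _ ((w + ε * (η / Ω)) / (1 + ε)) hz.1 (by
      convert h1 using 1
      funext j
      simp only [hrel, hy']
      field_simp; ring)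
    rw [div_le_iff₀ (by positivity)] at h2
    have h3 : ε * (η / Ω) ≤ ε * w := by linarith
    have h4 := le_of_mul_le_mul_left h3 hε0
    rw [div_le_iff₀ hΩ] at h4
    linarith

/-- A tile with lattice point `0` lies in the cone of the model at `0`. -/
theorem sub_nonneg_of_mem (h : IsTile ω k A) (hι : 3 ≤ Fintype.card ι) (h0 : (0 : ι → ℝ) ∈ A)
    {y : ι → ℝ} (hy : y ∈ A) (l : ι) : 0 ≤ y k - y l := by
  classical
  by_contra hcon
  push Not at hcon
  have hl : l ≠ k := by rintro rfl; simp at hcon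
  -- β lies on the wall y_k = y_l of the model cone, at positive height.
  set β : ι → ℝ := Pi.single k 1 + Pi.single l 1 with hβ
  have hβk : β k = 1 := by simp [hβ, Ne.symm hl]
  have hβl : β l = 1 := by simp [hβ, hl]
  have hβj : ∀ j, j ≠ k → j ≠ l → β j = 0 := fun j h1 h2 => by simp [hβ, h1, h2]
  have hβc : ∀ j, 0 ≤ β k - β j := by
    intro j
    by_cases h1 : j = k
    · simp [h1]
    by_cases h2 : j = l
    · simp [h2, hβk, hβl]
    · rw [hβk, hβj j h1 h2]; norm_num
  have hβh : ∑ j, ω j * β j = ω k + ω l := by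
    simp [hβ, mul_add, Finset.sum_add_distrib, Pi.single_apply]
  obtain ⟨i, hi⟩ : ∃ i, i ∉ ({k, l} : Finset ι) := by
    by_contra hcon
    push Not at hcon
    have : Fintype.card ι ≤ 2 := by
      rw [← Finset.card_univ, ← Finset.eq_univ_iff_forall.2 hcon]
      exact Finset.card_le_two
    omega
  simp only [Finset.mem_insert, Finset.mem_singleton, not_or] at hi
  obtain ⟨hik, hil⟩ := hi
  obtain ⟨ρ, hρ, hint⟩ := h.exists_add_mem_interior hι h0
  have hωk := h.pos k
  have hωl := h.pos l
  have hmem := h.eventually_smul_mem hι h0 hik (y := β) (hβj i hik hil) (fun j _ => hβc j)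
    (by rw [hβh]; linarith) (by rw [hβk]; norm_num)
  obtain ⟨s, ⟨⟨⟨hsA, hsmall⟩, hsρ⟩, hsω⟩, hs0⟩ := ((((hmem.and
    (eventually_isSmall_smul h.pos β)).and
    (eventually_lt_of_continuous (f := fun s => s * ∑ j, (β k - β j)) (g := fun _ => ρ)
      (by fun_prop) (by fun_prop) (by simpa using hρ))).and
    (eventually_lt_of_continuous (f := fun s => s * (ω k + ω l)) (g := fun _ => ω k)
      (by fun_prop) (by fun_prop) (by simpa using hωk))).and self_mem_nhdsWithin).exists
  have hs0 : 0 < s := hs0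
  have hsumβ : ∑ j, ω j * (s • β) j = s * (ω k + ω l) := by
    rw [← hβh, Finset.mul_sum]
    refine Finset.sum_congr rfl fun j _ => ?_
    simp only [Pi.smul_apply, smul_eq_mul]; ring
  -- Otherwise raising the l-th coordinate slightly gives tile points beyond the wall with h > 0,
  -- which are in neither cone.
  have hnot : s • β ∉ interior A := by
    intro hcon
    have hopen : IsOpen (interior A ∩ {y | IsSmall ω y} ∩ {y : ι → ℝ | 0 < ∑ j, ω j * y j}) :=
      (isOpen_interior.inter (isOpen_setOf_isSmall ω)).inter
        (isOpen_lt continuous_const (by fun_prop))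
    have hin : s • β ∈ interior A ∩ {y | IsSmall ω y} ∩ {y : ι → ℝ | 0 < ∑ j, ω j * y j} := by
      refine ⟨⟨hcon, hsmall⟩, ?_⟩
      change 0 < ∑ j, ω j * (s • β) j
      rw [hsumβ]; positivity
    have ht : Tendsto (fun ε : ℝ => (s • β + ε • Pi.single l 1 : ι → ℝ)) (𝓝 0) (𝓝 (s • β)) := by
      have : Tendsto (fun ε : ℝ => (s • β + ε • Pi.single l 1 : ι → ℝ)) (𝓝 0)
        (𝓝 (s • β + (0 : ℝ) • Pi.single l 1)) := Continuous.tendsto (by fun_prop) 0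
      simpa using this
    obtain ⟨ε, ⟨⟨hε1, hε2⟩, hε3⟩, hε0⟩ := (((ht.mono_left nhdsWithin_le_nhds).eventually
      (hopen.mem_nhds hin)).and (self_mem_nhdsWithin (s := Ioi (0 : ℝ)))).exists
    have hε0 : 0 < ε := hε0
    rcases h.cone_of_isSmall hik (by simp [hβj i hik hil, hil]) hε2
      ⟨0, by
        have hεA := interior_subset hε1
        convert hεA using 1
        funext j; simp⟩ with ⟨h1, -⟩ | ⟨-, h2⟩
    · have := h1 l (Ne.symm hil)
      simp [hβk, hβl, Ne.symm hl] at this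
      linarith
    · exact absurd hε3 (not_lt.2 h2)
  -- The point (sβ − δy)/(1 − δ) is pushed off the wall, away from y, so its diagonal meets the
  -- interior. Combining that interior point with y gives an interior point on the diagonal of sβ.
  obtain ⟨δ, ⟨⟨hδ1, hδρ⟩, hδc⟩, hδ0⟩ := (((eventually_lt_right one_pos).and
    (eventually_lt_of_continuous (f := fun δ => s * ∑ j, (β k - β j) - δ * ∑ j, (y k - y j))
      (g := fun δ => ρ * (1 - δ)) (by fun_prop) (by fun_prop) (by simpa using hsρ))).and
    (Filter.eventually_all.2 fun j => eventually_lt_of_continuous (f := fun δ => δ * (y k - y j))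
      (g := fun _ => s) (by fun_prop) (by fun_prop) (by simpa using hs0))).and
        self_mem_nhdsWithin |>.exists
  have hδ0 : 0 < δ := hδ0
  have hδ1' : 0 < 1 - δ := by linarith
  obtain ⟨σ, hσ⟩ := hint (fun j => (s * β j - δ * y j) / (1 - δ))
    (fun j hj => by
      rw [← sub_div]
      apply div_pos _ hδ1'
      by_cases hjl : j = l
      · rw [hjl, hβk, hβl]; nlinarith
      · rw [hβk, hβj j hj hjl]; linarith [hδc j])
    (by
      simp only [← sub_div]
      rw [← Finset.sum_div, div_lt_iff₀ hδ1']
      refine lt_of_eq_of_lt ?_ hδρ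
      rw [Finset.mul_sum, Finset.mul_sum, ← Finset.sum_sub_distrib]
      exact Finset.sum_congr rfl fun j _ => by ring)
  have hm : (fun j => (s • β) j + (1 - δ) * σ) ∈ interior A := by
    refine h.convex.openSegment_interior_self_subset_interior hσ hy
      ⟨1 - δ, δ, hδ1', hδ0, by ring, ?_⟩
    funext j
    have := hδ1'.ne'
    simp only [Pi.add_apply, Pi.smul_apply, smul_eq_mul]
    field_simp; ring
  have hΩ := h.sum_pos
  have hwΩ : ω k / (∑ i, ω i) * (∑ i, ω i) = ω k := div_mul_cancel₀ _ hΩ.ne'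
  -- Now sβ is the end of a chord of length w, along which h changes by ω_k. As 0 < h(sβ) < ω_k, the
  -- other end violates the slab condition.
  rcases h.endpoint hsA hnot hm with h1 | h1
  · have := (h.sum_mem_Icc hι h0 h1).2
    simp only [mul_add, Finset.sum_add_distrib, ← Finset.sum_mul] at this
    rw [hsumβ, mul_comm (∑ i, ω i), hwΩ] at this
    have : 0 < s * (ω k + ω l) := by positivity
    linarith
  · have := (h.sum_mem_Icc hι h0 h1).1
    simp only [mul_sub, Finset.sum_sub_distrib, ← Finset.sum_mul] at this
    rw [hsumβ, mul_comm (∑ i, ω i), hwΩ] at this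
    linarith

end IsTile
end
-- Containment of a tile in a translate of the model
section
variable {ι : Type*} [Fintype ι] {ω : ι → ℝ} {k : ι} {A : Set (ι → ℝ)}

namespace IsTile

theorem exists_sub_mem_diagBox_of_three_le (h : IsTile ω k A) (hι : 3 ≤ Fintype.card ι) :
    ∃ z : ι → ℤ, ∀ y ∈ A, (fun j => y j - z j) ∈ diagBox ω k := by
  classical
  have hex : ∀ k : ι, ∃ i, i ≠ k := by
    have : Nontrivial ι := Fintype.one_lt_card_iff_nontrivial.1 (by omega)
    exact fun k => exists_ne k
  have hlat : ∀ B : Set (ι → ℝ), IsTile ω k B →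
      ∃ z : ι → ℤ, z k = 0 ∧ (fun j => (z j : ℝ)) ∈ B := by
    intro B hB
    obtain ⟨i, hi⟩ := hex k
    obtain ⟨z, hz, hzB, -⟩ := hB.exists_lattice_mem (y := Pi.single k 1) hi (by simp [hi])
      (fun l _ => by
        by_cases hl : l = k
        · simp [hl]
        · simp [hl])
      (by simp [Pi.single_apply, (h.pos k).le]) (by simp)
    exact ⟨z, hz, hzB⟩
  obtain ⟨z, hzk, hzA⟩ := hlat A h
  have h2 := h.translate z hzk
  set B := (fun y : ι → ℝ => (fun i => y i + z i : ι → ℝ)) ⁻¹' A with hB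
  have h0 : (0 : ι → ℝ) ∈ B := by
    change (fun i => (0 : ι → ℝ) i + (z i : ℝ)) ∈ A
    simpa using hzA
  -- The reflected tile has a lattice point x too. Once x = 0, its cone conditions are the missing
  -- upper bounds y_k − y_l ≤ 1.
  have h3 := h2.reflect
  obtain ⟨x, hxk, hxR⟩ := hlat _ h3
  have h4 := h3.translate x hxk
  set R := (fun y : ι → ℝ => (fun i => y i + x i : ι → ℝ)) ⁻¹'
    ((fun y : ι → ℝ => (Pi.single k 1 : ι → ℝ) - y) ⁻¹' B) with hR
  have h0R : (0 : ι → ℝ) ∈ R := by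
    change (fun i => (0 : ι → ℝ) i + (x i : ℝ)) ∈
      (fun y : ι → ℝ => (Pi.single k 1 : ι → ℝ) - y) ⁻¹' B
    simpa only [Pi.zero_apply, zero_add] using hxR
  have hmemR : ∀ y ∈ B, (fun j => (Pi.single k 1 : ι → ℝ) j - y j - x j) ∈ R := by
    intro y hy
    change (Pi.single k 1 : ι → ℝ) - _ ∈ B
    convert hy using 1
    funext j; simp
  have hsumR : ∀ y : ι → ℝ, ∑ j, ω j * ((Pi.single k 1 : ι → ℝ) j - y j - x j) =
      ω k - ∑ j, ω j * y j - ∑ j, ω j * (x j : ℝ) := by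
    intro y
    simp [mul_sub, Finset.sum_sub_distrib, Pi.single_apply]
  have hΩ := h.sum_pos
  -- The slab condition for the reflections of 0 and of w(1,…,1), whose heights are 0 and ω_k,
  -- bounds h(x) from both sides.
  have hx0 : ∑ j, ω j * (x j : ℝ) = 0 := by
    have h5 := h4.sum_mem_Icc hι h0R (hmemR _ h0)
    have h6 := h4.sum_mem_Icc hι h0R (hmemR _ (h2.const_mem h0))
    rw [hsumR] at h5 h6
    have h7 : ∑ j, ω j * (ω k / ∑ i, ω i) = ω k := by
      rw [← Finset.sum_mul, mul_div_cancel₀ _ hΩ.ne']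
    rw [h7] at h6
    simp only [Pi.zero_apply, mul_zero, Finset.sum_const_zero] at h5
    linarith [h5.2, h6.1]
  have hc : ∀ y ∈ B, ∀ l, l ≠ k → y k - y l ≤ 1 + x l := by
    intro y hy l hl
    have := h4.sub_nonneg_of_mem hι h0R (hmemR y hy) l
    simp [hxk, hl] at this
    linarith
  -- The tile contains some s(1 − e_l) with s > 0, where y_k − y_l = s; hence x_l > −1.
  have hxnn : ∀ l, 0 ≤ x l := by
    intro l
    by_cases hl : l = k
    · rw [hl, hxk]
    · obtain ⟨s, hs, hs0⟩ := ((h2.eventually_smul_mem hι h0 hl (y := 1 - Pi.single l 1) (by simp)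
        (fun j hj => by simp [Ne.symm hl, hj])
        (Finset.sum_nonneg fun j _ => mul_nonneg (h.pos j).le (by
          by_cases hj : j = l
          · simp [hj]
          · simp [hj])) (by simp [Ne.symm hl])).and self_mem_nhdsWithin).exists
      have hs0 : 0 < s := hs0
      have := hc _ hs l hl
      simp [Ne.symm hl] at this
      have h5 : ((-1 : ℤ) : ℝ) < x l := by push_cast; linarith
      have := Int.cast_lt.1 h5
      omega
  have hxz : ∀ l, (x l : ℝ) = 0 := by
    intro l
    have hn : ∀ j ∈ Finset.univ, 0 ≤ ω j * (x j : ℝ) := fun j _ =>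
      mul_nonneg (h.pos j).le (by exact_mod_cast hxnn j)
    have := (Finset.sum_eq_zero_iff_of_nonneg hn).1 hx0 l (Finset.mem_univ l)
    exact (mul_eq_zero.1 this).resolve_left (h.pos l).ne'
  refine ⟨z, fun y hy => ?_⟩
  have hyB : (fun j => y j - z j) ∈ B := by
    change (fun i => (y i - z i) + (z i : ℝ)) ∈ A
    simpa using hy
  refine ⟨fun l => ⟨h2.sub_nonneg_of_mem hι h0 hyB l, ?_⟩, ?_⟩
  · by_cases hl : l = k
    · simp [hl]
    · have := hc _ hyB l hl
      rwa [hxz, add_zero] at this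
  · rw [tsum_fintype]
    exact h2.sum_mem_Icc hι h0 hyB

/-- If y_k − y_i varied by more than 1, it would vary by exactly 1 between two interior points.
These differ by a nonconstant lattice vector up to a diagonal shift, contradicting packing. -/
theorem width_le_one (h : IsTile ω k A) [DecidableEq ι] {i : ι} (hi : i ≠ k)
    (hall : ∀ j, j = k ∨ j = i) {a b : ι → ℝ} (ha : a ∈ A) (hb : b ∈ A) :
    (b k - b i) - (a k - a i) ≤ 1 := by
  by_contra hcon
  push Not at hcon
  have ho : IsOpen {x : (ι → ℝ) × (ι → ℝ) | 1 < (x.2 k - x.2 i) - (x.1 k - x.1 i)} :=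
    isOpen_lt continuous_const (by fun_prop)
  have hcl : (a, b) ∈ closure (interior A ×ˢ interior A) := by
    rw [closure_prod_eq]
    exact ⟨h.subset_closure ha, h.subset_closure hb⟩
  obtain ⟨⟨a', b'⟩, hlt, ha', hb'⟩ := mem_closure_iff.1 hcl _ ho hcon
  simp only [mem_ofPred_eq] at hlt ha' hb'
  set θ := 1 / ((b' k - b' i) - (a' k - a' i)) with hθ
  have hpos : 0 < (b' k - b' i) - (a' k - a' i) := by linarith
  have hθ0 : 0 ≤ θ := by positivity
  have hθ1 : θ ≤ 1 := by rw [hθ, div_le_one hpos]; exact hlt.le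
  have hθ' : θ * ((b' k - b' i) - (a' k - a' i)) = 1 := one_div_mul_cancel hpos.ne'
  have hc := h.convex.interior ha' hb' (sub_nonneg.2 hθ1) hθ0 (by ring)
  obtain ⟨m, hm⟩ := h.packing a' (θ * (b' k - a' k)) (fun j => if j = k then 0 else -1) ha' (by
    convert hc using 1
    funext j
    rcases hall j with rfl | rfl
    · simp; ring
    · simp [hi]; linarith)
  have h1 := hm k
  have h2 := hm i
  simp [hi] at h1 h2
  omega

/-- The section y_i = 0 yields, for each x in (0,1), an integer m(x) with (x, m(x)) in the tile. By
the width bound m is nondecreasing and varies by at most 1. If it were not constant, closedness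
would put (0, m) and (1, m + 1) in the tile, a chord of length 1 > w. So the tile contains a segment
from (0, n) to (1, n), and chord lengths do the rest. -/
theorem exists_sub_mem_diagBox_of_eq_two (h : IsTile ω k A) {i : ι} (hi : i ≠ k)
    (hall : ∀ j, j = k ∨ j = i) :
    ∃ z : ι → ℤ, ∀ y ∈ A, (fun j => y j - z j) ∈ diagBox ω k := by
  classical
  let pt : ℝ → ℤ → ι → ℝ := fun x m j => if j = k then x else m
  have hptk : ∀ x m, pt x m k = x := fun x m => by simp [pt]
  have hpti : ∀ x m, pt x m i = m := fun x m => by simp [pt, hi]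
  have hext : ∀ f g : ι → ℝ, f k = g k → f i = g i → f = g := by
    intro f g h1 h2
    funext j
    rcases hall j with rfl | rfl
    · exact h1
    · exact h2
  have hpair : Finset.univ = ({k, i} : Finset ι) := by
    ext j; simpa using hall j
  have hsum : ∀ f : ι → ℝ, ∑ j, f j = f k + f i := fun f => by
    rw [hpair, Finset.sum_pair hi.symm]
  have hex : ∀ x : ℝ, x ∈ Ioo (0 : ℝ) 1 → ∃ m : ℤ, pt x m ∈ A := by
    intro x hx
    obtain ⟨z, hz⟩ := (h.slice i hi (pt x 0) (by simp [hpti])).2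
      ⟨0, rfl, fun l hl => by
        rcases hall l with rfl | rfl
        · simp
        · exact absurd rfl hl, by
        rw [hsum]
        simp only [hptk, hpti, Pi.zero_apply, Int.cast_zero, add_zero, mul_zero]
        have := h.pos k
        constructor <;> nlinarith [hx.1, hx.2]⟩
    have hs := h.strip _ hz
    simp only [hptk] at hs
    have h1 : ((-1 : ℤ) : ℝ) < z k := by push_cast; linarith [hs.1, hx.2]
    have h2 : (z k : ℝ) < ((1 : ℤ) : ℝ) := by push_cast; linarith [hs.2, hx.1]
    have h1 := Int.cast_lt.1 h1
    have h2 := Int.cast_lt.1 h2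
    have h3 : z k = 0 := by omega
    refine ⟨z i, ?_⟩
    convert hz using 1
    apply hext
    · simp [hptk, h3]
    · simp [hpti]
  choose! m hm using hex
  have hmono : ∀ x ∈ Ioo (0 : ℝ) 1, ∀ x' ∈ Ioo (0 : ℝ) 1, x < x' →
      m x ≤ m x' ∧ m x' ≤ m x + 1 := by
    intro x hx x' hx' hlt
    have h1 := h.width_le_one hi hall (hm x hx) (hm x' hx')
    have h2 := h.width_le_one hi hall (hm x' hx') (hm x hx)
    simp only [hptk, hpti] at h1 h2
    have h3 : ((m x - m x' : ℤ) : ℝ) < ((1 : ℤ) : ℝ) := by push_cast; linarith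
    have h4 : ((m x' - m x : ℤ) : ℝ) < ((2 : ℤ) : ℝ) := by
      push_cast; linarith [hx.1, hx'.2]
    have h3 := Int.cast_lt.1 h3
    have h4 := Int.cast_lt.1 h4
    omega
  have hlim : ∀ (n : ℤ) (a : ℝ), ∀ S : Set ℝ, (∀ x ∈ S, pt x n ∈ A) → a ∈ closure S →
      pt a n ∈ A := by
    intro n a S hS ha
    have hc : Continuous fun x => pt x n := by
      refine continuous_pi fun j => ?_
      rcases hall j with rfl | rfl
      · simp only [hptk]; fun_prop
      · simp only [hpti]; fun_prop
    exact closure_minimal (s := S) (t := (fun x => pt x n) ⁻¹' A) hS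
      (h.isCompact.isClosed.preimage hc) ha
  have hconst : ∀ x ∈ Ioo (0 : ℝ) 1, ∀ x' ∈ Ioo (0 : ℝ) 1, x < x' → m x = m x' := by
    intro x hx x' hx' hlt
    by_contra hne
    have h1 := hmono x hx x' hx' hlt
    have hlow : pt 0 (m x) ∈ A := by
      refine hlim _ 0 (Ioo 0 x) (fun t ht => ?_) ?_
      · have ht' : t ∈ Ioo (0 : ℝ) 1 := ⟨ht.1, ht.2.trans hx.2⟩
        have h2 := hmono t ht' x hx ht.2
        have h3 := hmono t ht' x' hx' (ht.2.trans hlt)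
        have : m t = m x := by omega
        rw [← this]; exact hm t ht'
      · rw [closure_Ioo hx.1.ne]; exact ⟨le_rfl, hx.1.le⟩
    have hhigh : pt 1 (m x') ∈ A := by
      refine hlim _ 1 (Ioo x' 1) (fun t ht => ?_) ?_
      · have ht' : t ∈ Ioo (0 : ℝ) 1 := ⟨hx'.1.trans ht.1, ht.2⟩
        have h2 := hmono x' hx' t ht' ht.1
        have h3 := hmono x hx t ht' (hlt.trans ht.1)
        have : m t = m x' := by omega
        rw [← this]; exact hm t ht'
      · rw [closure_Ioo hx'.2.ne]; exact ⟨hx'.2.le, le_rfl⟩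
    have h2 := h.chord_le _ 1 hlow (by
      convert hhigh using 1
      apply hext
      · simp [hptk]
      · simp only [hpti]
        have : m x' = m x + 1 := by omega
        rw [this]; push_cast; ring)
    linarith [h.ratio_lt_one hi]
  set n := m (1 / 2) with hn
  have hall' : ∀ x ∈ Ioo (0 : ℝ) 1, pt x n ∈ A := by
    intro x hx
    have : m x = n := by
      rcases lt_trichotomy x (1 / 2) with h1 | h1 | h1
      · exact hconst x hx _ (by norm_num) h1
      · rw [h1]
      · exact (hconst _ (by norm_num) x hx h1).symm
    rw [← this]; exact hm x hx
  have hcl : closure (Ioo (0 : ℝ) 1) = Icc 0 1 := closure_Ioo zero_ne_one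
  have hA0 : pt 0 n ∈ A := hlim n 0 _ hall' (by rw [hcl]; simp)
  have hA1 : pt 1 n ∈ A := hlim n 1 _ hall' (by rw [hcl]; simp)
  have hΩ := h.sum_pos
  have hw : ω k / (∑ j, ω j) * (ω k + ω i) = ω k := by
    rw [hsum]; exact div_mul_cancel₀ _ (by rw [← hsum]; exact hΩ.ne')
  set w := ω k / ∑ j, ω j with hwdef
  have hΩ' : 0 < ω k + ω i := by rw [← hsum]; exact hΩ
  have hA0w : (fun j => pt 0 n j + w) ∈ A := by
    obtain ⟨τ, hτ, ha, hb⟩ := h.chord _ hA0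
    have h3 := (h.strip _ ha).1
    have h4 : τ = 0 := by simp only [hptk] at h3; linarith [hτ.1]
    simpa [h4] using hb
  have hA1w : (fun j => pt 1 n j - w) ∈ A := by
    obtain ⟨τ, hτ, ha, hb⟩ := h.chord _ hA1
    have h3 := (h.strip _ hb).2
    have h4 : τ = w := by simp only [hptk] at h3; linarith [hτ.2]
    rwa [h4] at ha
  refine ⟨fun j => if j = k then 0 else n, fun y hy => ?_⟩
  have hu0 := h.width_le_one hi hall hA0 hy
  have hu1 := h.width_le_one hi hall hy hA1
  simp only [hptk, hpti] at hu0 hu1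
  set u := y k - y i + n with hu
  have hu0' : 0 ≤ u := by linarith
  have hu1' : u ≤ 1 := by linarith
  -- P and Q are the ends of the chord, on the diagonal through y, of the parallelogram spanned by
  -- the four known points. They are exactly w apart, so the bound on chord lengths, applied to y
  -- with each of them, places y in between.
  have hP := h.convex hA0w hA1 (sub_nonneg.2 hu1') hu0' (by ring)
  have hQ := h.convex hA0 hA1w (sub_nonneg.2 hu1') hu0' (by ring)
  have hτP := h.chord_le y ((1 - u) * w + u - y k) hy (by
    convert hP using 1
    apply hext
    · simp [hptk]
    · simp only [Pi.add_apply, Pi.smul_apply, smul_eq_mul, hpti]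
      rw [hu]; ring)
  have hτQ := h.chord_le _ (y k - (u - u * w)) hQ (by
    convert hy using 1
    apply hext
    · simp [hptk]; ring
    · simp only [Pi.add_apply, Pi.smul_apply, smul_eq_mul, hpti]
      rw [hu]; ring)
  refine ⟨fun j => ?_, ?_⟩
  · rcases hall j with rfl | rfl
    · simp
    · simp only [hi, if_true, if_false]
      push_cast
      constructor <;> linarith
  · rw [tsum_fintype, hsum]
    simp only [hi, if_true, if_false]
    have hyi : y i - n = y k - u := by rw [hu]; ring
    push_cast
    rw [hyi]
    constructor <;> nlinarith

/-- A tile is contained in a lattice translate of the model parallelotope. -/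
theorem exists_sub_mem_diagBox (h : IsTile ω k A) (hι : 2 ≤ Fintype.card ι) :
    ∃ z : ι → ℤ, ∀ y ∈ A, (fun j => y j - z j) ∈ diagBox ω k := by
  classical
  rcases hι.eq_or_lt with h2 | h3
  · have : Nontrivial ι := Fintype.one_lt_card_iff_nontrivial.1 (by omega)
    obtain ⟨i, hi⟩ := exists_ne k
    refine h.exists_sub_mem_diagBox_of_eq_two hi fun j => ?_
    have huniv : ({k, i} : Finset ι) = Finset.univ :=
      Finset.eq_univ_of_card _ (by rw [Finset.card_pair hi.symm, h2])
    have := Finset.mem_univ j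
    rw [← huniv] at this
    simpa using this
  · exact h.exists_sub_mem_diagBox_of_three_le h3

end IsTile
end

/-! ### The covering by lines and the model parallelotope -/

/-- The covering of a product of circles by a product of lines, with period lattice `ℤ^ι`. -/
def angle {ι : Type*} (y : ι → ℝ) : ι → AddCircle (2 * Real.pi) :=
  fun k => ((2 * Real.pi * y k : ℝ) : AddCircle (2 * Real.pi))

section
variable {ι : Type*}

theorem coe_two_pi_mul_eq_iff {a b : ℝ} :
    ((2 * Real.pi * a : ℝ) : AddCircle (2 * Real.pi)) = ((2 * Real.pi * b : ℝ) : AddCircle _) ↔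
      ∃ n : ℤ, b = a + n := by
  have hpi := Real.two_pi_pos
  rw [← sub_eq_zero, ← AddCircle.coe_sub, AddCircle.coe_eq_zero_iff]
  constructor
  · rintro ⟨n, hn⟩
    refine ⟨-n, ?_⟩
    rw [zsmul_eq_mul] at hn
    have : 2 * Real.pi * (a - b - n) = 0 := by linarith
    have := (mul_eq_zero.1 this).resolve_left hpi.ne'
    push_cast; linarith
  · rintro ⟨n, rfl⟩
    exact ⟨-n, by rw [zsmul_eq_mul]; push_cast; ring⟩

theorem angle_eq_iff {y y' : ι → ℝ} :
    angle y = angle y' ↔ ∃ z : ι → ℤ, ∀ i, y' i = y i + z i := by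
  constructor
  · intro h
    choose z hz using fun i => coe_two_pi_mul_eq_iff.1 (congrFun h i)
    exact ⟨z, hz⟩
  · rintro ⟨z, hz⟩
    exact funext fun i => coe_two_pi_mul_eq_iff.2 ⟨z i, hz i⟩

theorem angle_add (y y' : ι → ℝ) : angle (fun i => y i + y' i) = angle y + angle y' := by
  funext i
  simp [angle, mul_add]

theorem exists_coe_two_pi_mul (a : AddCircle (2 * Real.pi)) :
    ∃ x : ℝ, ((2 * Real.pi * x : ℝ) : AddCircle (2 * Real.pi)) = a := by
  obtain ⟨x, rfl⟩ := QuotientAddGroup.mk_surjective a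
  refine ⟨x / (2 * Real.pi), ?_⟩
  rw [mul_div_cancel₀ _ Real.two_pi_pos.ne']

theorem angle_surjective : Function.Surjective (angle (ι := ι)) := by
  intro t
  choose y hy using fun i => exists_coe_two_pi_mul (t i)
  exact ⟨y, funext hy⟩

theorem continuous_angle : Continuous (angle (ι := ι)) :=
  continuous_pi fun i => (AddCircle.continuous_mk' _).comp (by fun_prop)

theorem isOpenMap_coe_two_pi_mul :
    IsOpenMap fun x : ℝ => ((2 * Real.pi * x : ℝ) : AddCircle (2 * Real.pi)) := by
  have h1 : IsOpenMap fun x : ℝ => 2 * Real.pi * x :=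
    (Homeomorph.mulLeft₀ _ Real.two_pi_pos.ne').isOpenMap
  exact QuotientAddGroup.isOpenMap_coe.comp h1

theorem isOpenMap_angle [Finite ι] : IsOpenMap (angle (ι := ι)) :=
  IsOpenMap.piMap (f := fun _ : ι => fun x : ℝ => ((2 * Real.pi * x : ℝ) : AddCircle (2 * Real.pi)))
    (fun _ => isOpenMap_coe_two_pi_mul) (by simp)

/-- A lift of a point of the circle in a prescribed fundamental interval. -/
theorem exists_lift_sub_mem_Ico (a : ℝ) (t : AddCircle (2 * Real.pi)) :
    ∃ x : ℝ, ((2 * Real.pi * x : ℝ) : AddCircle (2 * Real.pi)) = t ∧ a - x ∈ Ico (0 : ℝ) 1 := by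
  obtain ⟨x, hx⟩ := exists_coe_two_pi_mul t
  refine ⟨x + ⌊a - x⌋, ?_, ?_⟩
  · rw [← hx]; exact (coe_two_pi_mul_eq_iff.2 ⟨_, rfl⟩).symm
  · have h1 := Int.floor_le (a - x)
    have h2 := Int.lt_floor_add_one (a - x)
    constructor <;> linarith

variable {ω : ι → ℝ} {k : ι} {y : ι → ℝ}

theorem summable_mul_of_abs_le (hω : ∀ i, 0 < ω i) (hs : Summable ω) {b : ι → ℝ} {M : ℝ}
    (hb : ∀ i, |b i| ≤ M) : Summable fun i => ω i * b i := by
  refine Summable.of_norm_bounded (hs.mul_right M) fun i => ?_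
  rw [Real.norm_eq_abs, abs_mul, abs_of_pos (hω i)]
  exact mul_le_mul_of_nonneg_left (hb i) (hω i).le

theorem abs_le_of_sub_mem_Icc (hy : ∀ i, y k - y i ∈ Icc (0 : ℝ) 1) (i : ι) :
    |y i| ≤ |y k| + 1 := by
  have h1 := hy i
  have h2 := abs_le.1 (le_refl |y k|)
  rw [abs_le]
  constructor <;> linarith [h1.1, h1.2]

theorem tsum_mul_sub (hω : ∀ i, 0 < ω i) (hs : Summable ω)
    (hy : ∀ i, y k - y i ∈ Icc (0 : ℝ) 1) :
    ∑' i, ω i * (y k - y i) = (∑' i, ω i) * y k - ∑' i, ω i * y i := by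
  rw [← tsum_mul_right, ← Summable.tsum_sub (hs.mul_right _)
    (summable_mul_of_abs_le hω hs (abs_le_of_sub_mem_Icc hy))]
  exact tsum_congr fun i => by ring

theorem summable_mul_sub (hω : ∀ i, 0 < ω i) (hs : Summable ω)
    (hy : ∀ i, y k - y i ∈ Icc (0 : ℝ) 1) : Summable fun i => ω i * (y k - y i) :=
  summable_mul_of_abs_le hω hs (M := 1) fun i => by
    rw [abs_of_nonneg (hy i).1]; exact (hy i).2

theorem tsum_weight_pos (hω : ∀ i, 0 < ω i) (hs : Summable ω) (k : ι) : 0 < ∑' i, ω i :=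
  hs.tsum_pos (fun i => (hω i).le) k (hω k)

/-- Lower bound for the distinguished coordinate of a point of the model parallelotope. -/
theorem weight_mul_le_of_mem_diagBox (hω : ∀ i, 0 < ω i) (hs : Summable ω)
    (hy : y ∈ diagBox ω k) (i : ι) : ω i * (y k - y i) ≤ (∑' i, ω i) * y k := by
  -- Ω y_k = h(y) + ∑ ω_j (y_k − y_j), where h(y) and all terms of the sum are nonnegative.
  have h1 := (summable_mul_sub hω hs hy.1).le_tsum i
    (fun j _ => mul_nonneg (hω j).le (hy.1 j).1)
  rw [tsum_mul_sub hω hs hy.1] at h1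
  linarith [hy.2.1]

/-- Upper bound for the distinguished coordinate of a point of the model parallelotope. -/
theorem weight_mul_one_sub_le_of_mem_diagBox (hω : ∀ i, 0 < ω i) (hs : Summable ω)
    (hy : y ∈ diagBox ω k) {i : ι} (hi : i ≠ k) :
    ω i * (1 - (y k - y i)) ≤ (∑' i, ω i) * (1 - y k) := by
  classical
  have hsum : Summable fun j => ω j * (1 - (y k - y j)) := by
    have := hs.sub (summable_mul_sub hω hs hy.1)
    exact this.congr fun j => by ring
  have hval : ∑' j, ω j * (1 - (y k - y j)) =
      ∑' j, ω j - ((∑' i, ω i) * y k - ∑' i, ω i * y i) := by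
    rw [← tsum_mul_sub hω hs hy.1, ← Summable.tsum_sub hs (summable_mul_sub hω hs hy.1)]
    exact tsum_congr fun j => by ring
  -- The nonnegative terms ω_j (1 − (y_k − y_j)) have sum Ω(1 − y_k) + h(y). The term j = k is ω_k,
  -- which compensates h(y) ≤ ω_k.
  have h1 := hsum.sum_le_tsum {i, k} (fun j _ => mul_nonneg (hω j).le
    (by linarith [(hy.1 j).2]))
  rw [Finset.sum_pair hi, hval] at h1
  have h2 := hy.2.2
  simp only [sub_self, sub_zero, mul_one] at h1
  linarith

theorem mem_Icc_of_mem_diagBox (hω : ∀ i, 0 < ω i) (hs : Summable ω)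
    (hy : y ∈ diagBox ω k) : y k ∈ Icc (0 : ℝ) 1 := by
  have hΩ := tsum_weight_pos hω hs k
  constructor
  · have := weight_mul_le_of_mem_diagBox hω hs hy k
    simp only [sub_self, mul_zero] at this
    exact nonneg_of_mul_nonneg_right this hΩ
  · by_cases hex : ∃ i, i ≠ k
    · obtain ⟨i, hi⟩ := hex
      have h1 := weight_mul_one_sub_le_of_mem_diagBox hω hs hy hi
      have h2 : 0 ≤ ω i * (1 - (y k - y i)) :=
        mul_nonneg (hω i).le (by linarith [(hy.1 i).2])
      have := nonneg_of_mul_nonneg_right (h2.trans h1) hΩ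
      linarith
    · push Not at hex
      have : ∑' i, ω i * y i = ω k * y k := tsum_eq_single k fun i hi => absurd (hex i) hi
      have h2 := hy.2.2
      rw [this] at h2
      have := hω k
      nlinarith

theorem abs_le_one_of_mem_diagBox (hω : ∀ i, 0 < ω i) (hs : Summable ω)
    (hy : y ∈ diagBox ω k) (i : ι) : y i ∈ Icc (-1 : ℝ) 1 := by
  have h1 := mem_Icc_of_mem_diagBox hω hs hy
  have h2 := hy.1 i
  constructor <;> linarith [h1.1, h1.2, h2.1, h2.2]

/-- The only integral value of a coordinate `i ≠ k` on the model parallelotope is `0`. -/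
theorem eq_zero_of_mem_diagBox_of_int (hω : ∀ i, 0 < ω i) (hs : Summable ω)
    (hy : y ∈ diagBox ω k) {i : ι} (hi : i ≠ k) {n : ℤ} (hn : y i = n) : n = 0 := by
  have hΩ := tsum_weight_pos hω hs k
  have h1 := mem_Icc_of_mem_diagBox hω hs hy
  have h2 := hy.1 i
  have h3 := weight_mul_le_of_mem_diagBox hω hs hy i
  have h4 := weight_mul_one_sub_le_of_mem_diagBox hω hs hy hi
  have hωi := hω i
  -- At either extreme y_k and y_k − y_i are determined, and the weighted inequality becomes ω_i ≤
  -- 0.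
  have hlow : -1 < y i := by
    by_contra hcon
    have h5 : y k = 0 := by linarith [h1.1, h2.2]
    have h6 : y k - y i = 1 := by linarith [h2.2]
    rw [h6, h5] at h3
    linarith
  have hup : y i < 1 := by
    by_contra hcon
    have h5 : y k = 1 := by linarith [h1.2, h2.1]
    have h6 : y k - y i = 0 := by linarith [h2.1]
    rw [h6, h5] at h4
    linarith
  rw [hn] at hlow hup
  have h5 : -1 < n := by exact_mod_cast hlow
  have h6 : n < 1 := by exact_mod_cast hup
  omega

/-- If the distinguished coordinate is integral, the point projects to `0`. -/
theorem angle_eq_zero_of_mem_diagBox (hω : ∀ i, 0 < ω i) (hs : Summable ω)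
    (hy : y ∈ diagBox ω k) {n : ℤ} (hn : y k = n) : angle y = angle (0 : ι → ℝ) := by
  classical
  have h1 := mem_Icc_of_mem_diagBox hω hs hy
  have hzero : ∀ i, i ≠ k → y i = 0 := by
    intro i hi
    have h2 := hy.1 i
    have h3 := weight_mul_le_of_mem_diagBox hω hs hy i
    have h4 := weight_mul_one_sub_le_of_mem_diagBox hω hs hy hi
    have hωi := hω i
    rw [hn] at h1
    have h5 : 0 ≤ n := by exact_mod_cast h1.1
    have h6 : n ≤ 1 := by exact_mod_cast h1.2
    rcases (by omega : n = 0 ∨ n = 1) with h7 | h7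
    · rw [hn, h7] at h3 h2
      push_cast at h3 h2
      nlinarith [h2.1]
    · rw [hn, h7] at h4 h2
      push_cast at h4 h2
      nlinarith [h2.2]
  refine (angle_eq_iff.2 ⟨fun i => if i = k then n else 0, fun i => ?_⟩).symm
  by_cases hi : i = k
  · simp [hi, hn]
  · simp [hi, hzero i hi]

theorem zero_mem_diagBox (hω : ∀ i, 0 < ω i) : (0 : ι → ℝ) ∈ diagBox ω k :=
  ⟨by simp, by simp [(hω k).le]⟩

theorem convex_diagBox (hω : ∀ i, 0 < ω i) (hs : Summable ω) : Convex ℝ (diagBox ω k) := by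
  intro x hx y hy a b ha hb hab
  have hsum : ∑' i, ω i * (a • x + b • y) i = a * ∑' i, ω i * x i + b * ∑' i, ω i * y i := by
    rw [← tsum_mul_left, ← tsum_mul_left, ← Summable.tsum_add
      ((summable_mul_of_abs_le hω hs (abs_le_of_sub_mem_Icc hx.1)).mul_left a)
      ((summable_mul_of_abs_le hω hs (abs_le_of_sub_mem_Icc hy.1)).mul_left b)]
    refine tsum_congr fun i => ?_
    simp only [Pi.add_apply, Pi.smul_apply, smul_eq_mul]; ring
  refine ⟨fun i => ?_, ?_⟩
  · have h := convex_Icc (0 : ℝ) 1 (hx.1 i) (hy.1 i) ha hb hab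
    convert h using 1
    simp only [Pi.add_apply, Pi.smul_apply, smul_eq_mul]; ring
  · rw [hsum]
    exact convex_Icc 0 (ω k) hx.2 hy.2 ha hb hab

/-- The box lies in the compact cube [−1,1]^I, on which h is a uniformly convergent sum of
continuous functions. -/
theorem isCompact_diagBox (hω : ∀ i, 0 < ω i) (hs : Summable ω) : IsCompact (diagBox ω k) := by
  set C : Set (ι → ℝ) := Set.pi univ fun _ => Icc (-1 : ℝ) 1 with hC
  have hCc : IsCompact C := isCompact_univ_pi fun _ => isCompact_Icc
  have hcont : ContinuousOn (fun y : ι → ℝ => ∑' i, ω i * y i) C := by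
    refine continuousOn_tsum (u := ω) (fun i => by fun_prop) hs fun i y hy => ?_
    rw [Real.norm_eq_abs, abs_mul, abs_of_pos (hω i)]
    have := hy i (mem_univ i)
    exact mul_le_of_le_one_right (hω i).le (abs_le.2 ⟨this.1, this.2⟩)
  have heq : diagBox ω k = (C ∩ (fun y : ι → ℝ => ∑' i, ω i * y i) ⁻¹' Icc 0 (ω k)) ∩
      ⋂ i, {y | y k - y i ∈ Icc (0 : ℝ) 1} := by
    ext y
    constructor
    · intro hy
      exact ⟨⟨fun i _ => abs_le_one_of_mem_diagBox hω hs hy i, hy.2⟩, mem_iInter.2 hy.1⟩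
    · rintro ⟨⟨-, h1⟩, h2⟩
      exact ⟨mem_iInter.1 h2, h1⟩
  rw [heq]
  have hcl : IsClosed (C ∩ (fun y : ι → ℝ => ∑' i, ω i * y i) ⁻¹' Icc 0 (ω k)) :=
    hcont.preimage_isClosed_of_isClosed hCc.isClosed isClosed_Icc
  refine (hCc.of_isClosed_subset hcl inter_subset_left).inter_right
    (isClosed_iInter fun i => ?_)
  exact isClosed_Icc.preimage (by fun_prop : Continuous fun y : ι → ℝ => y k - y i)

end

/-! ### Diagonals, interiors and closures of the pieces -/

/-- The open part of the model parallelotope. -/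
def openDiagBox {ι : Type*} (ω : ι → ℝ) (k : ι) : Set (ι → ℝ) :=
  {y | (∀ i, i ≠ k → y k - y i ∈ Ioo (0 : ℝ) 1) ∧ ∑' i, ω i * y i ∈ Ioo 0 (ω k)}

section
variable {ι : Type*} {ω : ι → ℝ} {k : ι} {y : ι → ℝ}

theorem sub_mem_Icc_of_Ioo (hy : ∀ i, i ≠ k → y k - y i ∈ Ioo (0 : ℝ) 1) (i : ι) :
    y k - y i ∈ Icc (0 : ℝ) 1 := by
  by_cases hi : i = k
  · simp [hi]
  · exact Ioo_subset_Icc_self (hy i hi)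

theorem openDiagBox_subset : openDiagBox ω k ⊆ diagBox ω k := fun _ hy =>
  ⟨sub_mem_Icc_of_Ioo hy.1, Ioo_subset_Icc_self hy.2⟩

theorem tsum_mul_add_const (hω : ∀ i, 0 < ω i) (hs : Summable ω)
    (hy : ∀ i, y k - y i ∈ Icc (0 : ℝ) 1) (σ : ℝ) :
    ∑' i, ω i * (y i + σ) = ∑' i, ω i * y i + (∑' i, ω i) * σ := by
  rw [← tsum_mul_right, ← Summable.tsum_add
    (summable_mul_of_abs_le hω hs (abs_le_of_sub_mem_Icc hy)) (hs.mul_right _)]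
  exact tsum_congr fun i => by ring

/-- z_k − z_i is a difference of a number in (0,1) and one in [0,1], hence 0. Lifts of a generic
diagonal into the box therefore differ by constants only, and membership becomes a condition on h.
-/
theorem int_eq_of_sub_mem_Icc (hy : ∀ i, i ≠ k → y k - y i ∈ Ioo (0 : ℝ) 1) {τ : ℝ} {z : ι → ℤ}
    (hz : ∀ i, (y k + τ + z k) - (y i + τ + z i) ∈ Icc (0 : ℝ) 1) (i : ι) : z i = z k := by
  by_cases hi : i = k
  · rw [hi]
  · have h1 := hy i hi
    have h2 := hz i
    have h3 : ((z k - z i : ℤ) : ℝ) < ((1 : ℤ) : ℝ) := by push_cast; linarith [h1.1, h2.2]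
    have h4 : ((-1 : ℤ) : ℝ) < ((z k - z i : ℤ) : ℝ) := by push_cast; linarith [h1.2, h2.1]
    have h3 := Int.cast_lt.1 h3
    have h4 := Int.cast_lt.1 h4
    omega

/-- The intersection of a general diagonal with the image of the model parallelotope. -/
theorem angle_add_mem_image_diagBox_iff (hω : ∀ i, 0 < ω i) (hs : Summable ω)
    (hy : ∀ i, i ≠ k → y k - y i ∈ Ioo (0 : ℝ) 1) (τ : ℝ) :
    angle (fun i => y i + τ) ∈ angle '' diagBox ω k ↔
      ∃ m : ℤ, ∑' i, ω i * y i + (∑' i, ω i) * (τ + m) ∈ Icc 0 (ω k) := by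
  constructor
  · rintro ⟨y', hy', he⟩
    obtain ⟨z, hz⟩ := angle_eq_iff.1 he.symm
    have hzk := int_eq_of_sub_mem_Icc hy (τ := τ) (z := z) (fun i => by
      rw [← hz, ← hz]; exact hy'.1 i)
    refine ⟨z k, ?_⟩
    rw [← tsum_mul_add_const hω hs (sub_mem_Icc_of_Ioo hy)]
    convert hy'.2 using 4 with i
    rw [hz, hzk i]; ring
  · rintro ⟨m, hm⟩
    refine ⟨fun i => y i + (τ + m), ⟨fun i => ?_, ?_⟩, ?_⟩
    · have := sub_mem_Icc_of_Ioo hy i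
      simpa using this
    · rwa [tsum_mul_add_const hω hs (sub_mem_Icc_of_Ioo hy)]
    · exact (angle_eq_iff.2 ⟨fun _ => m, fun i => by ring⟩).symm

theorem angle_add_mem_image_openDiagBox_iff (hω : ∀ i, 0 < ω i) (hs : Summable ω)
    (hy : ∀ i, i ≠ k → y k - y i ∈ Ioo (0 : ℝ) 1) (τ : ℝ) :
    angle (fun i => y i + τ) ∈ angle '' openDiagBox ω k ↔
      ∃ m : ℤ, ∑' i, ω i * y i + (∑' i, ω i) * (τ + m) ∈ Ioo 0 (ω k) := by
  constructor
  · rintro ⟨y', hy', he⟩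
    obtain ⟨z, hz⟩ := angle_eq_iff.1 he.symm
    have hzk := int_eq_of_sub_mem_Icc hy (τ := τ) (z := z) (fun i => by
      rw [← hz, ← hz]; exact sub_mem_Icc_of_Ioo hy'.1 i)
    refine ⟨z k, ?_⟩
    rw [← tsum_mul_add_const hω hs (sub_mem_Icc_of_Ioo hy)]
    convert hy'.2 using 4 with i
    rw [hz, hzk i]; ring
  · rintro ⟨m, hm⟩
    refine ⟨fun i => y i + (τ + m), ⟨fun i hi => ?_, ?_⟩, ?_⟩
    · have := hy i hi
      simpa using this
    · rwa [tsum_mul_add_const hω hs (sub_mem_Icc_of_Ioo hy)]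
    · exact (angle_eq_iff.2 ⟨fun _ => m, fun i => by ring⟩).symm

/-- Two lifts differ by a constant integer m, and h by mΩ. As h ranges over an open interval of
length ω_k ≤ Ω, m = 0. -/
theorem injOn_angle_openDiagBox (hω : ∀ i, 0 < ω i) (hs : Summable ω) :
    InjOn angle (openDiagBox ω k) := by
  intro y hy y' hy' he
  obtain ⟨z, hz⟩ := angle_eq_iff.1 he
  have hzk := int_eq_of_sub_mem_Icc hy.1 (τ := 0) (z := z) (fun i => by
    rw [add_zero, add_zero, ← hz, ← hz]; exact sub_mem_Icc_of_Ioo hy'.1 i)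
  have hΩ := tsum_weight_pos hω hs k
  have hle : ω k ≤ ∑' i, ω i := hs.le_tsum k fun j _ => (hω j).le
  have hh : ∑' i, ω i * y' i = ∑' i, ω i * y i + (∑' i, ω i) * z k := by
    rw [← tsum_mul_add_const hω hs (sub_mem_Icc_of_Ioo hy.1)]
    exact tsum_congr fun i => by rw [hz, hzk]
  have h1 := hy.2
  have h2 := hy'.2
  rw [hh] at h2
  have h3 : (∑' i, ω i) * z k < (∑' i, ω i) * 1 := by linarith [h1.1, h2.2]
  have h4 : (∑' i, ω i) * (-1) < (∑' i, ω i) * z k := by linarith [h1.2, h2.1]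
  have h3 := lt_of_mul_lt_mul_left h3 hΩ.le
  have h4 := lt_of_mul_lt_mul_left h4 hΩ.le
  have h3 : z k < 1 := by exact_mod_cast h3
  have h4 : -1 < z k := by exact_mod_cast h4
  have h5 : z k = 0 := by omega
  funext i
  rw [hz, hzk, h5]; simp

theorem interior_diagBox_subset (hω : ∀ i, 0 < ω i) (hs : Summable ω) :
    interior (diagBox ω k) ⊆ openDiagBox ω k := by
  classical
  intro y hy
  have hmem : ∀ i, ∃ ε > (0 : ℝ), y + ε • Pi.single i 1 ∈ diagBox ω k ∧
      y - ε • Pi.single i 1 ∈ diagBox ω k := by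
    intro i
    have h1 : Tendsto (fun ε : ℝ => (y + ε • Pi.single i 1 : ι → ℝ)) (𝓝 0) (𝓝 y) := by
      have : Tendsto (fun ε : ℝ => (y + ε • Pi.single i 1 : ι → ℝ)) (𝓝 0)
        (𝓝 (y + (0 : ℝ) • Pi.single i 1)) := Continuous.tendsto (by fun_prop) 0
      simpa using this
    have h2 : Tendsto (fun ε : ℝ => (y - ε • Pi.single i 1 : ι → ℝ)) (𝓝 0) (𝓝 y) := by
      have : Tendsto (fun ε : ℝ => (y - ε • Pi.single i 1 : ι → ℝ)) (𝓝 0)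
        (𝓝 (y - (0 : ℝ) • Pi.single i 1)) := Continuous.tendsto (by fun_prop) 0
      simpa using this
    have hn := mem_interior_iff_mem_nhds.1 hy
    obtain ⟨ε, ⟨h3, h4⟩, h5⟩ := (((h1.mono_left nhdsWithin_le_nhds).eventually hn).and
      ((h2.mono_left nhdsWithin_le_nhds).eventually hn) |>.and
        (self_mem_nhdsWithin (s := Ioi (0 : ℝ)))).exists
    exact ⟨ε, h5, h3, h4⟩
  have hyD := interior_subset hy
  refine ⟨fun i hi => ?_, ?_⟩
  · obtain ⟨ε, h0, h1, h2⟩ := hmem i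
    have h3 := h1.1 i
    have h4 := h2.1 i
    simp [Ne.symm hi] at h3 h4
    constructor <;> linarith
  · obtain ⟨ε, h0, h1, h2⟩ := hmem k
    have hsum : ∀ δ : ℝ, ∑' i, ω i * (y i + δ * (Pi.single k 1 : ι → ℝ) i) =
        ∑' i, ω i * y i + δ * ω k := by
      intro δ
      have hsing : Summable fun i => ω i * (δ * (Pi.single k 1 : ι → ℝ) i) :=
        summable_of_ne_finset_zero (s := {k}) fun i hi => by
          simp only [Finset.mem_singleton] at hi; simp [hi]
      have : ∑' i, ω i * (δ * (Pi.single k 1 : ι → ℝ) i) = δ * ω k := by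
        rw [tsum_eq_single k fun i hi => by simp [hi]]
        simp [mul_comm]
      rw [← this, ← Summable.tsum_add
        (summable_mul_of_abs_le hω hs (abs_le_of_sub_mem_Icc hyD.1)) hsing]
      exact tsum_congr fun i => by ring
    have h3 := h1.2
    have h4 := h2.2
    have hs1 := hsum ε
    have hs2 := hsum (-ε)
    simp only [Pi.add_apply, Pi.sub_apply, Pi.smul_apply, smul_eq_mul, sub_eq_add_neg,
      ← neg_mul] at h3 h4
    rw [hs1] at h3
    rw [hs2] at h4
    have := mul_pos h0 (hω k)
    constructor <;> linarith [h3.2, h4.1]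

theorem interior_diagBox_of_finite [Finite ι] (hω : ∀ i, 0 < ω i) :
    interior (diagBox ω k) = openDiagBox ω k := by
  have := Fintype.ofFinite ι
  refine (interior_diagBox_subset hω (hasSum_fintype ω).summable).antisymm
    (interior_maximal openDiagBox_subset ?_)
  have : openDiagBox ω k = (⋂ i, {y | i ≠ k → y k - y i ∈ Ioo (0 : ℝ) 1}) ∩
      {y | ∑ i, ω i * y i ∈ Ioo 0 (ω k)} := by
    ext y; simp [openDiagBox, tsum_fintype]
  rw [this]
  refine (isOpen_iInter_of_finite fun i => ?_).inter
    (isOpen_Ioo.preimage (by fun_prop : Continuous fun y : ι → ℝ => ∑ i, ω i * y i))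
  by_cases hi : i = k
  · simp [hi]
  · simp only [hi, ne_eq, not_false_eq_true, forall_true_left]
    exact isOpen_Ioo.preimage (by fun_prop : Continuous fun y : ι → ℝ => y k - y i)

/-- A basic open set leaves some coordinate other than k free, so y_k − y_i is unbounded on it. -/
theorem interior_diagBox_of_infinite [Infinite ι] : interior (diagBox ω k) = ∅ := by
  classical
  rw [eq_empty_iff_forall_notMem]
  intro y hy
  obtain ⟨I, u, hu, hsub⟩ := isOpen_pi_iff.1 isOpen_interior y hy
  obtain ⟨i, hi⟩ := Infinite.exists_notMem_finset (insert k I)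
  simp only [Finset.mem_insert, not_or] at hi
  have hmem : Function.update y i (y k + 1) ∈ interior (diagBox ω k) := by
    refine hsub fun j hj => ?_
    have hji : j ≠ i := fun h => hi.2 (h ▸ hj)
    rw [Function.update_of_ne hji]
    exact (hu j hj).2
  have := ((interior_subset hmem).1 i).1
  rw [Function.update_of_ne (Ne.symm hi.1), Function.update_self] at this
  linarith

/-- The open part of the model parallelotope maps to interior points, in any dimension. -/
theorem angle_image_openDiagBox_subset (hω : ∀ i, 0 < ω i) (hs : Summable ω) :
    angle '' openDiagBox ω k ⊆ interior (angle '' diagBox ω k) := by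
  classical
  rintro _ ⟨y, ⟨hc, hh⟩, rfl⟩
  set h := ∑' i, ω i * y i with hhdef
  set Ω := ∑' i, ω i with hΩdef
  have hΩ := tsum_weight_pos hω hs k
  obtain ⟨μ, hμ0, hμ1, hμ2⟩ : ∃ μ > 0, μ ≤ h ∧ μ ≤ ω k - h :=
    ⟨min h (ω k - h), lt_min hh.1 (by linarith [hh.2]), min_le_left _ _, min_le_right _ _⟩
  -- Choose finitely many coordinates carrying almost all the weight. They are kept near y, while
  -- each remaining coordinate is lifted into the fundamental interval below the k-th one. The box
  -- inequalities hold automatically there, and h changes by little more than twice the remaining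
  -- weight.
  obtain ⟨F, hF⟩ : ∃ F : Finset ι, Ω - ∑ i ∈ F, ω i < μ / 4 := by
    have := (tendsto_order.1 hs.hasSum).1 (Ω - μ / 4) (by linarith)
    obtain ⟨F, hF⟩ := this.exists
    exact ⟨F, by linarith⟩
  set F' := insert k F with hF'
  have hF'sum : Ω - ∑ i ∈ F', ω i < μ / 4 := by
    have := Finset.sum_le_sum_of_subset_of_nonneg (Finset.subset_insert k F)
      (fun i _ _ => (hω i).le)
    linarith
  obtain ⟨η, ⟨⟨hη1, hη2⟩, hη3⟩, hη0⟩ : ∃ η : ℝ, ((η < 1 ∧ Ω * η < μ / 4) ∧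
      ∀ i ∈ F', i ≠ k → 2 * η < y k - y i ∧ 2 * η < 1 - (y k - y i)) ∧ 0 < η := by
    refine (((eventually_lt_right one_pos).and (eventually_lt_of_continuous
      (f := fun η => Ω * η) (g := fun _ => μ / 4) (by fun_prop) (by fun_prop)
      (by simpa using hμ0))).and ((Filter.eventually_all_finset F').2 fun i _ => ?_) |>.and
        self_mem_nhdsWithin).exists
    by_cases hi : i = k
    · simp [hi]
    · have := hc i hi
      filter_upwards [eventually_lt_of_continuous (f := fun η => 2 * η) (g := fun _ => y k - y i)
        (by fun_prop) (by fun_prop) (by simpa using this.1),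
        eventually_lt_of_continuous (f := fun η => 2 * η) (g := fun _ => 1 - (y k - y i))
        (by fun_prop) (by fun_prop) (by simpa using this.2)] with η h1 h2 _ using ⟨h1, h2⟩
  let U : Set (ι → AddCircle (2 * Real.pi)) := Set.pi F' fun i =>
    (fun x : ℝ => ((2 * Real.pi * x : ℝ) : AddCircle (2 * Real.pi))) '' Metric.ball (y i) η
  have hU : IsOpen U := isOpen_set_pi F'.finite_toSet fun i _ =>
    isOpenMap_coe_two_pi_mul _ Metric.isOpen_ball
  refine mem_interior.2 ⟨U, fun t ht => ?_, hU, fun i _ => ⟨y i, Metric.mem_ball_self hη0, rfl⟩⟩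
  obtain ⟨a, ha, hat⟩ := ht k (Finset.mem_insert_self k F)
  have hex : ∀ i, ∃ x : ℝ, ((2 * Real.pi * x : ℝ) : AddCircle (2 * Real.pi)) = t i ∧
      (i = k → x = a) ∧ (i ∈ F' → |x - y i| < η) ∧ (i ∉ F' → a - x ∈ Ico (0 : ℝ) 1) := by
    intro i
    by_cases hi : i ∈ F'
    · by_cases hik : i = k
      · subst hik
        exact ⟨a, hat, fun _ => rfl, fun _ => ha, fun h => absurd hi h⟩
      · obtain ⟨x, hx, hxt⟩ := ht i hi
        exact ⟨x, hxt, fun h => absurd h hik, fun _ => hx, fun h => absurd hi h⟩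
    · obtain ⟨x, hxt, hx⟩ := exists_lift_sub_mem_Ico a (t i)
      exact ⟨x, hxt, fun h => absurd (h ▸ Finset.mem_insert_self k F) hi,
        fun h => absurd h hi, fun _ => hx⟩
  choose y' hy't hy'k hy'F hy'N using hex
  have hyk : y' k = a := hy'k k rfl
  have hka := abs_lt.1 (hy'F k (Finset.mem_insert_self k F))
  have hcc := sub_mem_Icc_of_Ioo hc
  have hc' : ∀ i, y' k - y' i ∈ Icc (0 : ℝ) 1 := by
    intro i
    by_cases hi : i ∈ F'
    · by_cases hik : i = k
      · simp [hik]
      · have h1 := abs_lt.1 (hy'F i hi)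
        have h2 := hη3 i hi hik
        constructor <;> linarith [h2.1, h2.2]
    · rw [hyk]; exact Ico_subset_Icc_self (hy'N i hi)
  have hdiff : ∀ i, |ω i * (y' i - y i)| ≤ ω i * η + (2 * ω i - if i ∈ F' then 2 * ω i else 0) := by
    intro i
    rw [abs_mul, abs_of_pos (hω i)]
    by_cases hi : i ∈ F'
    · simp only [hi, if_true, sub_self, add_zero]
      exact mul_le_mul_of_nonneg_left (hy'F i hi).le (hω i).le
    · simp only [hi, if_false, sub_zero]
      have h1 := hcc i
      have h2 := hc' i
      have h3 : |y' i - y i| ≤ η + 2 := by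
        rw [abs_le]; constructor <;> linarith [h1.1, h1.2, h2.1, h2.2]
      have := mul_le_mul_of_nonneg_left h3 (hω i).le
      linarith
  have hite : Summable fun i => if i ∈ F' then 2 * ω i else 0 :=
    summable_of_ne_finset_zero (s := F') fun i hi => by simp [hi]
  have hbs : Summable fun i => ω i * η + (2 * ω i - if i ∈ F' then 2 * ω i else 0) :=
    (hs.mul_right _).add ((hs.mul_left 2).sub hite)
  have hbv : ∑' i, (ω i * η + (2 * ω i - if i ∈ F' then 2 * ω i else 0)) =
      Ω * η + 2 * (Ω - ∑ i ∈ F', ω i) := by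
    have hitev : ∑' i, (if i ∈ F' then 2 * ω i else 0) = 2 * ∑ i ∈ F', ω i := by
      rw [tsum_eq_sum (s := F') (fun i hi => if_neg hi), Finset.mul_sum]
      exact Finset.sum_congr rfl fun i hi => if_pos hi
    rw [Summable.tsum_add (hs.mul_right _) ((hs.mul_left 2).sub hite),
      Summable.tsum_sub (hs.mul_left 2) hite, tsum_mul_right, tsum_mul_left, hitev]
    ring
  have hle : |∑' i, ω i * (y' i - y i)| ≤ Ω * η + 2 * (Ω - ∑ i ∈ F', ω i) := by
    rw [← hbv]
    exact tsum_of_norm_bounded (f := fun i => ω i * (y' i - y i)) hbs.hasSum hdiff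
  have hval : ∑' i, ω i * y' i = h + ∑' i, ω i * (y' i - y i) := by
    have h1 := summable_mul_of_abs_le hω hs (abs_le_of_sub_mem_Icc hcc)
    have h2 := summable_mul_of_abs_le hω hs (abs_le_of_sub_mem_Icc hc')
    rw [hhdef, ← Summable.tsum_add h1 ((h2.sub h1).congr fun i => by ring)]
    exact tsum_congr fun i => by ring
  refine ⟨y', ⟨hc', ?_⟩, funext hy't⟩
  rw [hval]
  have := abs_le.1 hle
  constructor <;> linarith

theorem diagBox_subset_closure (hω : ∀ i, 0 < ω i) (hs : Summable ω) :
    diagBox ω k ⊆ closure (openDiagBox ω k) := by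
  classical
  intro y hy
  -- e_k/2 lies in the open part, so moving towards it makes every inequality strict.
  set p : ι → ℝ := (1 / 2 : ℝ) • Pi.single k 1 with hp
  have hpk : p k = 1 / 2 := by simp [hp]
  have hpi : ∀ i, i ≠ k → p i = 0 := fun i hi => by simp [hp, hi]
  have hph : ∑' i, ω i * p i = ω k / 2 := by
    rw [tsum_eq_single k fun i hi => by simp [hpi i hi], hpk]; ring
  have hpabs : ∀ i, |p i| ≤ 1 := by
    intro i
    by_cases hi : i = k
    · rw [hi, hpk]; norm_num
    · rw [hpi i hi]; norm_num
  have ht : Tendsto (fun ε : ℝ => (1 - ε) • y + ε • p) (𝓝[>] 0) (𝓝 y) := by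
    have : Tendsto (fun ε : ℝ => (1 - ε) • y + ε • p) (𝓝 0) (𝓝 ((1 - (0 : ℝ)) • y + (0 : ℝ) • p)) :=
      Continuous.tendsto (by fun_prop) 0
    simp only [sub_zero, one_smul, zero_smul, add_zero] at this
    exact this.mono_left nhdsWithin_le_nhds
  refine mem_closure_of_tendsto ht ?_
  filter_upwards [eventually_lt_right one_pos, self_mem_nhdsWithin] with ε hε1 hε0
  have hε0 : 0 < ε := hε0
  refine ⟨fun i hi => ?_, ?_⟩
  · have := hy.1 i
    have h1 : (0 : ℝ) ≤ (1 - ε) * (y k - y i) := mul_nonneg (by linarith) this.1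
    have h2 : (1 - ε) * (y k - y i) ≤ 1 - ε := mul_le_of_le_one_right (by linarith) this.2
    simp only [Pi.add_apply, Pi.smul_apply, smul_eq_mul, hpk, hpi i hi]
    constructor <;> linarith
  · have hsum : ∑' i, ω i * ((1 - ε) • y + ε • p) i =
        (1 - ε) * ∑' i, ω i * y i + ε * (ω k / 2) := by
      rw [← hph, ← tsum_mul_left, ← tsum_mul_left, ← Summable.tsum_add
        ((summable_mul_of_abs_le hω hs (abs_le_of_sub_mem_Icc hy.1)).mul_left _)
        ((summable_mul_of_abs_le hω hs hpabs).mul_left _)]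
      refine tsum_congr fun i => ?_
      simp only [Pi.add_apply, Pi.smul_apply, smul_eq_mul]; ring
    rw [hsum]
    have h0 := hy.2
    have hk := hω k
    have h1 : 0 ≤ (1 - ε) * ∑' i, ω i * y i := mul_nonneg (by linarith) h0.1
    have h2 : (1 - ε) * ∑' i, ω i * y i ≤ (1 - ε) * ω k :=
      mul_le_mul_of_nonneg_left h0.2 (by linarith)
    constructor <;> nlinarith

theorem isClosed_image_diagBox (hω : ∀ i, 0 < ω i) (hs : Summable ω) :
    IsClosed (angle '' diagBox ω k) := by
  have : Fact (0 < 2 * Real.pi) := ⟨Real.two_pi_pos⟩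
  exact ((isCompact_diagBox hω hs).image continuous_angle).isClosed

theorem closure_interior_image_diagBox (hω : ∀ i, 0 < ω i) (hs : Summable ω) :
    angle '' diagBox ω k = closure (interior (angle '' diagBox ω k)) := by
  refine Subset.antisymm ?_ ((isClosed_image_diagBox hω hs).closure_subset_iff.2 interior_subset)
  calc angle '' diagBox ω k ⊆ angle '' closure (openDiagBox ω k) :=
        image_mono (diagBox_subset_closure hω hs)
    _ ⊆ closure (angle '' openDiagBox ω k) := image_closure_subset_closure_image continuous_angle
    _ ⊆ _ := closure_mono (angle_image_openDiagBox_subset hω hs)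

end

/-! ### Disjointness, covering and restriction to sub-products -/

section
variable {ι : Type*} {ω : ι → ℝ} {k : ι} {y : ι → ℝ}

/-- A point whose coordinates differ from the `k`-th has a lift in general position. -/
theorem exists_angle_eq_of_ne {t : ι → AddCircle (2 * Real.pi)} (ht : ∀ j, j ≠ k → t j ≠ t k) :
    ∃ y : ι → ℝ, angle y = t ∧ ∀ i, i ≠ k → y k - y i ∈ Ioo (0 : ℝ) 1 := by
  obtain ⟨a, ha⟩ := exists_coe_two_pi_mul (t k)
  have hex : ∀ i, ∃ x : ℝ, ((2 * Real.pi * x : ℝ) : AddCircle (2 * Real.pi)) = t i ∧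
      (i = k → x = a) ∧ (i ≠ k → a - x ∈ Ioo (0 : ℝ) 1) := by
    intro i
    by_cases hi : i = k
    · exact ⟨a, hi ▸ ha, fun _ => rfl, fun h => absurd hi h⟩
    · obtain ⟨x, hx, h1, h2⟩ := exists_lift_sub_mem_Ico a (t i)
      refine ⟨x, hx, fun h => absurd h hi, fun _ => ⟨lt_of_le_of_ne h1 fun h0 => ?_, h2⟩⟩
      apply ht i hi
      rw [← hx, ← ha, sub_eq_zero.1 h0.symm]
  choose y hy1 hy2 hy3 using hex
  refine ⟨y, funext hy1, fun i hi => ?_⟩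
  rw [hy2 k rfl]
  exact hy3 i hi

theorem dense_setOf_apply_ne {i j : ι} (hij : i ≠ j) :
    Dense {t : ι → AddCircle (2 * Real.pi) | t i ≠ t j} := by
  classical
  refine dense_iff_inter_open.2 fun U hU ⟨t, ht⟩ => ?_
  by_cases hne : t i = t j
  · set c : ℝ → ι → AddCircle (2 * Real.pi) :=
      fun δ => t + Pi.single i ((δ : ℝ) : AddCircle (2 * Real.pi)) with hcdef
    have hc : Continuous c := by
      refine continuous_const.add ?_
      exact (continuous_single (A := fun _ => AddCircle (2 * Real.pi)) i).comp
        (AddCircle.continuous_mk' _)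
    have hc0 : c 0 = t := by simp [hcdef]
    have hmem : ∀ᶠ δ in 𝓝 (0 : ℝ), c δ ∈ U :=
      hc.continuousAt.eventually (hU.mem_nhds (hc0.symm ▸ ht))
    have hlt : ∀ᶠ δ : ℝ in 𝓝[>] (0 : ℝ), δ < 2 * Real.pi :=
      nhdsWithin_le_nhds (Iio_mem_nhds Real.two_pi_pos)
    obtain ⟨δ, ⟨h1, h2⟩, h3⟩ := (((hmem.filter_mono nhdsWithin_le_nhds).and hlt).and
      (self_mem_nhdsWithin (s := Ioi (0 : ℝ)))).exists
    have h3 : 0 < δ := h3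
    refine ⟨_, h1, ?_⟩
    simp only [hcdef, mem_ofPred_eq, Pi.add_apply, Pi.single_eq_same, Pi.single_eq_of_ne hij.symm,
      add_zero, hne]
    intro h4
    have h5 : ((δ : ℝ) : AddCircle (2 * Real.pi)) = 0 := by
      simpa using h4
    obtain ⟨n, hn⟩ := (AddCircle.coe_eq_zero_of_pos_iff (2 * Real.pi) Real.two_pi_pos h3).1 h5
    rw [nsmul_eq_mul] at hn
    have hpi := Real.two_pi_pos
    have h6 : (0 : ℝ) < n := by
      by_contra hcon
      have : (n : ℝ) = 0 := le_antisymm (not_lt.1 hcon) (Nat.cast_nonneg n)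
      rw [this] at hn; linarith
    have h7 : (1 : ℝ) ≤ n := by
      have : 0 < n := by exact_mod_cast h6
      exact_mod_cast this
    nlinarith
  · exact ⟨t, ht, hne⟩

/-- On a diagonal in general position, two pieces only share end points of arcs. -/
theorem endpoint_of_mem_two (hω : ∀ i, 0 < ω i) (hs : Summable ω) {i j : ι} (hij : i ≠ j)
    (hy : ∀ l, l ≠ i → y i - y l ∈ Ioo (0 : ℝ) 1)
    (hj : ∀ l, l ≠ j → ∀ n : ℤ, y j - y l ≠ n) {τ : ℝ}
    (h1 : angle (fun l => y l + τ) ∈ angle '' diagBox ω i)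
    (h2 : angle (fun l => y l + τ) ∈ angle '' diagBox ω j) :
    ∃ m : ℤ, ∑' l, ω l * y l + (∑' l, ω l) * (τ + m) = 0 ∨
      ∑' l, ω l * y l + (∑' l, ω l) * (τ + m) = ω i := by
  classical
  have hΩ := tsum_weight_pos hω hs i
  -- Lowering the coordinates above y_j by 1 gives a lift in general position for j; h drops by
  -- their total weight σ.
  set v : ι → ℝ := fun l => if y l ≤ y j then y l else y l - 1 with hv
  have hyij := hy j hij.symm
  have hylo : ∀ l, y i - y l ∈ Icc (0 : ℝ) 1 := sub_mem_Icc_of_Ioo hy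
  have hylt : ∀ l, y i - y l < 1 := by
    intro l
    by_cases hl : l = i
    · rw [hl]; simp
    · exact (hy l hl).2
  have hvj : v j = y j := by simp [hv]
  have hvc : ∀ l, l ≠ j → v j - v l ∈ Ioo (0 : ℝ) 1 := by
    intro l hl
    rw [hvj]
    have h0 : y j ≠ y l := by
      have := hj l hl 0
      simpa [sub_eq_zero] using this
    simp only [hv]
    split_ifs with hle
    · refine ⟨by linarith [lt_of_le_of_ne hle (Ne.symm h0)], ?_⟩
      linarith [hylt l, hyij.1]
    · push Not at hle
      refine ⟨?_, by linarith⟩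
      linarith [hylt j, (hylo l).1]
  have hva : angle (fun l => y l + τ) = angle (fun l => v l + τ) :=
    angle_eq_iff.2 ⟨fun l => if y l ≤ y j then 0 else -1, fun l => by
      simp only [hv]; split_ifs <;> simp; ring⟩
  rw [hva] at h2
  obtain ⟨m, hm⟩ := (angle_add_mem_image_diagBox_iff hω hs hy τ).1 h1
  obtain ⟨n, hn⟩ := (angle_add_mem_image_diagBox_iff hω hs hvc τ).1 h2
  have hsg : Summable fun l => if y l ≤ y j then 0 else ω l := by
    refine Summable.of_norm_bounded hs fun l => ?_
    split_ifs
    · simpa using (hω l).le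
    · rw [Real.norm_eq_abs, abs_of_pos (hω l)]
  set σ := ∑' l, (if y l ≤ y j then 0 else ω l) with hσ
  have hvh : ∑' l, ω l * v l = ∑' l, ω l * y l - σ := by
    rw [hσ, ← Summable.tsum_sub (summable_mul_of_abs_le hω hs (abs_le_of_sub_mem_Icc hylo)) hsg]
    refine tsum_congr fun l => ?_
    simp only [hv]
    split_ifs <;> ring
  have hnn : ∀ l, 0 ≤ (if y l ≤ y j then 0 else ω l) := fun l => by
    split_ifs
    · exact le_rfl
    · exact (hω l).le
  -- Measured by h modulo Ω, the two arcs are [0, ω_i] and [σ, σ + ω_j]. Since ω_i ≤ σ ≤ Ω − ω_j,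
  -- they meet at ends only.
  have hσi : ω i ≤ σ := by
    have := hsg.le_tsum i fun l _ => hnn l
    rwa [if_neg (by linarith [hyij.1])] at this
  have hσj : σ + ω j ≤ ∑' l, ω l := by
    have h3 : Summable fun l => ω l - (if y l ≤ y j then 0 else ω l) := hs.sub hsg
    have := h3.le_tsum j fun l _ => by
      split_ifs
      · simpa using (hω l).le
      · simp
    rw [Summable.tsum_sub hs hsg, if_pos le_rfl, sub_zero, ← hσ] at this
    linarith
  rw [hvh] at hn
  refine ⟨m, ?_⟩
  set h := ∑' l, ω l * y l
  set Ω := ∑' l, ω l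
  have h3 : Ω * (-1) < Ω * ((n - m : ℤ) : ℝ) := by
    push_cast
    have : Ω * (τ + n) = Ω * (τ + m) + Ω * ((n : ℝ) - m) := by ring
    linarith [hn.1, hm.2]
  have h4 : Ω * ((n - m : ℤ) : ℝ) ≤ Ω * 1 := by
    push_cast
    have : Ω * (τ + n) = Ω * (τ + m) + Ω * ((n : ℝ) - m) := by ring
    linarith [hn.2, hm.1]
  have h5 := lt_of_mul_lt_mul_left h3 hΩ.le
  have h6 := le_of_mul_le_mul_left h4 hΩ
  have h5 : -1 < n - m := by exact_mod_cast h5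
  have h6 : n - m ≤ 1 := by exact_mod_cast h6
  rcases (by omega : n = m ∨ n = m + 1) with h7 | h7
  · right
    rw [h7] at hn
    linarith [hn.1, hm.2]
  · left
    rw [h7] at hn
    push_cast at hn
    have : Ω * (τ + (m + 1)) = Ω * (τ + m) + Ω := by ring
    linarith [hn.2, hm.1]

/-- By Baire a common interior point could be taken with pairwise distinct coordinates. On its
diagonal the parameters of common points are ends of arcs, hence countably many, whereas those of
common interior points would form a nonempty open set. -/
theorem disjoint_interior_image_diagBox [Countable ι] (hω : ∀ i, 0 < ω i) (hs : Summable ω)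
    {i j : ι} (hij : i ≠ j) :
    Disjoint (interior (angle '' diagBox ω i)) (interior (angle '' diagBox ω j)) := by
  classical
  have : Fact (0 < 2 * Real.pi) := ⟨Real.two_pi_pos⟩
  rw [Set.disjoint_iff_inter_eq_empty]
  by_contra hne
  rw [← Ne, ← nonempty_iff_ne_empty] at hne
  have hd : Dense (⋂ l, ⋂ m, {t : ι → AddCircle (2 * Real.pi) | l ≠ m → t l ≠ t m}) := by
    have ho : ∀ p : ι × ι, IsOpen {t : ι → AddCircle (2 * Real.pi) | p.1 ≠ p.2 → t p.1 ≠ t p.2} := by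
      intro p
      by_cases hp : p.1 = p.2
      · simp [hp]
      · simp only [ne_eq, hp, not_false_eq_true, forall_true_left]
        exact isOpen_ne_fun (continuous_apply _) (continuous_apply _)
    have := dense_iInter_of_isOpen ho (fun p => by
      by_cases hp : p.1 = p.2
      · simp [hp]
      · simp only [ne_eq, hp, not_false_eq_true, forall_true_left]
        exact dense_setOf_apply_ne hp)
    convert this using 1
    ext t; simp
  obtain ⟨t, htU, ht⟩ := dense_iff_inter_open.1 hd _ (isOpen_interior.inter isOpen_interior) hne
  simp only [mem_iInter, mem_ofPred_eq] at ht
  obtain ⟨y, rfl, hy⟩ := exists_angle_eq_of_ne (fun l hl => ht l i hl)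
  set V : Set ℝ := {τ | angle (fun l => y l + τ) ∈
    interior (angle '' diagBox ω i) ∩ interior (angle '' diagBox ω j)} with hV
  have hVo : IsOpen V := (isOpen_interior.inter isOpen_interior).preimage
    (continuous_angle.comp (by fun_prop : Continuous fun τ : ℝ => fun l => y l + τ))
  have hV0 : V.Nonempty := ⟨0, by simpa [hV] using htU⟩
  set h := ∑' l, ω l * y l
  set Ω := ∑' l, ω l with hΩdef
  have hΩ : 0 < Ω := tsum_weight_pos hω hs i
  set C : Set ℝ := (range fun m : ℤ => -h / Ω - m) ∪ range fun m : ℤ => (ω i - h) / Ω - m with hC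
  have hCc : C.Countable := (countable_range _).union (countable_range _)
  have hVC : V ⊆ C := by
    intro τ hτ
    obtain ⟨m, hm | hm⟩ := endpoint_of_mem_two hω hs hij hy (fun l hl n hn => by
      apply ht j l (Ne.symm hl)
      refine (coe_two_pi_mul_eq_iff.2 ⟨-n, ?_⟩)
      push_cast; linarith) (interior_subset hτ.1) (interior_subset hτ.2)
    · refine Or.inl ⟨m, ?_⟩
      change -h / Ω - m = τ
      have hm : h + Ω * (τ + m) = 0 := hm
      field_simp; linarith
    · refine Or.inr ⟨m, ?_⟩
      change (ω i - h) / Ω - m = τ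
      have hm : h + Ω * (τ + m) = ω i := hm
      field_simp; linarith
  obtain ⟨τ, hτ, hτC⟩ := dense_iff_inter_open.1 (hCc.dense_compl ℝ) V hVo hV0
  exact hτC (hVC hτ)

/-- Among the lifts with coordinates at most 1 apart and h ≥ 0, take one whose integer parts have
least sum, and let k index its largest coordinate. Subtracting e_k preserves the first condition, so
it must violate the second: h < ω_k. The minimum exists because a very negative coordinate would
make all of them negative, and h too. -/
theorem iUnion_image_diagBox [Finite ι] [Nonempty ι] (hω : ∀ i, 0 < ω i) :
    ⋃ k, angle '' diagBox ω k = univ := by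
  classical
  have := Fintype.ofFinite ι
  rw [eq_univ_iff_forall]
  intro t
  choose θ hθt hθ using fun i => exists_lift_sub_mem_Ico 1 (t i)
  have hθ0 : ∀ i, 0 < θ i ∧ θ i ≤ 1 := fun i => ⟨by linarith [(hθ i).2], by linarith [(hθ i).1]⟩
  let P : ℤ → Prop := fun s => ∃ z : ι → ℤ, ∑ i, z i = s ∧
    (∀ i j, (θ i + z i) - (θ j + z j) ≤ 1) ∧ 0 ≤ ∑ i, ω i * (θ i + z i)
  have hbdd : ∃ b, ∀ s, P s → b ≤ s := by
    refine ⟨-(2 * Fintype.card ι : ℤ), ?_⟩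
    rintro s ⟨z, rfl, hc, hh⟩
    have hz : ∀ i, -2 ≤ z i := by
      intro i
      by_contra hcon
      have h1 : z i ≤ -3 := by omega
      have h1 : (z i : ℝ) ≤ -3 := by exact_mod_cast h1
      have : ∑ j, ω j * (θ j + z j) < 0 := Finset.sum_neg
        (fun j _ => mul_neg_of_pos_of_neg (hω j) (by linarith [hc j i, (hθ0 i).2]))
        Finset.univ_nonempty
      linarith
    calc -(2 * Fintype.card ι : ℤ) = ∑ _i : ι, (-2 : ℤ) := by simp; ring
      _ ≤ ∑ i, z i := Finset.sum_le_sum fun i _ => hz i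
  have hinh : ∃ s, P s := ⟨0, 0, by simp, fun i j => by
    simp; linarith [(hθ0 i).2, (hθ0 j).1], Finset.sum_nonneg fun i _ =>
      mul_nonneg (hω i).le (by simpa using (hθ0 i).1.le)⟩
  obtain ⟨s, ⟨z, hzs, hc, hh⟩, hmin⟩ := Int.exists_least_of_bdd hbdd hinh
  obtain ⟨k, -, hk⟩ := Finset.exists_max_image Finset.univ (fun i => θ i + z i) Finset.univ_nonempty
  have hk : ∀ i, θ i + z i ≤ θ k + z k := fun i => hk i (Finset.mem_univ i)
  refine mem_iUnion.2 ⟨k, fun i => θ i + z i,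
    ⟨fun i => ⟨by linarith [hk i], hc k i⟩, ?_⟩, ?_⟩
  · rw [tsum_fintype]
    refine ⟨hh, ?_⟩
    by_contra hcon
    push Not at hcon
    have hsum : ∑ i, ω i * (θ i + ((z - Pi.single k 1 : ι → ℤ) i : ℝ)) =
        ∑ i, ω i * (θ i + z i) - ω k := by
      have : ω k = ∑ i, ω i * (((Pi.single k 1 : ι → ℤ) i : ℤ) : ℝ) := by
        rw [Finset.sum_eq_single k]
        · simp
        · intro l _ hl; simp [hl]
        · simp
      conv_rhs => rw [this]
      rw [← Finset.sum_sub_distrib]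
      refine Finset.sum_congr rfl fun i _ => ?_
      simp only [Pi.sub_apply]
      push_cast
      ring
    have hP : P (s - 1) := by
      refine ⟨z - Pi.single k 1, ?_, fun i j => ?_, ?_⟩
      · simp [Finset.sum_sub_distrib, hzs]
      · have h1 := hc i j
        have h2 := hc k j
        have h3 := hk i
        by_cases hi : i = k
        · by_cases hj : j = k
          · simp [hi, hj]
          · subst hi; simp [hj]; linarith
        · by_cases hj : j = k
          · subst hj; simp [hi]; linarith
          · simp [hi, hj]; linarith
      · rw [hsum]; linarith
    have := hmin _ hP
    omega
  · funext i
    rw [← hθt i]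
    exact (coe_two_pi_mul_eq_iff.2 ⟨z i, rfl⟩).symm

variable {κ : Type*} {ω' : κ → ℝ}

theorem tsum_extend_mul (e : ι ↪ κ) (he : ∀ i, ω' (e i) = ω i) {v : κ → ℝ}
    (hv : ∀ l, l ∉ range e → v l = 0) : ∑' l, ω' l * v l = ∑' i, ω i * v (e i) := by
  rw [← e.injective.tsum_eq (f := fun l => ω' l * v l)]
  · exact tsum_congr fun i => by simp only [he]
  · intro l hl
    by_contra hcon
    exact hl (by simp [hv l hcon])

/-- The piece of a product labelled by a factor of a sub-product restricts to the piece of the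
sub-product with the same label. -/
theorem extend_mem_image_diagBox_iff (hω' : ∀ i, 0 < ω' i) (hs' : Summable ω') (e : ι ↪ κ)
    (he : ∀ i, ω' (e i) = ω i) (j : ι) (t : ι → AddCircle (2 * Real.pi)) :
    Function.extend e t 0 ∈ angle '' diagBox ω' (e j) ↔ t ∈ angle '' diagBox ω j := by
  constructor
  · rintro ⟨v, hv, hvt⟩
    -- Such a coordinate is integral and its index is not the distinguished one, so on the box it is
    -- 0: the lift is supported on the sub-product.
    have hz : ∀ l, l ∉ range e → v l = 0 := by
      intro l hl
      have h1 := congrFun hvt l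
      rw [Function.extend_apply' _ _ _ hl] at h1
      have h2 : ((2 * Real.pi * 0 : ℝ) : AddCircle (2 * Real.pi)) =
          ((2 * Real.pi * v l : ℝ) : AddCircle (2 * Real.pi)) := by
        rw [mul_zero, AddCircle.coe_zero]; exact h1.symm
      obtain ⟨n, hn⟩ := coe_two_pi_mul_eq_iff.1 h2
      rw [zero_add] at hn
      have := eq_zero_of_mem_diagBox_of_int hω' hs' hv (i := l) (fun h => hl ⟨j, h.symm⟩) hn
      rw [hn, this]; simp
    refine ⟨fun i => v (e i), ⟨fun i => hv.1 (e i), ?_⟩, ?_⟩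
    · rw [← tsum_extend_mul e he hz, ← he]; exact hv.2
    · funext i
      have := congrFun hvt (e i)
      rw [e.injective.extend_apply] at this
      exact this
  · rintro ⟨y, hy, rfl⟩
    have hex : ∀ i, Function.extend e y 0 (e i) = y i := fun i => e.injective.extend_apply _ _ _
    have hex' : ∀ l, l ∉ range e → Function.extend e y 0 l = 0 := fun l hl =>
      Function.extend_apply' _ _ _ hl
    have hω : ∀ i, 0 < ω i := fun i => he i ▸ hω' (e i)
    have hs : Summable ω := (hs'.comp_injective e.injective).congr he
    refine ⟨Function.extend e y 0, ⟨fun l => ?_, ?_⟩, ?_⟩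
    · rw [hex]
      by_cases hl : l ∈ range e
      · obtain ⟨i, rfl⟩ := hl
        rw [hex]; exact hy.1 i
      -- For a zero coordinate the box condition is 0 ≤ y_j ≤ 1, which the smaller box implies.
      · rw [hex' l hl, sub_zero]; exact mem_Icc_of_mem_diagBox hω hs hy
    · rw [tsum_extend_mul e he hex', he]
      simp only [hex]; exact hy.2
    · funext l
      by_cases hl : l ∈ range e
      · obtain ⟨i, rfl⟩ := hl
        rw [e.injective.extend_apply]
        simp only [angle, hex]
      · rw [Function.extend_apply' _ _ _ hl]
        simp [angle, hex' l hl]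

/-- A piece labelled by a factor outside a sub-product meets the sub-product only in `0`. -/
theorem eq_zero_of_extend_mem (hω' : ∀ i, 0 < ω' i) (hs' : Summable ω') (e : ι ↪ κ) {k : κ}
    (hk : k ∉ range e) {t : ι → AddCircle (2 * Real.pi)}
    (ht : Function.extend e t 0 ∈ angle '' diagBox ω' k) : t = angle 0 := by
  obtain ⟨v, hv, hvt⟩ := ht
  have h1 := congrFun hvt k
  rw [Function.extend_apply' _ _ _ hk] at h1
  have h2 : ((2 * Real.pi * 0 : ℝ) : AddCircle (2 * Real.pi)) =
      ((2 * Real.pi * v k : ℝ) : AddCircle (2 * Real.pi)) := by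
    rw [mul_zero, AddCircle.coe_zero]; exact h1.symm
  obtain ⟨n, hn⟩ := coe_two_pi_mul_eq_iff.1 h2
  rw [zero_add] at hn
  have h3 := angle_eq_zero_of_mem_diagBox hω' hs' hv hn
  rw [hvt] at h3
  funext i
  have := congrFun h3 (e i)
  rw [e.injective.extend_apply] at this
  exact this

end

section
variable {ι : Type*} {ω : ι → ℝ}

/-- Truncations of a point converge to it, and each lies in a finite sub-product, which is covered
by its own pieces. -/
theorem closure_iUnion_image_diagBox [Nonempty ι] (hω : ∀ i, 0 < ω i) (hs : Summable ω) :
    closure (⋃ k, angle '' diagBox ω k) = univ := by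
  classical
  rw [eq_univ_iff_forall]
  intro t
  let i₀ : ι := Classical.arbitrary ι
  refine mem_closure_of_tendsto (b := (atTop : Filter (Finset ι)))
    (f := fun F : Finset ι => fun i => if i ∈ F then t i else 0) ?_ ?_
  · refine tendsto_pi_nhds.2 fun i => tendsto_const_nhds.congr' ?_
    filter_upwards [eventually_ge_atTop {i}] with F hF
    rw [if_pos (hF (by simp))]
  · filter_upwards [eventually_ge_atTop {i₀}] with F hF
    have : Nonempty F := ⟨⟨i₀, hF (by simp)⟩⟩
    have h1 := iUnion_image_diagBox (ω := fun i : F => ω i) fun i => hω i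
    obtain ⟨k, hk⟩ := mem_iUnion.1 (h1.ge (mem_univ fun i : F => t i))
    refine mem_iUnion.2 ⟨k, ?_⟩
    have h2 := (extend_mem_image_diagBox_iff hω hs (Function.Embedding.subtype (· ∈ F))
      (ω := fun i : F => ω i) (fun _ => rfl) k (fun i : F => t i)).2 hk
    suffices h3 : (fun i => if i ∈ F then t i else 0) =
        Function.extend (Function.Embedding.subtype (· ∈ F)) (fun i : F => t i) 0 from h3 ▸ h2
    funext i
    by_cases hi : i ∈ F
    · rw [if_pos hi]
      exact ((Function.Embedding.subtype (· ∈ F)).injective.extend_apply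
        (fun i : F => t i) 0 ⟨i, hi⟩).symm
    · rw [if_neg hi, Function.extend_apply']
      · rfl
      · rintro ⟨a, rfl⟩
        exact hi a.2

end

/-! ### Transfer to right toroids: the partition exists -/

namespace RightToroid
variable (T : RightToroid)

/-- The squares of the radii. -/
def weight (k : T.Idx) : ℝ := T.r k ^ 2

theorem weight_pos (k : T.Idx) : 0 < T.weight k := pow_pos (T.r_pos k) 2

theorem summable_weight : Summable T.weight := T.r_summable

instance : Nonempty T.Idx := ⟨⟨0, T.dim_pos⟩⟩

theorem normSq_pos : 0 < T.normSq :=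
  tsum_weight_pos T.weight_pos T.summable_weight (Classical.arbitrary _)

theorem norm_pos : 0 < T.norm := Real.sqrt_pos.2 T.normSq_pos

theorem norm_mul_norm : T.norm * T.norm = T.normSq := Real.mul_self_sqrt T.normSq_pos.le

/-- Coordinates on the universal covering in which all the circles have length `1`. -/
def scale : (T.Idx → ℝ) ≃L[ℝ] (T.Idx → ℝ) :=
  ContinuousLinearEquiv.piCongrRight fun k => ContinuousLinearEquiv.unitsEquivAut ℝ
    (Units.mk0 (2 * Real.pi * T.r k) (mul_pos Real.two_pi_pos (T.r_pos k)).ne')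

theorem scale_apply (y : T.Idx → ℝ) (k : T.Idx) : T.scale y k = y k * (2 * Real.pi * T.r k) := rfl

theorem proj_scale (y : T.Idx → ℝ) : T.proj (T.scale y) = angle y := by
  funext k
  have := (T.r_pos k).ne'
  simp only [proj, angle, scale_apply]
  congr 1
  field_simp

theorem proj_image_scale (A : Set (T.Idx → ℝ)) : T.proj '' (T.scale '' A) = angle '' A := by
  rw [image_image]
  simp only [proj_scale]

theorem interior_scale_image (A : Set (T.Idx → ℝ)) :
    interior (T.scale '' A) = T.scale '' interior A :=
  (T.scale.toHomeomorph.image_interior A).symm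

theorem diag_angle (y : T.Idx → ℝ) (l : ℝ) :
    T.diag (angle y) l = angle fun i => y i + l / (2 * Real.pi * T.norm) := by
  rw [angle_add y fun _ => l / (2 * Real.pi * T.norm)]
  funext k
  have h1 := (T.r_pos k).ne'
  have h2 := T.norm_pos.ne'
  simp only [diag, proj, angle, Pi.add_apply]
  congr 2
  field_simp

theorem diag_eq_iff (t : T.Torus) (l l' : ℝ) :
    T.diag t l = T.diag t l' ↔ ∃ m : ℤ, l' = l + m * (2 * Real.pi * T.norm) := by
  obtain ⟨y, rfl⟩ := angle_surjective t
  have hN := T.norm_pos.ne'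
  rw [diag_angle, diag_angle, angle_eq_iff]
  constructor
  · rintro ⟨z, hz⟩
    refine ⟨z (Classical.arbitrary _), ?_⟩
    have := hz (Classical.arbitrary _)
    have h2 : l' / (2 * Real.pi * T.norm) = l / (2 * Real.pi * T.norm) +
      z (Classical.arbitrary _) := by linarith
    field_simp at h2
    linarith
  · rintro ⟨m, rfl⟩
    refine ⟨fun _ => m, fun i => ?_⟩
    field_simp
    ring

/-- Converts statements about arcs of the closed diagonal into statements about the parameter modulo
its length 2π‖r‖. -/
theorem diagonal_inter_eq_image_iff (t : T.Torus) (P : Set T.Torus) (I : Set ℝ) :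
    T.diagonal t ∩ P = T.diag t '' I ↔
      ∀ l, T.diag t l ∈ P ↔ ∃ m : ℤ, l + m * (2 * Real.pi * T.norm) ∈ I := by
  constructor
  · intro h l
    have h1 : T.diag t l ∈ P ↔ T.diag t l ∈ T.diag t '' I := by
      rw [← h]; simp [diagonal]
    rw [h1]
    constructor
    · rintro ⟨l', hl', he⟩
      obtain ⟨m, rfl⟩ := (T.diag_eq_iff t l l').1 he.symm
      exact ⟨m, hl'⟩
    · rintro ⟨m, hm⟩
      exact ⟨_, hm, ((T.diag_eq_iff t _ _).2 ⟨m, rfl⟩).symm⟩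
  · intro h
    ext u
    constructor
    · rintro ⟨⟨l, rfl⟩, hu⟩
      obtain ⟨m, hm⟩ := (h l).1 hu
      exact ⟨_, hm, ((T.diag_eq_iff t _ _).2 ⟨m, rfl⟩).symm⟩
    · rintro ⟨l, hl, rfl⟩
      exact ⟨⟨l, rfl⟩, (h l).2 ⟨0, by simpa using hl⟩⟩

/-- The fraction of a diagonal taken up by an arc of the `k`-th piece. -/
theorem arcLength_eq (k : T.Idx) :
    T.arcLength k = T.weight k / T.normSq * (2 * Real.pi * T.norm) := by
  have h2 := T.norm_pos.ne'
  rw [arcLength, weight, ← norm_mul_norm]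
  field_simp

theorem add_mul_eq (h l : ℝ) (m : ℤ) :
    h + T.normSq * (l / (2 * Real.pi * T.norm) + m) =
      T.normSq / (2 * Real.pi * T.norm) * (l + m * (2 * Real.pi * T.norm) -
        -h / T.normSq * (2 * Real.pi * T.norm)) := by
  have h1 := T.norm_pos.ne'
  have h2 := T.normSq_pos.ne'
  field_simp
  ring

theorem weight_eq (k : T.Idx) :
    T.weight k = T.normSq / (2 * Real.pi * T.norm) * T.arcLength k := by
  have h1 := T.norm_pos.ne'
  have h2 := T.normSq_pos.ne'
  rw [arcLength_eq]
  field_simp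

theorem add_mul_mem_Icc_iff {k : T.Idx} (h l : ℝ) (m : ℤ) :
    h + T.normSq * (l / (2 * Real.pi * T.norm) + m) ∈ Icc 0 (T.weight k) ↔
      l + m * (2 * Real.pi * T.norm) ∈ Icc (-h / T.normSq * (2 * Real.pi * T.norm))
        (-h / T.normSq * (2 * Real.pi * T.norm) + T.arcLength k) := by
  have h4 := div_pos T.normSq_pos (mul_pos Real.two_pi_pos T.norm_pos)
  rw [add_mul_eq, weight_eq, mem_Icc, mem_Icc, mul_nonneg_iff_of_pos_left h4,
    mul_le_mul_iff_right₀ h4, sub_nonneg, sub_le_iff_le_add']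

theorem add_mul_mem_Ioo_iff {k : T.Idx} (h l : ℝ) (m : ℤ) :
    h + T.normSq * (l / (2 * Real.pi * T.norm) + m) ∈ Ioo 0 (T.weight k) ↔
      l + m * (2 * Real.pi * T.norm) ∈ Ioo (-h / T.normSq * (2 * Real.pi * T.norm))
        (-h / T.normSq * (2 * Real.pi * T.norm) + T.arcLength k) := by
  have h4 := div_pos T.normSq_pos (mul_pos Real.two_pi_pos T.norm_pos)
  rw [add_mul_eq, weight_eq, mem_Ioo, mem_Ioo, mul_pos_iff_of_pos_left h4,
    mul_lt_mul_iff_right₀ h4, sub_pos, sub_lt_iff_lt_add']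

/-- Every edge, including the k-th, contributes its share ω_j/Ω of the vector s; only the edges with
j ≠ k also subtract f_j. -/
theorem hasSum_smul_edge (k : T.Idx) {c : T.Idx → ℝ} (hc : ∀ j, c j ∈ Icc (0 : ℝ) 1) :
    HasSum (fun j => c j • T.edge k j)
      (T.scale fun i => (∑' j, T.weight j * c j) / T.normSq - if i = k then 0 else c i) := by
  classical
  rw [Pi.hasSum]
  intro i
  have hs : Summable fun j => T.weight j * c j :=
    summable_mul_of_abs_le T.weight_pos T.summable_weight (M := 1)
      fun j => abs_le.2 ⟨by linarith [(hc j).1], (hc j).2⟩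
  have h1 : HasSum (fun j => if j = i then (if i = k then 0 else c i) else 0)
      (if i = k then 0 else c i) := hasSum_ite_eq i _
  have h2 := ((hs.hasSum.div_const T.normSq).sub h1).mul_right (2 * Real.pi * T.r i)
  rw [scale_apply]
  refine h2.congr_fun fun j => ?_
  have hΩ := T.normSq_pos.ne'
  simp only [Pi.smul_apply, smul_eq_mul, edge]
  by_cases hj : j = k
  · subst hj
    by_cases hi : j = i
    · subst hi; simp [s, weight]; ring
    · simp [hi, s, weight]; ring
  · by_cases hi : j = i
    · subst hi; simp [hj, s, g, f, weight]; ring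
    · simp [hj, hi, s, g, f, weight, Ne.symm hi]; ring

/-- The coefficients of a point are c_i = y_k − y_i for i ≠ k and c_k = h(y)/ω_k. -/
theorem parallelotope_eq (k : T.Idx) : T.parallelotope k = T.scale '' diagBox T.weight k := by
  classical
  have hΩ := T.normSq_pos
  have hsum : ∀ c : T.Idx → ℝ, (∀ j, c j ∈ Icc (0 : ℝ) 1) → ∑' j, T.weight j * c j =
      T.weight k * c k + ∑' j, T.weight j * (if j = k then 0 else c j) := by
    intro c hc
    have hs : Summable fun j => T.weight j * c j :=
      summable_mul_of_abs_le T.weight_pos T.summable_weight (M := 1)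
        fun j => abs_le.2 ⟨by linarith [(hc j).1], (hc j).2⟩
    rw [hs.tsum_eq_add_tsum_ite k]
    congr 1
    refine tsum_congr fun j => ?_
    split_ifs <;> simp
  ext x
  constructor
  · rintro ⟨c, hc, hx⟩
    rw [hx.unique (T.hasSum_smul_edge k hc)]
    refine mem_image_of_mem _ ⟨fun i => ?_, ?_⟩
    · by_cases hi : i = k
      · simp [hi]
      · simpa [hi] using hc i
    · have h0 : ∀ i, (if i = k then 0 else c i) ∈ Icc (0 : ℝ) 1 := fun i => by
        split_ifs
        · simp
        · exact hc i
      have h1 := T.summable_weight.mul_right ((∑' j, T.weight j * c j) / T.normSq)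
      have h2 : Summable fun j => T.weight j * (if j = k then 0 else c j) :=
        summable_mul_of_abs_le T.weight_pos T.summable_weight (M := 1)
          fun j => abs_le.2 ⟨by linarith [(h0 j).1], (h0 j).2⟩
      simp only [mul_sub]
      rw [h1.tsum_sub h2, tsum_mul_right]
      change T.normSq * _ - _ ∈ _
      rw [mul_div_cancel₀ _ hΩ.ne', hsum c hc, add_sub_cancel_right]
      exact ⟨mul_nonneg (T.weight_pos k).le (hc k).1,
        mul_le_of_le_one_right (T.weight_pos k).le (hc k).2⟩
  · rintro ⟨y, hy, rfl⟩
    set c : T.Idx → ℝ := fun i =>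
      if i = k then (∑' j, T.weight j * y j) / T.weight k else y k - y i with hcdef
    have hc : ∀ j, c j ∈ Icc (0 : ℝ) 1 := by
      intro j
      simp only [hcdef]
      split_ifs
      · exact ⟨div_nonneg hy.2.1 (T.weight_pos k).le,
          (div_le_one (T.weight_pos k)).2 hy.2.2⟩
      · exact hy.1 j
    refine ⟨c, hc, ?_⟩
    convert T.hasSum_smul_edge k hc using 2
    have h1 : ∑' j, T.weight j * (if j = k then 0 else c j) = ∑' j, T.weight j * (y k - y j) := by
      refine tsum_congr fun j => ?_
      by_cases hj : j = k
      · simp [hj]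
      · simp [hj, hcdef]
    have h2 : T.weight k * c k = ∑' j, T.weight j * y j := by
      simp only [hcdef, if_pos]
      rw [mul_div_cancel₀ _ (T.weight_pos k).ne']
    rw [hsum c hc, h1, h2, tsum_mul_sub T.weight_pos T.summable_weight hy.1]
    funext i
    change _ = (_ + (T.normSq * y k - _)) / T.normSq - _
    rw [add_sub_cancel, mul_div_cancel_left₀ _ hΩ.ne']
    by_cases hi : i = k
    · simp [hi]
    · simp [hi, hcdef]

theorem piece_eq (k : T.Idx) : T.piece k = angle '' diagBox T.weight k := by
  rw [piece, parallelotope_eq, proj_image_scale]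

theorem exists_diagonal_inter_piece (k : T.Idx) {t : T.Torus} (ht : ∀ j, j ≠ k → t j ≠ t k) :
    ∃ a : ℝ, T.diagonal t ∩ T.piece k = T.diag t '' Icc a (a + T.arcLength k) := by
  obtain ⟨y, rfl, hy⟩ := exists_angle_eq_of_ne ht
  refine ⟨-(∑' i, T.weight i * y i) / T.normSq * (2 * Real.pi * T.norm),
    (T.diagonal_inter_eq_image_iff _ _ _).2 fun l => ?_⟩
  rw [diag_angle, piece_eq, angle_add_mem_image_diagBox_iff T.weight_pos T.summable_weight hy]
  exact exists_congr fun m => T.add_mul_mem_Icc_iff _ l m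

theorem isConvexLift_parallelotope (k : T.Idx) :
    T.IsConvexLift (T.piece k) (T.arcLength k) (T.parallelotope k) where
  isCompact := by
    rw [parallelotope_eq]
    exact (isCompact_diagBox T.weight_pos T.summable_weight).image T.scale.continuous
  convex := by
    rw [parallelotope_eq]
    exact (convex_diagBox T.weight_pos T.summable_weight).linear_image T.scale.toLinearMap
  image_eq := rfl
  injOn := by
    rw [parallelotope_eq, interior_scale_image]
    rintro _ ⟨y, hy, rfl⟩ _ ⟨y', hy', rfl⟩ he
    rw [proj_scale, proj_scale] at he
    have hsub := interior_diagBox_subset T.weight_pos T.summable_weight (k := k)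
    rw [injOn_angle_openDiagBox T.weight_pos T.summable_weight (hsub hy) (hsub hy') he]
  diagonal := by
    intro t
    rw [parallelotope_eq, interior_scale_image, proj_image_scale]
    rcases finite_or_infinite T.Idx with hfin | hinf
    · rw [interior_diagBox_of_finite T.weight_pos]
      rcases (T.diagonal t ∩ angle '' openDiagBox T.weight k).eq_empty_or_nonempty with h | h
      · exact Or.inl h
      · right
        obtain ⟨_, ⟨l₀, rfl⟩, y₀, hy₀, he⟩ := h
        -- Sliding the common point back along the diagonal gives a lift of t in general position.
        obtain ⟨y, rfl, hy⟩ : ∃ y : T.Idx → ℝ, angle y = t ∧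
            ∀ i, i ≠ k → y k - y i ∈ Ioo (0 : ℝ) 1 := by
          obtain ⟨x, rfl⟩ := angle_surjective t
          rw [diag_angle, angle_eq_iff] at he
          obtain ⟨z, hz⟩ := he
          refine ⟨fun i => y₀ i - l₀ / (2 * Real.pi * T.norm), angle_eq_iff.2 ⟨z, fun i => ?_⟩,
            fun i hi => ?_⟩
          · linarith [hz i]
          · simpa using hy₀.1 i hi
        refine ⟨-(∑' i, T.weight i * y i) / T.normSq * (2 * Real.pi * T.norm),
          (T.diagonal_inter_eq_image_iff _ _ _).2 fun l => ?_⟩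
        rw [diag_angle, angle_add_mem_image_openDiagBox_iff T.weight_pos T.summable_weight hy]
        exact exists_congr fun m => T.add_mul_mem_Ioo_iff _ l m
    · left
      rw [interior_diagBox_of_infinite]
      simp

theorem nontrivial_addCircle : Nontrivial (AddCircle (2 * Real.pi)) := by
  refine ⟨((2 * Real.pi * 0 : ℝ) : AddCircle _), ((2 * Real.pi * (1 / 2) : ℝ) : AddCircle _),
    fun h => ?_⟩
  obtain ⟨n, hn⟩ := coe_two_pi_mul_eq_iff.1 h
  have h1 : ((2 * n : ℤ) : ℝ) = (1 : ℤ) := by push_cast; linarith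
  have h2 : 2 * n = 1 := by exact_mod_cast h1
  omega

/-- The joint law of two coordinates is the product measure, for which the diagonal is null because
points are. -/
theorem haar_setOf_eq {i j : T.Idx} (hij : i ≠ j) : T.haar {t | t i = t j} = 0 := by
  have : Fact (0 < 2 * Real.pi) := ⟨Real.two_pi_pos⟩
  have := nontrivial_addCircle
  set μ : Measure (AddCircle (2 * Real.pi)) := AddCircle.haarAddCircle with hμ
  have h1 := Measure.infinitePi_map_eval_prod (P := fun _ : T.Idx => μ) hij
  have hd : MeasurableSet {p : AddCircle (2 * Real.pi) × AddCircle (2 * Real.pi) | p.1 = p.2} :=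
    measurableSet_eq_fun measurable_fst measurable_snd
  have h2 : (μ.prod μ) {p | p.1 = p.2} = 0 := by
    rw [Measure.measure_prod_null hd]
    refine Filter.Eventually.of_forall fun x => ?_
    have h3 : Prod.mk x ⁻¹' {p : AddCircle (2 * Real.pi) × AddCircle (2 * Real.pi) | p.1 = p.2} =
        {x} := by
      ext; simp [eq_comm]
    exact (congrArg μ h3).trans (measure_singleton x)
  rw [← h1, Measure.map_apply (by fun_prop) hd] at h2
  exact h2

theorem isPythagorean_piece : T.IsPythagorean T.piece where
  cover := by
    simp only [piece_eq]
    exact closure_iUnion_image_diagBox T.weight_pos T.summable_weight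
  disjoint i j hij := by
    simp only [piece_eq]
    exact disjoint_interior_image_diagBox T.weight_pos T.summable_weight hij
  regular j := by
    rw [piece_eq]
    exact closure_interior_image_diagBox T.weight_pos T.summable_weight
  convex j := ⟨_, T.isConvexLift_parallelotope j⟩
  diagonal k := by
    have h : ∀ j, ∀ᵐ t ∂T.haar, j ≠ k → t j ≠ t k := by
      intro j
      by_cases hj : j = k
      · simp [hj]
      · simp only [ne_eq, hj, not_false_eq_true, forall_true_left]
        rw [ae_iff]
        simpa using T.haar_setOf_eq hj
    filter_upwards [ae_all_iff.2 h] with t ht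
    exact T.exists_diagonal_inter_piece k ht

theorem finite_idx (hT : T.dim ≠ ⊤) : Finite T.Idx := by
  obtain ⟨n, hn⟩ := ENat.ne_top_iff_exists.1 hT
  refine Finite.of_injective (fun k : T.Idx => (⟨k, ?_⟩ : Fin n)) ?_
  · exact Nat.cast_lt.1 (k.2.trans_eq hn.symm)
  · intro k k' h
    exact Subtype.ext (congrArg Fin.val h)

theorem iUnion_piece (hT : T.dim ≠ ⊤) : ⋃ k, T.piece k = univ := by
  have : Finite T.Idx := T.finite_idx hT
  simp only [piece_eq]
  exact iUnion_image_diagBox T.weight_pos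

variable {T} in
theorem Hom.preserves_piece {T' : RightToroid} (φ : T.Hom T') : φ.Preserves T.piece T'.piece := by
  have he : ∀ i, T'.weight (φ.idx i) = T.weight i := fun i => by rw [weight, φ.r_idx, weight]
  have h1 : ∀ j, φ.incl ⁻¹' T'.piece (φ.idx j) = T.piece j := by
    intro j
    ext t
    rw [piece_eq, piece_eq]
    exact extend_mem_image_diagBox_iff T'.weight_pos T'.summable_weight φ.idx he j t
  refine ⟨h1, fun k => ?_⟩
  by_cases hk : k ∈ range φ.idx
  · obtain ⟨j, rfl⟩ := hk
    exact ⟨j, (h1 j).subset⟩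
  · refine ⟨Classical.arbitrary _, fun t ht => ?_⟩
    rw [mem_preimage, piece_eq] at ht
    rw [eq_zero_of_extend_mem T'.weight_pos T'.summable_weight φ.idx hk ht, piece_eq]
    exact mem_image_of_mem _ (zero_mem_diagBox T.weight_pos)

end RightToroid

/-! ### Uniqueness: refinements and convex lifts -/

/-- Two families of regular closed sets with disjoint interiors which cover a space agree if one of
them refines the other. -/
theorem eq_of_subset_of_iUnion_eq_univ {X ι : Type*} [TopologicalSpace X] {p q : ι → Set X}
    (hp : ∀ i, p i = closure (interior (p i))) (hq : ∀ i, q i = closure (interior (q i)))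
    (hd : Pairwise fun i j => Disjoint (interior (p i)) (interior (p j)))
    (hc : ⋃ i, q i = univ) (hsub : ∀ i, q i ⊆ p i) : q = p := by
  funext k
  refine (hsub k).antisymm ?_
  have h1 : interior (p k) ⊆ q k := by
    intro x hx
    obtain ⟨j, hj⟩ := mem_iUnion.1 (hc.ge (mem_univ x))
    by_cases hjk : j = k
    · exact hjk ▸ hj
    · rw [hq j] at hj
      have h2 : Disjoint (interior (p k)) (closure (interior (q j))) :=
        ((hd (Ne.symm hjk)).mono_right (interior_mono (hsub j))).closure_right isOpen_interior
      exact absurd hj (disjoint_left.1 h2 hx)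
  rw [hp k, hq k]
  refine closure_minimal ?_ isClosed_closure
  rw [← hq k]
  exact h1

section
variable {ι : Type*} {w : ℝ} {p : Set (ι → AddCircle (2 * Real.pi))} {A : Set (ι → ℝ)}

/-- A convex lift in coordinates in which the lattice of periods is `ℤ^ι`; the arcs are parametrised
such that a diagonal has length `1`. -/
structure IsAngleLift (w : ℝ) (p : Set (ι → AddCircle (2 * Real.pi))) (A : Set (ι → ℝ)) :
    Prop where
  isCompact : IsCompact A
  convex : Convex ℝ A
  image_eq : angle '' A = p
  injOn : InjOn angle (interior A)
  arc : ∀ y ∈ interior A, ∃ a : ℝ, ∀ τ : ℝ,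
    angle (fun i => y i + τ) ∈ angle '' interior A ↔ ∃ m : ℤ, τ + m ∈ Ioo a (a + w)

theorem angle_add_int (y : ι → ℝ) (z : ι → ℤ) : angle (fun i => y i + z i) = angle y :=
  (angle_eq_iff.2 ⟨z, fun _ => rfl⟩).symm

namespace IsAngleLift

theorem translate (h : IsAngleLift w p A) (z : ι → ℤ) :
    IsAngleLift w p ((fun y : ι → ℝ => fun i => y i + z i) '' A) := by
  have hf : (fun y : ι → ℝ => fun i => y i + z i) = Homeomorph.addRight fun i => (z i : ℝ) := rfl
  have hint : interior ((fun y : ι → ℝ => fun i => y i + z i) '' A) =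
      (fun y : ι → ℝ => fun i => y i + z i) '' interior A := by
    rw [hf]; exact ((Homeomorph.addRight fun i => (z i : ℝ)).image_interior A).symm
  have him : ∀ B : Set (ι → ℝ), angle '' ((fun y : ι → ℝ => fun i => y i + z i) '' B) =
      angle '' B := fun B => by
    rw [image_image]; simp only [angle_add_int]
  refine ⟨h.isCompact.image (by fun_prop), ?_, ?_, ?_, ?_⟩
  · have := h.convex.translate fun i => (z i : ℝ)
    rwa [show (fun y : ι → ℝ => fun i => y i + z i) = fun y => (fun i => (z i : ℝ)) + y from
      funext fun y => funext fun i => add_comm _ _]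
  · rw [him, h.image_eq]
  · rw [hint]
    rintro _ ⟨y, hy, rfl⟩ _ ⟨y', hy', rfl⟩ he
    simp only [angle_add_int] at he
    rw [h.injOn hy hy' he]
  · rw [hint]
    rintro _ ⟨y, hy, rfl⟩
    obtain ⟨a, ha⟩ := h.arc y hy
    refine ⟨a, fun τ => ?_⟩
    rw [him, ← ha τ]
    have : (fun i => y i + z i + τ) = fun i => (fun i => y i + τ) i + z i := by
      funext i; ring
    simp only [this, angle_add_int]

/-- Baire: countably many translates of a closed set without interior cannot cover the nonempty open
preimage of the interior of p. -/
theorem interior_nonempty [Finite ι] (h : IsAngleLift w p A) (hp : (interior p).Nonempty) :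
    (interior A).Nonempty := by
  by_contra hA
  rw [not_nonempty_iff_eq_empty] at hA
  have hd : Dense (⋂ z : ι → ℤ, ((fun y : ι → ℝ => fun i => y i + z i) '' A)ᶜ) := by
    refine dense_iInter_of_isOpen (fun z => ?_) fun z => ?_
    · exact (h.translate z).isCompact.isClosed.isOpen_compl
    · rw [← interior_eq_empty_iff_dense_compl]
      have : (fun y : ι → ℝ => fun i => y i + z i) = Homeomorph.addRight fun i => (z i : ℝ) := rfl
      rw [this, ← Homeomorph.image_interior, hA, image_empty]
  obtain ⟨t, ht⟩ := hp
  obtain ⟨y₀, rfl⟩ := angle_surjective t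
  obtain ⟨y, hy, hy'⟩ := dense_iff_inter_open.1 hd _
    (isOpen_interior.preimage continuous_angle) ⟨y₀, ht⟩
  rw [← h.image_eq] at hy
  obtain ⟨x, hx, hxy⟩ := interior_subset hy
  obtain ⟨z, hz⟩ := angle_eq_iff.1 hxy
  exact mem_iInter.1 hy' z ⟨x, hx, funext fun i => (hz i).symm⟩

/-- Every line in the diagonal direction meets the interior in a segment of the same length. -/
theorem exists_chord (h : IsAngleLift w p A) (hw : w < 1) {y : ι → ℝ} (hy : y ∈ interior A) :
    ∃ a : ℝ, (∀ τ : ℝ, (fun i => y i + τ) ∈ interior A ↔ τ ∈ Ioo a (a + w)) ∧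
      ∀ τ : ℝ, angle (fun i => y i + τ) ∈ angle '' interior A ↔
        ∃ m : ℤ, τ + m ∈ Ioo a (a + w) := by
  obtain ⟨b, hb⟩ := h.arc y hy
  have hy0 : (fun i => y i + (0 : ℝ)) ∈ interior A := by simpa using hy
  obtain ⟨m₀, hm₀⟩ := (hb 0).1 (mem_image_of_mem _ hy0)
  have hb' : ∀ τ : ℝ, angle (fun i => y i + τ) ∈ angle '' interior A ↔
      ∃ m : ℤ, τ + m ∈ Ioo (b - m₀) (b - m₀ + w) := by
    intro τ
    rw [hb τ]
    constructor
    · rintro ⟨m, h1, h2⟩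
      exact ⟨m - m₀, by push_cast; linarith, by push_cast; linarith⟩
    · rintro ⟨m, h1, h2⟩
      exact ⟨m + m₀, by push_cast; linarith, by push_cast; linarith⟩
  set a := b - m₀ with ha
  have h0 : a < 0 ∧ 0 < a + w := ⟨by linarith [hm₀.1], by linarith [hm₀.2]⟩
  refine ⟨a, fun τ => ⟨fun hτ => ?_, fun hτ => ?_⟩, hb'⟩
  · have hseg : ∀ s ∈ Icc (0 : ℝ) 1, (fun i => y i + s * τ) ∈ interior A := by
      intro s hs
      have := h.convex.interior hy0 hτ (by linarith [hs.2] : 0 ≤ 1 - s) hs.1 (by ring)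
      convert this using 1
      funext i
      simp
      ring
    -- As w < 1, the ends a and a + w are not congruent modulo 1 to points of the open arc. A
    -- segment of the interior starting at parameter 0 cannot cross them.
    have hno : ∀ s ∈ Icc (0 : ℝ) 1, s * τ ≠ a ∧ s * τ ≠ a + w := by
      intro s hs
      obtain ⟨m, h1, h2⟩ := (hb' _).1 (mem_image_of_mem _ (hseg s hs))
      constructor
      · intro he
        rw [he] at h1 h2
        have h3 : (0 : ℝ) < m := by linarith
        have h4 : (m : ℝ) < 1 := by linarith
        have h3 : 0 < m := by exact_mod_cast h3
        have h4 : m < 1 := by exact_mod_cast h4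
        omega
      · intro he
        rw [he] at h1 h2
        have h3 : (-1 : ℝ) < m := by linarith
        have h4 : (m : ℝ) < 0 := by linarith
        have h3 : -1 < m := by exact_mod_cast h3
        have h4 : m < 0 := by exact_mod_cast h4
        omega
    constructor
    · by_contra hcon
      push Not at hcon
      have hτ0 : τ < 0 := by linarith
      refine (hno (a / τ) ⟨div_nonneg_of_nonpos h0.1.le hτ0.le, ?_⟩).1 (div_mul_cancel₀ _ hτ0.ne)
      rw [div_le_one_of_neg hτ0]
      exact hcon
    · by_contra hcon
      push Not at hcon
      have hτ0 : 0 < τ := by linarith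
      refine (hno ((a + w) / τ) ⟨div_nonneg h0.2.le hτ0.le, ?_⟩).2 (div_mul_cancel₀ _ hτ0.ne')
      rw [div_le_one hτ0]
      exact hcon
  -- Conversely, the parameters in the arc are covered by the open sets belonging to z = 0 and to z
  -- ≠ 0. These are disjoint by injectivity, so connectedness leaves only the first.
  · set U : Set ℝ := {τ | (fun i => y i + τ) ∈ interior A} with hU
    set V : Set ℝ := ⋃ (z : ι → ℤ) (_ : z ≠ 0), {τ : ℝ | (fun i => y i + τ + z i) ∈ interior A}
      with hV
    have hUo : IsOpen U := isOpen_interior.preimage (by fun_prop)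
    have hVo : IsOpen V := isOpen_iUnion fun z => isOpen_iUnion fun _ =>
      isOpen_interior.preimage (by fun_prop)
    have hUV : Disjoint U V := by
      rw [disjoint_left]
      intro σ h1 h2
      simp only [hV, mem_iUnion] at h2
      obtain ⟨z, hz, h2⟩ := h2
      have := h.injOn h2 h1 (angle_add_int (fun i => y i + σ) z)
      apply hz
      funext i
      have := congrFun this i
      simpa using this
    have hcov : Ioo a (a + w) ⊆ U ∪ V := by
      intro σ hσ
      obtain ⟨x, hx, hxy⟩ := (hb' σ).2 ⟨0, by simpa using hσ⟩
      obtain ⟨z, hz⟩ := angle_eq_iff.1 hxy.symm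
      have hxz : x = fun i => y i + σ + z i := funext hz
      by_cases h1 : z = 0
      · left
        rw [hxz, h1] at hx
        simpa [hU] using hx
      · right
        rw [hxz] at hx
        exact mem_iUnion₂.2 ⟨z, h1, hx⟩
    exact isPreconnected_Ioo.subset_left_of_subset_union hUo hVo hUV hcov ⟨0, h0, hy0⟩ hτ

/-- y + τ + z projects into the arc of the diagonal of y, so y + τ + m is interior for some integer
m and has the same projection. Injectivity gives z = m. -/
theorem packing (h : IsAngleLift w p A) (hw : w < 1) {y : ι → ℝ} {τ : ℝ} {z : ι → ℤ} (hy : y ∈ interior A)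
    (hz : (fun i => y i + τ + z i) ∈ interior A) : ∃ m : ℤ, ∀ i, z i = m := by
  obtain ⟨a, h1, h2⟩ := h.exists_chord hw hy
  obtain ⟨m, hm⟩ := (h2 τ).1 ⟨_, hz, angle_add_int (fun i => y i + τ) z⟩
  have h3 := (h1 _).2 hm
  have h4 : angle (fun i => y i + (τ + m)) = angle (fun i => y i + τ + z i) := by
    rw [angle_add_int (fun i => y i + τ) z, ← angle_add_int (fun i => y i + τ) fun _ => m]
    simp only [add_assoc]
  have h5 := h.injOn h3 hz h4
  refine ⟨m, fun i => ?_⟩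
  have := congrFun h5 i
  have : (m : ℝ) = z i := by linarith
  exact_mod_cast this.symm

/-- Interior points lie on closed chords of length w, and the pairs of a position and a lower end
form a compact set, so this passes to the closure. -/
theorem exists_chord_of_mem (h : IsAngleLift w p A) (hw : w < 1) (hA : (interior A).Nonempty) {y : ι → ℝ}
    (hy : y ∈ A) : ∃ τ ∈ Icc 0 w, (fun i => y i - τ) ∈ A ∧ (fun i => y i - τ + w) ∈ A := by
  have hcl : A ⊆ closure (interior A) := by
    rw [h.convex.closure_interior_eq_closure_of_nonempty_interior hA]
    exact subset_closure
  set K : Set (ℝ × (ι → ℝ)) := (Icc 0 w ×ˢ A) ∩ {v | (fun i => v.2 i + w) ∈ A} with hK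
  have hKc : IsCompact K := (isCompact_Icc.prod h.isCompact).inter_right
    (h.isCompact.isClosed.preimage (by fun_prop))
  have hKi : IsClosed ((fun v : ℝ × (ι → ℝ) => fun i => v.2 i + v.1) '' K) :=
    (hKc.image (by fun_prop)).isClosed
  have hsub : interior A ⊆ (fun v : ℝ × (ι → ℝ) => fun i => v.2 i + v.1) '' K := by
    intro x hx
    obtain ⟨a, h1, -⟩ := h.exists_chord hw hx
    have h0 : (0 : ℝ) ∈ Ioo a (a + w) := (h1 0).1 (by simpa using hx)
    have hcont : Continuous fun τ : ℝ => fun i => x i + τ := by fun_prop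
    have hIcc : ∀ τ ∈ Icc a (a + w), (fun i => x i + τ) ∈ A := by
      intro τ hτ
      rw [← closure_Ioo (by linarith [h0.1, h0.2] : a ≠ a + w)] at hτ
      have hmap : MapsTo (fun τ : ℝ => fun i => x i + τ) (Ioo a (a + w)) A :=
        fun σ hσ => interior_subset ((h1 σ).2 hσ)
      have := hmap.closure hcont hτ
      rwa [h.isCompact.isClosed.closure_eq] at this
    refine ⟨(-a, fun i => x i + a), ⟨⟨⟨by linarith [h0.1], by linarith [h0.2]⟩,
      hIcc a ⟨le_rfl, by linarith [h0.1, h0.2]⟩⟩, ?_⟩, ?_⟩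
    · have := hIcc (a + w) ⟨by linarith [h0.1, h0.2], le_rfl⟩
      simpa only [mem_ofPred_eq, add_assoc] using this
    · funext i; simp
  obtain ⟨⟨τ, v⟩, ⟨⟨hτ, hv⟩, hv'⟩, rfl⟩ := closure_minimal hsub hKi (hcl hy)
  exact ⟨τ, hτ, by simpa using hv, by simpa using hv'⟩

/-- A longer chord, contracted by w/τ towards an interior point, would give two interior points
exactly w apart on a diagonal which meets the interior in an open segment of length w. -/
theorem chord_le (h : IsAngleLift w p A) (hw : w < 1) (hA : (interior A).Nonempty) {y : ι → ℝ} {τ : ℝ}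
    (hy : y ∈ A) (hτ : (fun i => y i + τ) ∈ A) : τ ≤ w := by
  obtain ⟨c, hc⟩ := hA
  have hw0 : 0 < w := by
    obtain ⟨a, h1, -⟩ := h.exists_chord hw hc
    have h0 : (0 : ℝ) ∈ Ioo a (a + w) := (h1 0).1 (by simpa using hc)
    linarith [h0.1, h0.2]
  by_contra hcon
  push Not at hcon
  have hτ0 : 0 < τ := hw0.trans hcon
  have hs : w / τ < 1 := (div_lt_one hτ0).2 hcon
  have hs0 : 0 < w / τ := div_pos hw0 hτ0
  have hmem : ∀ x ∈ A, (w / τ) • x + (1 - w / τ) • c ∈ interior A := fun x hx =>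
    h.convex.combo_self_interior_mem_interior hx hc hs0.le (by linarith) (by ring)
  have h1 := hmem _ hy
  have h2 := hmem _ hτ
  obtain ⟨a, h3, -⟩ := h.exists_chord hw h1
  have h0 : (0 : ℝ) ∈ Ioo a (a + w) := (h3 0).1 (by simp only [add_zero]; exact h1)
  have h4 : w ∈ Ioo a (a + w) := by
    refine (h3 w).1 ?_
    convert h2 using 1
    funext i
    simp only [Pi.add_apply, Pi.smul_apply, smul_eq_mul]
    field_simp
    ring
  linarith [h0.1, h4.2]

end IsAngleLift
end

section
variable {ι : Type*}

theorem angle_mem_image_iff {y : ι → ℝ} {A : Set (ι → ℝ)} :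
    angle y ∈ angle '' A ↔ ∃ z : ι → ℤ, (fun i => y i + z i) ∈ A := by
  constructor
  · rintro ⟨x, hx, hxy⟩
    obtain ⟨z, hz⟩ := angle_eq_iff.1 hxy.symm
    exact ⟨z, by rwa [← show x = fun i => y i + z i from funext hz]⟩
  · rintro ⟨z, hz⟩
    exact ⟨_, hz, angle_add_int y z⟩

/-- The points of a coordinate hyperplane which lie in the model piece. -/
theorem angle_mem_image_diagBox_iff [Fintype ι] {ω : ι → ℝ} (hω : ∀ i, 0 < ω i) {i k : ι}
    (hik : i ≠ k) {y : ι → ℝ} (hy : y i = 0) :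
    angle y ∈ angle '' diagBox ω k ↔
      ∃ z : ι → ℤ, z i = 0 ∧ (∀ l, l ≠ i → (y k + z k) - (y l + z l) ∈ Icc (0 : ℝ) 1) ∧
        ∑ j, ω j * (y j + z j) ∈ Icc 0 (ω k) := by
  classical
  rw [angle_mem_image_iff]
  refine exists_congr fun z => ?_
  constructor
  · intro h
    have hz : z i = 0 := eq_zero_of_mem_diagBox_of_int hω (hasSum_fintype ω).summable h hik
      (by simp [hy])
    refine ⟨hz, fun l _ => h.1 l, ?_⟩
    have := h.2
    rwa [tsum_fintype] at this
  · rintro ⟨hz, hc, hh⟩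
    refine ⟨fun l => ?_, by rwa [tsum_fintype]⟩
    -- The condition for l = i, absent on the right, reads 0 ≤ y_k + z_k ≤ 1. It holds because the
    -- remaining coordinates form a point of the smaller box.
    by_cases hl : l = i
    · subst hl
      set ω' : {j // j ≠ l} → ℝ := fun j => ω j with hω'
      have hbox : (fun j : {j // j ≠ l} => y j + z j) ∈ diagBox ω' ⟨k, hik.symm⟩ := by
        refine ⟨fun j => hc j j.2, ?_⟩
        rw [← tsum_fintype (L := SummationFilter.unconditional _),
          tsum_extend_mul (Function.Embedding.subtype (· ≠ l)) (ω := ω') (fun _ => rfl)] at hh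
        · exact hh
        · intro j hj
          have : j = l := by
            by_contra hne
            exact hj ⟨⟨j, hne⟩, rfl⟩
          rw [this, hy, hz]; simp
      have := mem_Icc_of_mem_diagBox (ω := ω') (fun j => hω j) (hasSum_fintype ω').summable hbox
      simpa [hy, hz] using this
    · exact hc l hl

end

/-! ### Compatible partitions: tiles, induction, limit -/

namespace RightToroid
variable {T : RightToroid}

theorem IsConvexLift.isAngleLift {k : T.Idx} {p : Set T.Torus} {A : Set (T.Idx → ℝ)}
    (h : T.IsConvexLift p (T.arcLength k) A) :
    IsAngleLift (T.weight k / T.normSq) p (T.scale ⁻¹' A) := by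
  have him : ∀ B : Set (T.Idx → ℝ), angle '' (T.scale ⁻¹' B) = T.proj '' B := fun B => by
    rw [← proj_image_scale, image_preimage_eq _ T.scale.surjective]
  have hint : interior (T.scale ⁻¹' A) = T.scale ⁻¹' interior A :=
    (T.scale.toHomeomorph.preimage_interior A).symm
  have hN := mul_pos Real.two_pi_pos T.norm_pos
  refine ⟨T.scale.toHomeomorph.isCompact_preimage.2 h.isCompact,
    h.convex.linear_preimage T.scale.toLinearMap, (him A).trans h.image_eq, ?_, ?_⟩
  · rw [hint]
    intro y hy y' hy' he
    rw [← proj_scale, ← proj_scale] at he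
    exact T.scale.injective (h.injOn hy hy' he)
  · rw [hint]
    intro y hy
    rw [him]
    rcases h.diagonal (angle y) with h0 | ⟨a, ha⟩
    · refine absurd h0 (Set.Nonempty.ne_empty ⟨angle y, ⟨0, ?_⟩, ?_⟩)
      · rw [diag_angle]; simp
      · rw [← him]; exact mem_image_of_mem _ hy
    · refine ⟨a / (2 * Real.pi * T.norm), fun τ => ?_⟩
      have h1 := (T.diagonal_inter_eq_image_iff _ _ _).1 ha (τ * (2 * Real.pi * T.norm))
      rw [diag_angle, mul_div_cancel_right₀ _ hN.ne'] at h1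
      rw [h1]
      refine exists_congr fun m => ?_
      rw [← add_mul, mem_Ioo, mem_Ioo, arcLength_eq, div_lt_iff₀ hN,
        div_add' _ _ _ hN.ne', lt_div_iff₀ hN]

namespace IsPythagorean
variable {p : T.Idx → Set T.Torus}

theorem isClosed (h : T.IsPythagorean p) (k : T.Idx) : IsClosed (p k) := by
  rw [h.regular k]; exact isClosed_closure

theorem disjoint_interior (h : T.IsPythagorean p) {i j : T.Idx} (hij : i ≠ j) :
    Disjoint (interior (p i)) (p j) := by
  rw [h.regular j]
  exact (h.disjoint hij).closure_right isOpen_interior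

theorem arcLength_pos (k : T.Idx) : 0 < T.arcLength k :=
  div_pos (mul_pos Real.two_pi_pos (T.weight_pos k)) T.norm_pos

theorem interior_nonempty (h : T.IsPythagorean p) (k : T.Idx) : (interior (p k)).Nonempty := by
  have : Fact (0 < 2 * Real.pi) := ⟨Real.two_pi_pos⟩
  have : IsProbabilityMeasure T.haar := by unfold haar; infer_instance
  obtain ⟨t, a, ha⟩ := (h.diagonal k).exists
  rw [← closure_nonempty_iff, ← h.regular k]
  refine ⟨T.diag t a, ?_⟩
  have : T.diag t a ∈ T.diag t '' Icc a (a + T.arcLength k) :=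
    mem_image_of_mem _ ⟨le_rfl, by linarith [arcLength_pos k]⟩
  rw [← ha] at this
  exact this.2

theorem iUnion_eq [Finite T.Idx] (h : T.IsPythagorean p) : ⋃ k, p k = univ := by
  rw [← h.cover, (isClosed_iUnion_of_finite h.isClosed).closure_eq]

theorem eq_univ_of_subsingleton [Subsingleton T.Idx] (h : T.IsPythagorean p) (k : T.Idx) :
    p k = univ := by
  rw [← h.iUnion_eq]
  refine (subset_iUnion p k).antisymm (iUnion_subset fun j => ?_)
  rw [Subsingleton.elim j k]

end IsPythagorean

theorem card_idx {n : ℕ} (hT : T.dim = n) : Nat.card T.Idx = n := by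
  rw [← Nat.card_fin n]
  exact Nat.card_congr ⟨fun k => ⟨k, Nat.cast_lt.1 (k.2.trans_eq hT)⟩,
    fun k => ⟨k, (Nat.cast_lt.2 k.2).trans_eq hT.symm⟩, fun _ => rfl, fun _ => rfl⟩

/-- The increasing enumeration of a finite set of indices. -/
def enum (J : Finset T.Idx) : {k : ℕ // (k : ℕ∞) < (J.card : ℕ∞)} ↪o T.Idx :=
  OrderEmbedding.ofStrictMono (fun k => J.orderEmbOfFin rfl ⟨k, Nat.cast_lt.1 k.2⟩)
    fun _ _ h => (J.orderEmbOfFin rfl).strictMono h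

theorem range_enum (J : Finset T.Idx) : range (enum J) = J := by
  rw [← J.range_orderEmbOfFin rfl]
  ext i
  constructor
  · rintro ⟨k, rfl⟩; exact ⟨_, rfl⟩
  · rintro ⟨k, rfl⟩; exact ⟨⟨k, Nat.cast_lt.2 k.2⟩, rfl⟩

variable (T) in
/-- The product of finitely many of the circles of a right toroid. -/
def sub (J : Finset T.Idx) (hJ : J.Nonempty) : RightToroid where
  dim := J.card
  dim_pos := Nat.cast_pos.2 hJ.card_pos
  r k := T.r (enum J k)
  r_pos _ := T.r_pos _
  r_anti := T.r_anti.comp_monotone (enum J).monotone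
  r_summable := T.r_summable.comp_injective (enum J).injective

variable (T) in
/-- The inclusion of a finite sub-product. -/
def subHom (J : Finset T.Idx) (hJ : J.Nonempty) : (T.sub J hJ).Hom T :=
  ⟨(enum J).toEmbedding, fun _ => rfl⟩

/-- A choice of Pythagorean partitions which is preserved by all allowable maps. -/
structure IsCompatible (q : ∀ T : RightToroid, T.Idx → Set T.Torus) : Prop where
  isPythagorean : ∀ T : RightToroid, T.IsPythagorean (q T)
  preserves : ∀ {T T' : RightToroid} (φ : T.Hom T'), φ.Preserves (q T) (q T')

namespace IsCompatible
variable {q : ∀ T : RightToroid, T.Idx → Set T.Torus}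

/-- Points supported on J come from the sub-product, to which both partitions restrict. -/
theorem mem_iff_mem_piece (hq : IsCompatible q) {J : Finset T.Idx} {hJ : J.Nonempty}
    (hs : q (T.sub J hJ) = (T.sub J hJ).piece) {k : T.Idx} (hk : k ∈ J) {u : T.Torus}
    (hu : ∀ i, i ∉ J → u i = 0) : u ∈ q T k ↔ u ∈ T.piece k := by
  have hr := range_enum J
  obtain ⟨j, rfl⟩ : k ∈ range (enum J) := by rw [hr]; exact hk
  have hincl : (T.subHom J hJ).incl (fun j => u (enum J j)) = u := by
    funext i
    by_cases hi : i ∈ range (enum J)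
    · obtain ⟨l, rfl⟩ := hi
      exact (enum J).injective.extend_apply _ _ _
    · exact (Function.extend_apply' _ _ _ hi).trans (hu i (by rw [hr] at hi; exact hi)).symm
  have h1 := (hq.preserves (T.subHom J hJ)).preimage_eq j
  have h2 := (T.subHom J hJ).preserves_piece.preimage_eq j
  rw [hs, ← h2] at h1
  have := Set.ext_iff.1 h1 fun j => u (enum J j)
  rw [mem_preimage, mem_preimage, hincl] at this
  exact this

/-- The sub-product is covered by its own pieces, which are restrictions of those with labels in J.
-/
theorem exists_mem (hq : IsCompatible q) {J : Finset T.Idx} {hJ : J.Nonempty} {u : T.Torus}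
    (hu : ∀ i, i ∉ J → u i = 0) : ∃ k ∈ J, u ∈ q T k := by
  have hr := range_enum J
  have : Finite (T.sub J hJ).Idx := (T.sub J hJ).finite_idx (ENat.natCast_ne_top _)
  have hincl : (T.subHom J hJ).incl (fun j => u (enum J j)) = u := by
    funext i
    by_cases hi : i ∈ range (enum J)
    · obtain ⟨l, rfl⟩ := hi
      exact (enum J).injective.extend_apply _ _ _
    · exact (Function.extend_apply' _ _ _ hi).trans (hu i (by rw [hr] at hi; exact hi)).symm
  obtain ⟨j, hj⟩ := mem_iUnion.1
    ((hq.isPythagorean (T.sub J hJ)).iUnion_eq.ge (mem_univ fun j => u (enum J j)))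
  rw [← (hq.preserves (T.subHom J hJ)).preimage_eq j] at hj
  have hu' : (T.subHom J hJ).incl (fun j => u (enum J j)) ∈ q T (enum J j) := hj
  rw [hincl] at hu'
  refine ⟨enum J j, ?_, hu'⟩
  rw [← Finset.mem_coe, ← hr]
  exact mem_range_self j

theorem exists_isTile (hq : IsCompatible q) [Fintype T.Idx] (hcard : 2 ≤ Fintype.card T.Idx)
    (hs : ∀ i hJ, q (T.sub (Finset.univ.erase i) hJ) = (T.sub (Finset.univ.erase i) hJ).piece)
    (k : T.Idx) : ∃ A, IsTile T.weight k A ∧ angle '' A = q T k := by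
  have : Nontrivial T.Idx := Fintype.one_lt_card_iff_nontrivial.1 (by omega)
  have hJ : ∀ i : T.Idx, (Finset.univ.erase i).Nonempty := fun i => by
    obtain ⟨j, hj⟩ := exists_ne i
    exact ⟨j, by simp [hj]⟩
  have hsum : T.normSq = ∑ i, T.weight i := tsum_fintype _
  have hw : T.weight k / T.normSq < 1 := by
    obtain ⟨i, hi⟩ := exists_ne k
    rw [hsum, div_lt_one (hsum ▸ T.normSq_pos)]
    exact Finset.single_lt_sum hi (Finset.mem_univ _) (Finset.mem_univ _) (T.weight_pos i)
      fun j _ _ => (T.weight_pos j).le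
  have hP := hq.isPythagorean T
  obtain ⟨_, hlift⟩ := hP.convex k
  have hB := hlift.isAngleLift
  set B := T.scale ⁻¹' _
  have hBi := hB.interior_nonempty (hP.interior_nonempty k)
  -- A point with y_k integral lies on the subtorus without the circle k, hence in a piece q_j with
  -- j ≠ k, and so not in the interior of q_k.
  have hno : ∀ y ∈ interior B, ∀ m : ℤ, y k ≠ m := by
    intro y hy m hm
    have hyk : angle y k = 0 := by
      have := congrFun (angle_eq_iff.2 ⟨fun _ => -m, fun _ => rfl⟩ :
        angle y = angle fun i => y i + ((-m : ℤ) : ℝ)) k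
      rw [this]
      simp [angle, hm]
    obtain ⟨j, hj, hyj⟩ := hq.exists_mem (J := Finset.univ.erase k) (hJ := hJ k) (u := angle y)
      fun i hi => by
        have : i = k := by simpa using hi
        rw [this, hyk]
    have hyk : angle y ∈ interior (q T k) := by
      have hsub : angle '' interior B ⊆ interior (q T k) :=
        interior_maximal ((image_mono interior_subset).trans hB.image_eq.subset)
          (isOpenMap_angle _ isOpen_interior)
      exact hsub (mem_image_of_mem _ hy)
    exact disjoint_left.1 (hP.disjoint_interior (Finset.ne_of_mem_erase hj).symm) hyk hyj
  obtain ⟨c, hc⟩ := hBi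
  set m := ⌊c k⌋ with hm
  -- The interior is connected, so y_k stays between two consecutive integers on it.
  have hstrip : B ⊆ {y | y k ∈ Icc (m : ℝ) (m + 1)} := by
    have hcl : IsClosed {y : T.Idx → ℝ | y k ∈ Icc (m : ℝ) (m + 1)} :=
      isClosed_Icc.preimage (continuous_apply k)
    have h1 : B ⊆ closure (interior B) := by
      rw [hB.convex.closure_interior_eq_closure_of_nonempty_interior ⟨c, hc⟩]
      exact subset_closure
    refine h1.trans (closure_minimal (fun y hy => ?_) hcl)
    have hpre := hB.convex.interior.isPreconnected
    have hcont : ContinuousOn (fun y : T.Idx → ℝ => y k) (interior B) :=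
      (continuous_apply k).continuousOn
    constructor
    · by_contra hcon
      push Not at hcon
      obtain ⟨x, hx, hxm⟩ := hpre.intermediate_value hy hc hcont ⟨hcon.le, Int.floor_le (c k)⟩
      exact hno x hx m hxm
    · by_contra hcon
      push Not at hcon
      obtain ⟨x, hx, hxm⟩ := hpre.intermediate_value hc hy hcont
        ⟨(Int.lt_floor_add_one (c k)).le, hcon.le⟩
      exact hno x hx (m + 1) (by push_cast; exact hxm)
  have hA := hB.translate (Pi.single k (-m))
  have hAi := hA.interior_nonempty (hP.interior_nonempty k)
  refine ⟨_, ⟨T.weight_pos, hA.isCompact, hA.convex, hAi, ?_, ?_, ?_, ?_, ?_⟩, hA.image_eq⟩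
  · rw [← hsum]; exact fun y hy => hA.exists_chord_of_mem hw hAi hy
  · rw [← hsum]; exact fun y τ hy hτ => hA.chord_le hw hAi hy hτ
  · exact fun y τ z hy hz => hA.packing hw hy hz
  · rintro _ ⟨y, hy, rfl⟩
    have := hstrip hy
    simp only [mem_ofPred_eq] at this
    simp only [Pi.single_eq_same, Int.cast_neg]
    exact ⟨by linarith [this.1], by linarith [this.2]⟩
  · intro i hik y hy
    -- On y_i = 0 the piece is the model piece by the hypothesis on the sub-product without the
    -- circle i.
    rw [← angle_mem_image_iff, hA.image_eq, hq.mem_iff_mem_piece (hs i (hJ i)) (by simp [hik.symm]),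
      piece_eq, angle_mem_image_diagBox_iff T.weight_pos hik hy]
    intro l hl
    have : l = i := by simpa using hl
    rw [this]
    simp [angle, hy]

theorem eq_piece_of_finite (hq : IsCompatible q) (n : ℕ) :
    ∀ T : RightToroid, T.dim = n → q T = T.piece := by
  induction n using Nat.strong_induction_on with
  | _ n ih =>
    intro T hT
    have hfin : Finite T.Idx := T.finite_idx (by rw [hT]; exact ENat.natCast_ne_top n)
    have := Fintype.ofFinite T.Idx
    have hcard : Fintype.card T.Idx = n := by rw [← Nat.card_eq_fintype_card, card_idx hT]
    have hP := hq.isPythagorean T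
    have hP' := T.isPythagorean_piece
    by_cases h2 : 2 ≤ Fintype.card T.Idx
    · refine eq_of_subset_of_iUnion_eq_univ hP'.regular hP.regular hP'.disjoint hP.iUnion_eq
        fun k => ?_
      have hlt : ∀ i : T.Idx, (Finset.univ.erase i).card < n := fun i => by
        rw [← hcard]
        exact Finset.card_lt_card (Finset.erase_ssubset (Finset.mem_univ i))
      obtain ⟨A, hA, hAq⟩ := hq.exists_isTile h2 (fun i hJ => ih _ (hlt i) _ rfl) k
      obtain ⟨z, hz⟩ := hA.exists_sub_mem_diagBox h2
      rw [← hAq, piece_eq]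
      rintro _ ⟨y, hy, rfl⟩
      exact ⟨_, hz y hy, angle_eq_iff.2 ⟨z, fun i => by ring⟩⟩
    · have : Subsingleton T.Idx := Fintype.card_le_one_iff_subsingleton.1 (by omega)
      funext k
      rw [hP.eq_univ_of_subsingleton, hP'.eq_univ_of_subsingleton]

/-- The truncations of an interior point of p k eventually stay in p k, hence in the closed set p'
k, and converge to the point. -/
theorem subset_of_forall_mem {p p' : T.Idx → Set T.Torus} (hp : T.IsPythagorean p)
    (hp' : T.IsPythagorean p') {k : T.Idx}
    (h : ∀ (J : Finset T.Idx) (u : T.Torus), k ∈ J → (∀ i, i ∉ J → u i = 0) →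
      u ∈ p k → u ∈ p' k) : p k ⊆ p' k := by
  rw [hp.regular k]
  refine closure_minimal (fun t ht => ?_) (hp'.isClosed k)
  have hlim : Tendsto (fun J : Finset T.Idx => fun i => if i ∈ J then t i else 0) atTop (𝓝 t) := by
    refine tendsto_pi_nhds.2 fun i => tendsto_const_nhds.congr' ?_
    filter_upwards [eventually_ge_atTop {i}] with J hJ
    rw [if_pos (hJ (by simp))]
  refine (hp'.isClosed k).mem_of_tendsto hlim ?_
  filter_upwards [hlim.eventually (isOpen_interior.mem_nhds ht), eventually_ge_atTop {k}]
    with J hJ hk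
  exact h J _ (hk (by simp)) (fun i hi => if_neg hi) (interior_subset hJ)

/-- The only compatible choice of Pythagorean partitions. -/
theorem eq_piece (hq : IsCompatible q) (T : RightToroid) : q T = T.piece := by
  have h : ∀ (k : T.Idx) (J : Finset T.Idx) (u : T.Torus), k ∈ J → (∀ i, i ∉ J → u i = 0) →
      (u ∈ q T k ↔ u ∈ T.piece k) := fun k J u hk hu =>
    hq.mem_iff_mem_piece (hJ := ⟨k, hk⟩) (hq.eq_piece_of_finite _ _ rfl) hk hu
  funext k
  exact (subset_of_forall_mem (hq.isPythagorean T) T.isPythagorean_piece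
    fun J u hk hu => (h k J u hk hu).1).antisymm
      (subset_of_forall_mem T.isPythagorean_piece (hq.isPythagorean T)
        fun J u hk hu => (h k J u hk hu).2)

end IsCompatible
end RightToroid

/-! ### The manifest functor -/

/-- The partition of a right toroid into the images of the parallelotopes. -/
def pythagoreanFunctor : RightToroid ⥤ PartitionedToroid where
  obj T := ⟨T, T.piece, T.isPythagorean_piece⟩
  map φ := ⟨φ, RightToroid.Hom.preserves_piece φ⟩

theorem isManifest_pythagoreanFunctor : IsManifest pythagoreanFunctor := rfl

namespace PartitionedToroid

theorem exists_eq_mk {X : PartitionedToroid} {T : RightToroid} (h : X.toroid = T) :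
    ∃ (p : T.Idx → Set T.Torus) (hp : T.IsPythagorean p), X = ⟨T, p, hp⟩ := by
  subst h
  exact ⟨X.part, X.isPythagorean, rfl⟩

/-- Equality of functors identifies toroids only up to transport; substituting the objects removes
the `eqToHom` factors. -/
theorem preserves_of_hom_eq {X Y : PartitionedToroid} (f : X ⟶ Y) {T T' : RightToroid}
    (hX : X.toroid = T) (hY : Y.toroid = T') (φ : T ⟶ T')
    (hf : f.hom = eqToHom hX ≫ φ ≫ eqToHom hY.symm)
    {p : T.Idx → Set T.Torus} {hp : T.IsPythagorean p} (hXp : X = ⟨T, p, hp⟩)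
    {p' : T'.Idx → Set T'.Torus} {hp' : T'.IsPythagorean p'} (hYp : Y = ⟨T', p', hp'⟩) :
    RightToroid.Hom.Preserves φ p p' := by
  subst hXp hYp
  have : f.hom = φ := by simpa using hf
  exact this ▸ f.preserves

theorem forget_map_injective {X Y : PartitionedToroid} {f g : X ⟶ Y}
    (h : forget.map f = forget.map g) : f = g :=
  PartitionedToroid.Hom.ext h

end PartitionedToroid

theorem eq_pythagoreanFunctor {Q : RightToroid ⥤ PartitionedToroid} (hQ : IsManifest Q) :
    Q = pythagoreanFunctor := by
  have hobj : ∀ T, (Q.obj T).toroid = T := Functor.congr_obj hQ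
  choose q hq hQq using fun T => PartitionedToroid.exists_eq_mk (hobj T)
  have hc : RightToroid.IsCompatible q := ⟨hq, fun {T T'} φ =>
    PartitionedToroid.preserves_of_hom_eq (Q.map (X := T) (Y := T') φ) (hobj T) (hobj T') φ
      (Functor.congr_hom hQ (X := T) (Y := T') φ) (hQq T) (hQq T')⟩
  have hobj' : ∀ T, Q.obj T = pythagoreanFunctor.obj T := by
    intro T
    rw [hQq T]
    have h := hc.eq_piece T
    have : ∀ (p : T.Idx → Set T.Torus) (hp : T.IsPythagorean p), p = T.piece →
        (⟨T, p, hp⟩ : PartitionedToroid) = pythagoreanFunctor.obj T := by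
      rintro p hp rfl; rfl
    exact this _ _ h
  refine CategoryTheory.Functor.ext hobj' fun T T' φ => ?_
  apply PartitionedToroid.forget_map_injective
  rw [Functor.map_comp, Functor.map_comp, eqToHom_map, eqToHom_map]
  exact Functor.congr_hom hQ φ

end

theorem theorem3p1 :
    (∀ T : RightToroid, T.IsPythagorean T.piece ∧
      (T.dim ≠ ⊤ → ⋃ k, T.piece k = univ) ∧
      ∀ k, T.IsConvexLift (T.piece k) (T.arcLength k) (T.parallelotope k) ∧
        ∀ t : T.Torus, (∀ j, j ≠ k → t j ≠ t k) →
          ∃ a : ℝ, T.diagonal t ∩ T.piece k = T.diag t '' Icc a (a + T.arcLength k)) ∧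
    ∃ P : RightToroid ⥤ PartitionedToroid, IsManifest P ∧
      (∀ T : RightToroid, ∃ h : T.IsPythagorean T.piece, P.obj T = ⟨T, T.piece, h⟩) ∧
      ∀ Q : RightToroid ⥤ PartitionedToroid, IsManifest Q → Q = P :=
  ⟨fun T => ⟨T.isPythagorean_piece, T.iUnion_piece, fun k =>
      ⟨T.isConvexLift_parallelotope k, fun _ ht => T.exists_diagonal_inter_piece k ht⟩⟩,
    pythagoreanFunctor, isManifest_pythagoreanFunctor,
    fun T => ⟨T.isPythagorean_piece, rfl⟩, fun _ hQ => eq_pythagoreanFunctor hQ⟩
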